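/- Let $d\ge 1$, and let $G$ be a nonempty graph (loops and parallel edges are allowed) with cofinite free $\mathbb Z^d$-symmetry: $\mathbb Z^d$ acts freely on $G$ by graph automorphisms and the quotient graph is finite. For a finite-index subgroup $\Lambda\le\mathbb Z^d$ let $G_\Lambda=G/\Lambda$ be the finite quotient graph, let $T(G_\Lambda)$ be its complexity, that is, the product over its connected components of their numbers of spanning trees, and let $\langle\Lambda\rangle$ be the minimal Euclidean length of a nonzero vector of $\Lambda$. The complexity growth rate of $G$ is $$\gamma(G)=\lim_{\langle\Lambda\rangle\to\infty}\frac{1}{|\mathbb Z^d/\Lambda|}\log T(G_\Lambda).$$ Choose one vertex $v_1,\dots,v_n$ in each $\mathbb Z^d$-orbit of vertices. The Laplacian polynomial of $G$ is $\Delta(G)=\det(D-A)\in\mathbb Z[\mathbb Z^d]=\mathbb Z[x_1^{\pm1},\dots,x_d^{\pm1}]$, where $D$ is the diagonal matrix of the degrees of $v_1,\dots,v_n$, and the coefficient of $x^{\mathbf s}$ in $A_{ij}$ is the number of edges of $G$ between $v_i$ and $\mathbf s\cdot v_j$ (loops of $G$ are ignored in $D$ and in $A$). The logarithmic Mahler measure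 of a nonzero $f\in\mathbb Z[\mathbb Z^d]$ is $m(f)=\int_{[0,1]^d}\log|f(e^{2\pi i\theta_1},\dots,e^{2\pi i\theta_d})|\,d\theta$. Let $\mathbb G_d$ be the $d$-dimensional grid graph, with vertex set $\mathbb Z^d$ and one edge between any two points that differ by a standard basis vector, on which $\mathbb Z^d$ acts by translation. If $G$ has finitely many connected components, then the limits defining $\gamma(G)$ and $\gamma(\mathbb G_d)$ exist, and $\gamma(G)\ge\gamma(\mathbb G_d)$. Moreover $\Delta(G)$ and $\Delta(\mathbb G_d)$ are nonzero, the integrals defining their logarithmic Mahler measures converge, and $m(\Delta(G))\ge m(\Delta(\mathbb G_d))$ (for every choice of the vertices $v_1,\dots,v_n$). -/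

import Mathlib

open Filter Topology MeasureTheory

namespace Graph

section Finite

variable {α β : Type*}

/-- `G.Reachable x y`: the vertices `x` and `y` are joined by a walk in the multigraph `G`. -/
def Reachable (G : Graph α β) : α → α → Prop :=
  Relation.ReflTransGen G.Adj

/-- The (vertex sets of the) connected components of a multigraph. -/
def components (G : Graph α β) : Set (Set α) :=
  {C | ∃ x ∈ G.vertexSet, C = {y | G.Reachable x y}}

/-- A multigraph is connected if it has a vertex and any two of its vertices are joined by a
walk. -/
structure IsConnected (G : Graph α β) : Prop where
  nonempty : G.vertexSet.Nonempty
  reachable : ∀ x ∈ G.vertexSet, ∀ y ∈ G.vertexSet, G.Reachable x y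

/-- A multigraph is acyclic if no edge lies on a cycle, that is, if deleting any edge disconnects
its two ends from each other. In particular there are no loops and no parallel edges. -/
def IsAcyclic (G : Graph α β) : Prop :=
  ∀ e x y, G.IsLink e x y → ¬ (G.deleteEdges {e}).Reachable x y

/-- A tree is a connected acyclic multigraph. -/
structure IsTree (G : Graph α β) : Prop where
  connected : G.IsConnected
  acyclic : G.IsAcyclic

/-- The set of spanning trees of `G`; a spanning tree is given by its set of edges, the graph
`G.restrict F` having all vertices of `G` and the edge set `F`. -/
def spanningTrees (G : Graph α β) : Set (Set β) :=
  {F | F ⊆ G.edgeSet ∧ (G.restrict F).IsTree}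

/-- The number `τ(G)` of spanning trees of a finite multigraph. -/
noncomputable def numSpanningTrees (G : Graph α β) : ℕ :=
  G.spanningTrees.ncard

/-- The complexity `T(G)` of a finite multigraph: the product over its connected components of
their numbers of spanning trees. -/
noncomputable def complexity (G : Graph α β) : ℕ :=
  ∏ᶠ C ∈ G.components, (G.induce C).numSpanningTrees

end Finite

section Symmetry

variable {d : ℕ} {V E : Type*} [AddAction (Fin d → ℤ) V] [AddAction (Fin d → ℤ) E]

/-- `G` is a multigraph with vertex set `V` and edge set `E`, and the given actions of `ℤ ^ d` on
`V` and `E` are a free action by graph automorphisms with finite quotient graph. -/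
structure IsCofiniteFree (d : ℕ) {V E : Type*} [AddAction (Fin d → ℤ) V]
    [AddAction (Fin d → ℤ) E] (G : Graph V E) : Prop where
  vertexSet_eq : G.vertexSet = Set.univ
  edgeSet_eq : G.edgeSet = Set.univ
  vadd_isLink : ∀ (s : Fin d → ℤ) (e : E) (x y : V),
    G.IsLink e x y → G.IsLink (s +ᵥ e) (s +ᵥ x) (s +ᵥ y)
  free_vertex : ∀ (s : Fin d → ℤ) (x : V), s +ᵥ x = x → s = 0
  free_edge : ∀ (s : Fin d → ℤ) (e : E), s +ᵥ e = e → s = 0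
  finite_vertex : Finite (AddAction.orbitRel.Quotient (Fin d → ℤ) V)
  finite_edge : Finite (AddAction.orbitRel.Quotient (Fin d → ℤ) E)

/-- The quotient graph `G_Λ` of `G` by a subgroup `Λ` of `ℤ ^ d`: its vertices and edges are the
`Λ`-orbits of vertices and edges of `G`, with the induced incidence. -/
def quotientGraph {G : Graph V E} (hG : G.IsCofiniteFree d) (Λ : AddSubgroup (Fin d → ℤ)) :
    Graph (AddAction.orbitRel.Quotient Λ V) (AddAction.orbitRel.Quotient Λ E) where
  vertexSet := Set.univ
  IsLink e x y := ∃ e' x' y', Quotient.mk'' e' = e ∧ Quotient.mk'' x' = x ∧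
    Quotient.mk'' y' = y ∧ G.IsLink e' x' y'
  isLink_symm := by
    intro e _
    refine ⟨?_⟩
    rintro x y ⟨e', x', y', he, hx, hy, h⟩
    exact ⟨e', y', x', he, hy, hx, h.symm⟩
  eq_or_eq_of_isLink_of_isLink := by
    rintro e x y v w ⟨e₁, x₁, y₁, rfl, rfl, rfl, h₁⟩ ⟨e₂, v₂, w₂, he, rfl, rfl, h₂⟩
    obtain ⟨s, hs⟩ := Quotient.exact he
    have hs' : (s : Fin d → ℤ) +ᵥ e₁ = e₂ := hs
    have h₃ := hG.vadd_isLink s e₁ x₁ y₁ h₁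
    rw [hs'] at h₃
    have key : ∀ z : V, (Quotient.mk'' ((s : Fin d → ℤ) +ᵥ z) :
        AddAction.orbitRel.Quotient Λ V) = Quotient.mk'' z :=
      fun z => Quotient.sound ⟨s, rfl⟩
    rcases h₃.left_eq_or_eq h₂ with h | h
    · left
      rw [← h, key]
    · right
      rw [← h, key]
  left_mem_of_isLink := fun _ _ _ _ => Set.mem_univ _

/-- The length `⟨Λ⟩` of a shortest nonzero vector of the subgroup `Λ` of `ℤ ^ d`. -/
noncomputable def minLength (Λ : AddSubgroup (Fin d → ℤ)) : ℝ :=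
  sInf {r : ℝ | ∃ v ∈ Λ, v ≠ 0 ∧ r = √(∑ i, (v i : ℝ) ^ 2)}

/-- The filter "`⟨Λ⟩ → ∞`", where `Λ` ranges over the finite-index subgroups of `ℤ ^ d`. -/
noncomputable def minLengthAtTop (d : ℕ) : Filter (AddSubgroup (Fin d → ℤ)) :=
  comap minLength atTop ⊓ 𝓟 {Λ | Λ.FiniteIndex}

/-- The normalized logarithmic complexity `log T(G_Λ) / |ℤ ^ d / Λ|` of the quotient `G_Λ`. -/
noncomputable def normalizedLogComplexity {G : Graph V E} (hG : G.IsCofiniteFree d)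
    (Λ : AddSubgroup (Fin d → ℤ)) : ℝ :=
  Real.log ((quotientGraph hG Λ).complexity : ℝ) / (Λ.index : ℝ)

/-- The complexity growth rate `γ(G)`: the limit of `log T(G_Λ) / |ℤ ^ d / Λ|` as `⟨Λ⟩ → ∞`
(an unspecified number if the limit does not exist). -/
noncomputable def complexityGrowthRate {G : Graph V E} (hG : G.IsCofiniteFree d) : ℝ :=
  limUnder (minLengthAtTop d) (normalizedLogComplexity hG)

/-- The family `v 0, …, v (n - 1)` contains exactly one vertex of each `ℤ ^ d`-orbit, so that every
vertex is uniquely of the form `s +ᵥ v i`. -/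
def IsTransversal (d : ℕ) {V : Type*} [AddAction (Fin d → ℤ) V] {n : ℕ} (v : Fin n → V) : Prop :=
  Function.Bijective fun p : Fin n × (Fin d → ℤ) => p.2 +ᵥ v p.1

/-- The Laplacian matrix `D - A` of `G` over the Laurent polynomial ring `ℤ[ℤ ^ d]`, with respect
to representatives `v i` of the vertex orbits. `D` is the diagonal matrix of the degrees of the
`v i`, and the coefficient of `x ^ s` in `A i j` is the number of edges between `v i` and
`s +ᵥ v j`. Loops are ignored. -/
noncomputable def laplacianMatrix (d : ℕ) {V E : Type*} [AddAction (Fin d → ℤ) V]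
    (G : Graph V E) {n : ℕ} (v : Fin n → V) :
    Matrix (Fin n) (Fin n) (AddMonoidAlgebra ℤ (Fin d → ℤ)) :=
  Matrix.diagonal (fun i => ((Nat.card {e // G.IsNonloopAt e (v i)} : ℕ) :
    AddMonoidAlgebra ℤ (Fin d → ℤ))) -
  Matrix.of fun i j => ∑ᶠ s : Fin d → ℤ, AddMonoidAlgebra.single s
    ((Nat.card {e // G.IsLink e (v i) (s +ᵥ v j) ∧ v i ≠ s +ᵥ v j} : ℕ) : ℤ)

/-- The Laplacian polynomial `Δ(G)`, the determinant of the Laplacian matrix. -/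
noncomputable def laplacianPolynomial (d : ℕ) {V E : Type*} [AddAction (Fin d → ℤ) V]
    (G : Graph V E) {n : ℕ} (v : Fin n → V) :
    AddMonoidAlgebra ℤ (Fin d → ℤ) :=
  (G.laplacianMatrix d v).det

end Symmetry

end Graph

/-- The value of the Laurent polynomial `f` at the point `(exp (2πi θ₁), …, exp (2πi θ_d))`. -/
noncomputable def torusEval {d : ℕ} (f : AddMonoidAlgebra ℤ (Fin d → ℤ)) (θ : Fin d → ℝ) : ℂ :=
  f.coeff.sum fun s c => (c : ℂ) *
    ∏ j, Complex.exp (2 * Real.pi * Complex.I * (θ j : ℂ)) ^ (s j)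

/-- The function whose integral over the unit cube is the logarithmic Mahler measure of `f`. -/
noncomputable def logAbsTorusEval {d : ℕ} (f : AddMonoidAlgebra ℤ (Fin d → ℤ)) (θ : Fin d → ℝ) :
    ℝ :=
  Real.log ‖torusEval f θ‖

/-- The logarithmic Mahler measure `m(f)` of a nonzero Laurent polynomial `f`. -/
noncomputable def logMahlerMeasureTorus {d : ℕ} (f : AddMonoidAlgebra ℤ (Fin d → ℤ)) : ℝ :=
  ∫ θ in Set.Icc (0 : Fin d → ℝ) 1, logAbsTorusEval f θ

/-- An edge of the grid graph: the segment from the lattice point `base` to `base + e_dir`. -/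
@[ext]
structure GridEdge (d : ℕ) where
  base : Fin d → ℤ
  dir : Fin d

instance GridEdge.instAddAction (d : ℕ) : AddAction (Fin d → ℤ) (GridEdge d) where
  vadd s e := ⟨s + e.base, e.dir⟩
  zero_vadd _ := GridEdge.ext (zero_add _) rfl
  add_vadd _ _ _ := GridEdge.ext (add_assoc _ _ _) rfl

/-- The `d`-dimensional grid graph: its vertices are the points of `ℤ ^ d`, and any two points that
differ by a standard basis vector are joined by one edge. -/
def gridGraph (d : ℕ) : Graph (Fin d → ℤ) (GridEdge d) where
  vertexSet := Set.univ
  IsLink e x y := (x = e.base ∧ y = e.base + Pi.single e.dir 1) ∨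
    (y = e.base ∧ x = e.base + Pi.single e.dir 1)
  isLink_symm := fun _ _ => ⟨fun _ _ h => h.symm⟩
  eq_or_eq_of_isLink_of_isLink := by
    rintro e x y v w (⟨rfl, rfl⟩ | ⟨rfl, rfl⟩) (⟨rfl, rfl⟩ | ⟨rfl, rfl⟩) <;> simp
  left_mem_of_isLink := fun _ _ _ _ => Set.mem_univ _

/-- The grid graph with the translation action has cofinite free `ℤ ^ d`-symmetry. -/
theorem gridGraph_isCofiniteFree (d : ℕ) : (gridGraph d).IsCofiniteFree d where
  vertexSet_eq := rfl
  edgeSet_eq := by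
    ext e
    simp only [Set.mem_univ, iff_true]
    exact ⟨e.base, e.base + Pi.single e.dir 1, Or.inl ⟨rfl, rfl⟩⟩
  vadd_isLink := by
    rintro s e x y (⟨rfl, rfl⟩ | ⟨rfl, rfl⟩)
    · exact Or.inl ⟨rfl, (add_assoc _ _ _).symm⟩
    · exact Or.inr ⟨rfl, (add_assoc _ _ _).symm⟩
  free_vertex := fun s x h => add_eq_right.mp (show s + x = x from h)
  free_edge := fun s e h => by
    have h' : s + e.base = e.base := congrArg GridEdge.base h
    exact add_eq_right.mp h'
  finite_vertex := by
    refine Finite.of_surjective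
      (fun _ : Unit => (Quotient.mk'' 0 : AddAction.orbitRel.Quotient (Fin d → ℤ) (Fin d → ℤ))) ?_
    intro q
    induction q using Quotient.inductionOn' with
    | h x => exact ⟨(), Quotient.sound ⟨-x, show -x + x = 0 from neg_add_cancel x⟩⟩
  finite_edge := by
    refine Finite.of_surjective
      (fun i : Fin d => (Quotient.mk'' ⟨0, i⟩ :
        AddAction.orbitRel.Quotient (Fin d → ℤ) (GridEdge d))) ?_
    intro q
    induction q using Quotient.inductionOn' with
    | h e => exact ⟨e.dir, Quotient.sound
        ⟨-e.base, GridEdge.ext (show -e.base + e.base = 0 from neg_add_cancel _) rfl⟩⟩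

/-- The Laplacian polynomial of the grid graph (with the origin representing the only vertex
orbit). -/
noncomputable def gridLaplacianPolynomial (d : ℕ) : AddMonoidAlgebra ℤ (Fin d → ℤ) :=
  (gridGraph d).laplacianPolynomial d fun _ : Fin 1 => (0 : Fin d → ℤ)

/-! Growth rate and Mahler measure are both equal to the integral of log |Δ| over the torus, and
this integral is compared with that of the grid by contracting edges.

At a point θ the Laplacian matrix is a Gram matrix B(θ)*B(θ), with B the twisted coboundary
(`IsPresentation.map_laplacianMatrix`). If an edge joins two different vertex orbits, a column
operation of determinant 1 turns its row into a multiple of a basis vector, and deleting the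
corresponding column does not increase the Gram determinant (`det_gram_submatrix_le`); this
contracts the edge orbit. When every edge stays within one vertex orbit, B*B is diagonal and its
entries are Laplacians of Cayley graphs of ℤ^d. Finiteness of the number of components forces the
edge shifts at each remaining orbit to generate a subgroup of finite index, so some d of them are
linearly independent. Hence Δ ≥ ∏ L_c over K ≥ 1 nonsingular integer matrices c, where L_c = ∑ |1 -
χ_{c i}|² over the rows of c (`exists_prod_le_det`). Each L_c is the grid Laplacian pulled back by
the torus endomorphism c, which preserves Haar measure. So the integral for G is at least K times
that of the grid, and the latter is nonnegative, being a limit of logarithms of natural numbers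
divided by indices.

For the growth rate, the Fourier transform on ℤ^d/Λ block-diagonalizes the Laplacian of G_Λ
(`charpoly_quotientLaplacian`). By the matrix-tree theorem the trailing coefficient of its
characteristic polynomial is T(G_Λ) up to a factor polynomial in the index
(`Graph.exists_trailingCoeff_charpoly`). Thus the normalized logarithm is, up to o(1), an average of
log |Δ| over the annihilator of Λ, with a correction at finitely many points. These annihilators
become equidistributed. The singularities of the logarithm are controlled by the same product bound:
it gives Δ^(-p) ≤ ∑ |1 - χ|^(-1/2), and each summand has average at most 4 over every annihilator,
uniformly in Λ (`sum_addChar_invSqrtDist_le`). The same estimate makes log |Δ| integrable. -/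

set_option linter.unusedSectionVars false

/-! ### The Cauchy–Binet formula -/

namespace Matrix

variable {m n R : Type*} [Fintype m] [DecidableEq m] [Fintype n] [DecidableEq n] [CommRing R]

/-- Expansion of `det (A * B)` over all functions from the row index to the inner index. -/
theorem det_mul_eq_sum_prod (A : Matrix m n R) (B : Matrix n m R) :
    (A * B).det = ∑ f : m → n, (∏ i, A i (f i)) * (B.submatrix f id).det := by
  have h : (A * B) = fun i => ∑ k, A i k • B k := by
    ext i j
    simp [Matrix.mul_apply, Finset.sum_apply]
  change detRowAlternating (A * B) = _
  rw [h]
  have := (detRowAlternating (n := m) (R := R)).toMultilinearMap.map_sum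
    (fun i k => A i k • B k)
  refine this.trans (Finset.sum_congr rfl fun f _ => ?_)
  exact (detRowAlternating (n := m) (R := R)).toMultilinearMap.map_smul_univ
    (fun i => A i (f i)) (fun i => B (f i))

/-- The Cauchy–Binet formula, as a sum over functions. -/
theorem factorial_mul_det_mul (A : Matrix m n R) (B : Matrix n m R) :
    ((Fintype.card m).factorial : R) * (A * B).det =
      ∑ f : m → n, (A.submatrix id f).det * (B.submatrix f id).det := by
  -- Reindexing the functions by σ permutes the rows of the second minor and produces sign σ.
  -- Averaging over all σ then assembles the products of entries of `A` into a determinant.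
  have h : ∀ σ : Equiv.Perm m, (A * B).det =
      ∑ f : m → n, (Equiv.Perm.sign σ : R) * (∏ i, A i (f (σ i))) * (B.submatrix f id).det := by
    intro σ
    rw [det_mul_eq_sum_prod, ← Equiv.sum_comp (Equiv.arrowCongr σ (Equiv.refl n)).symm]
    refine Finset.sum_congr rfl fun f _ => ?_
    have : (B.submatrix (f ∘ σ) id).det = (Equiv.Perm.sign σ : R) * (B.submatrix f id).det := by
      rw [← Matrix.det_permute]
      rfl
    change (∏ i, A i (f (σ i))) * (B.submatrix (f ∘ σ) id).det = _
    rw [this]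
    ring
  have h2 : ((Fintype.card m).factorial : R) * (A * B).det =
      ∑ _σ : Equiv.Perm m, (A * B).det := by
    simp [Fintype.card_perm]
  rw [h2, Finset.sum_congr rfl fun σ _ => h σ, Finset.sum_comm]
  refine Finset.sum_congr rfl fun f _ => ?_
  rw [← Finset.sum_mul]
  congr 1
  rw [← Matrix.det_transpose, Matrix.det_apply']
  rfl

end Matrix

/-! ### The matrix-tree theorem for principal minors -/

section MatrixTree

variable {α β : Type*} (s t : β → α)

/-- Two vertices are joined by an edge of `F`, where the edge `e` has ends `s e` and `t e`. -/
def EdgeAdj (F : Set β) (x y : α) : Prop :=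
  ∃ e ∈ F, (s e = x ∧ t e = y) ∨ (s e = y ∧ t e = x)

/-- Every vertex of `U` can be reached through edges of `F` from a vertex outside `U`. -/
def SpansFrom (U : Finset α) (F : Set β) : Prop :=
  ∀ x, ∃ r ∉ U, Relation.ReflTransGen (EdgeAdj s t F) r x

variable [DecidableEq α]

/-- The oriented incidence matrix of the multigraph whose edge `e` has ends `s e` and `t e`. -/
def incidenceMatrix : Matrix α β ℤ :=
  Matrix.of fun x e => (if s e = x then 1 else 0) - (if t e = x then 1 else 0)

/-- The signed edge vector of a path from a root to x has boundary the indicator of x on `U`, since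
the root lies outside `U`. These vectors are the columns of an integral right inverse. -/
theorem incidenceMatrix_isUnit_det {U : Finset α} {f : U → β}
    (h : SpansFrom s t U (Set.range f)) :
    IsUnit ((incidenceMatrix s t).submatrix (Subtype.val : U → α) f).det := by
  have key : ∀ x : α, ∃ q : U → ℤ, ∀ z : U,
      ∑ y, incidenceMatrix s t z (f y) * q y = if z.1 = x then 1 else 0 := by
    intro x
    obtain ⟨r, hr, hx⟩ := h x
    induction hx with
    | refl =>
      refine ⟨0, fun z => ?_⟩
      rw [if_neg (fun h : z.1 = r => hr (h ▸ z.2))]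
      simp
    | @tail x y _ hxy ih =>
      obtain ⟨q, hq⟩ := ih
      obtain ⟨_, ⟨w, rfl⟩, h1 | h1⟩ := hxy
      · refine ⟨q - Pi.single w 1, fun z => ?_⟩
        simp only [Pi.sub_apply, mul_sub, Finset.sum_sub_distrib, hq]
        rw [Finset.sum_eq_single w (by intro b _ hb; simp [hb]) (by simp)]
        simp only [incidenceMatrix, Matrix.of_apply, h1.1, h1.2, Pi.single_eq_same, mul_one]
        grind
      · refine ⟨q + Pi.single w 1, fun z => ?_⟩
        simp only [Pi.add_apply, mul_add, Finset.sum_add_distrib, hq]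
        rw [Finset.sum_eq_single w (by intro b _ hb; simp [hb]) (by simp)]
        simp only [incidenceMatrix, Matrix.of_apply, h1.1, h1.2, Pi.single_eq_same, mul_one]
        grind
  choose q hq using key
  have : ((incidenceMatrix s t).submatrix (Subtype.val : U → α) f) *
      (Matrix.of fun y x : U => q x y) = 1 := by
    ext z x
    refine (hq x z).trans ?_
    simp only [Matrix.one_apply, Subtype.ext_iff]
  exact Matrix.isUnit_det_of_right_inverse this

/-- The vertices not reachable from a root all lie in `U`, and no edge of the family leaves this
set. Its indicator is therefore a nonzero vector in the left kernel. -/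
theorem incidenceMatrix_det_eq_zero {U : Finset α} {f : U → β}
    (h : ¬ SpansFrom s t U (Set.range f)) :
    ((incidenceMatrix s t).submatrix (Subtype.val : U → α) f).det = 0 := by
  classical
  simp only [SpansFrom, not_forall] at h
  obtain ⟨x, hx⟩ := h
  let P : α → Prop := fun z => ∃ r ∉ U, Relation.ReflTransGen (EdgeAdj s t (Set.range f)) r z
  have hU : ∀ z, ¬ P z → z ∈ U := fun z hz => by
    by_contra h
    exact hz ⟨z, h, .refl⟩
  have hadj : ∀ w, P (s (f w)) ↔ P (t (f w)) := by
    intro w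
    constructor
    · rintro ⟨r, hr, h⟩
      exact ⟨r, hr, h.tail ⟨f w, ⟨w, rfl⟩, .inl ⟨rfl, rfl⟩⟩⟩
    · rintro ⟨r, hr, h⟩
      exact ⟨r, hr, h.tail ⟨f w, ⟨w, rfl⟩, .inr ⟨rfl, rfl⟩⟩⟩
  refine Matrix.exists_vecMul_eq_zero_iff.mp
    ⟨fun z : U => if P z then 0 else 1, fun h0 => ?_, ?_⟩
  · have := congrFun h0 ⟨x, hU x hx⟩
    simp only [Pi.zero_apply, ite_eq_left_iff, one_ne_zero, imp_false, not_not] at this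
    exact hx this
  · ext w
    have : ∀ e : α, ∑ z : U, (if P z then (0 : ℤ) else 1) * (if e = z then 1 else 0) =
        if P e then 0 else 1 := by
      intro e
      by_cases he : P e
      · rw [if_pos he]
        refine Finset.sum_eq_zero fun z _ => ?_
        by_cases hz : e = z
        · rw [← hz, if_pos he, zero_mul]
        · rw [if_neg hz, mul_zero]
      · rw [Finset.sum_eq_single ⟨e, hU e he⟩]
        · simp
        · intro b _ hb
          rw [if_neg (fun h : e = b.1 => hb (Subtype.ext h.symm)), mul_zero]
        · simp
    simp only [Matrix.vecMul, dotProduct, Matrix.submatrix_apply, incidenceMatrix, Matrix.of_apply,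
      mul_sub, Finset.sum_sub_distrib, this, hadj, sub_self, Pi.zero_apply]

/-- A repeated edge would give two equal columns in a matrix of unit determinant. -/
theorem SpansFrom.injective {U : Finset α} {f : U → β} (h : SpansFrom s t U (Set.range f)) :
    Function.Injective f := by
  intro x y hxy
  by_contra hne
  have h0 : ((incidenceMatrix s t).submatrix (Subtype.val : U → α) f).det = 0 :=
    Matrix.det_zero_of_column_eq hne (by intro k; simp [hxy])
  have := incidenceMatrix_isUnit_det s t h
  rw [h0] at this
  exact not_isUnit_zero this

variable [Fintype α] [Fintype β] [DecidableEq β]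

/-- The Laplacian matrix of the multigraph whose edge `e` has ends `s e` and `t e`. -/
def multigraphLaplacian : Matrix α α ℤ :=
  incidenceMatrix s t * (incidenceMatrix s t).transpose

open Classical in
/-- The spanning forests rooted at the vertices outside `U`. -/
noncomputable def rootedForests (U : Finset α) : Finset (Finset β) :=
  (Finset.univ.powersetCard U.card).filter fun F => SpansFrom s t U F

theorem mem_rootedForests {U : Finset α} {F : Finset β} :
    F ∈ rootedForests s t U ↔ F.card = U.card ∧ SpansFrom s t U F := by
  simp [rootedForests]

open Classical in
-- A spanning family indexed by `U` is automatically injective, so each forest is the image of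
-- exactly |U|! families, the bijections from `U` onto it.
theorem card_filter_spansFrom_range (U : Finset α) :
    (Finset.univ.filter fun f : U → β => SpansFrom s t U (Set.range f)).card =
      (rootedForests s t U).card * (U.card).factorial := by
  rw [Finset.card_eq_sum_card_fiberwise (f := fun f : U → β => Finset.univ.image f)
    (t := rootedForests s t U)]
  · rw [Finset.sum_const_nat]
    intro F hF
    rw [mem_rootedForests] at hF
    have e : {f : U → β // f ∈ Finset.filter (fun f => Finset.univ.image f = F)
        (Finset.univ.filter fun f : U → β => SpansFrom s t U (Set.range f))} ≃ (U ≃ F) := by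
      refine ⟨fun f => Equiv.ofBijective (fun x => ⟨f.1 x, ?_⟩) ?_,
        fun g => ⟨fun x => (g x).1, ?_⟩, ?_, ?_⟩
      · have h := f.2
        simp only [Finset.mem_filter, Finset.mem_univ, true_and] at h
        exact h.2.subset (Finset.mem_image_of_mem _ (Finset.mem_univ _))
      · have h := f.2
        simp only [Finset.mem_filter, Finset.mem_univ, true_and] at h
        rw [Fintype.bijective_iff_injective_and_card]
        refine ⟨fun x y hxy => SpansFrom.injective s t h.1 ?_, ?_⟩
        · simpa using hxy
        · simp [hF.1]
      · have h : Finset.univ.image (fun x => (g x).1) = F := by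
          ext b
          simp only [Finset.mem_image, Finset.mem_univ, true_and]
          constructor
          · rintro ⟨a, rfl⟩
            exact (g a).2
          · intro hb
            exact ⟨g.symm ⟨b, hb⟩, by simp⟩
        have h2 : Set.range (fun x => (g x).1) = F := by
          have := congrArg (fun S : Finset β => (S : Set β)) h
          simpa using this
        simp only [Finset.mem_filter, Finset.mem_univ, true_and, h2, h, and_true]
        exact hF.2
      · intro f
        rfl
      · intro g
        ext x
        rfl
    rw [← Fintype.card_coe, Fintype.card_congr e, Fintype.card_equiv (Fintype.equivOfCardEq _)]
    · simp
    · simp [hF.1]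
  · intro f hf
    simp only [Finset.coe_filter, Finset.mem_univ, true_and, Set.mem_ofPred_eq] at hf
    simp only [Finset.mem_coe, mem_rootedForests]
    refine ⟨?_, by simpa using hf⟩
    rw [Finset.card_image_of_injective _ (SpansFrom.injective s t hf)]
    simp

/-- The all-minors matrix-tree theorem for principal minors. -/
theorem det_submatrix_multigraphLaplacian (U : Finset α) :
    ((multigraphLaplacian s t).submatrix (Subtype.val : U → α) Subtype.val).det =
      (rootedForests s t U).card := by
  classical
  have h1 : (multigraphLaplacian s t).submatrix (Subtype.val : U → α) Subtype.val =
      (incidenceMatrix s t).submatrix (Subtype.val : U → α) id *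
        ((incidenceMatrix s t).submatrix (Subtype.val : U → α) id).transpose := by
    ext x y
    simp [multigraphLaplacian, Matrix.mul_apply]
  have h2 := Matrix.factorial_mul_det_mul ((incidenceMatrix s t).submatrix (Subtype.val : U → α) id)
    ((incidenceMatrix s t).submatrix (Subtype.val : U → α) id).transpose
  -- Each Cauchy–Binet term is the square of a determinant that is 0 or ±1.
  have h3 : ∀ f : U → β,
      (((incidenceMatrix s t).submatrix (Subtype.val : U → α) id).submatrix id f).det *
      (((incidenceMatrix s t).submatrix (Subtype.val : U → α) id).transpose.submatrix f id).det =
      if SpansFrom s t U (Set.range f) then 1 else 0 := by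
    intro f
    have : (((incidenceMatrix s t).submatrix (Subtype.val : U → α) id).transpose.submatrix f id) =
      (((incidenceMatrix s t).submatrix (Subtype.val : U → α) id).submatrix id f).transpose := rfl
    rw [this, Matrix.det_transpose]
    change ((incidenceMatrix s t).submatrix (Subtype.val : U → α) f).det *
      ((incidenceMatrix s t).submatrix (Subtype.val : U → α) f).det = _
    split_ifs with h
    · rcases Int.isUnit_iff.mp (incidenceMatrix_isUnit_det s t h) with h | h <;> rw [h] <;> rfl
    · rw [incidenceMatrix_det_eq_zero s t h, zero_mul]
  rw [Finset.sum_congr rfl fun f _ => h3 f, Finset.sum_boole, card_filter_spansFrom_range,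
    ← h1] at h2
  have h4 : ((U.card).factorial : ℤ) ≠ 0 := by exact_mod_cast Nat.factorial_ne_zero _
  refine mul_left_cancel₀ h4 ?_
  rw [Fintype.card_coe] at h2
  rw [h2]
  push_cast
  ring

/-- Without a forest the minor B Bᵀ is singular. A kernel vector y then satisfies y B = 0, because y
B Bᵀ yᵀ is a sum of squares. Extended by zero, y is constant along edges and zero at the roots,
hence zero everywhere. -/
theorem rootedForests_nonempty {U : Finset α} (h : SpansFrom s t U Set.univ) :
    (rootedForests s t U).Nonempty := by
  classical
  rw [← Finset.card_pos, Nat.pos_iff_ne_zero]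
  intro h0
  have h1 := det_submatrix_multigraphLaplacian s t U
  rw [h0, Nat.cast_zero, ← Matrix.exists_vecMul_eq_zero_iff] at h1
  obtain ⟨y, hy, h2⟩ := h1
  set B := (incidenceMatrix s t).submatrix (Subtype.val : U → α) id
  have h3 : (multigraphLaplacian s t).submatrix (Subtype.val : U → α) Subtype.val =
      B * B.transpose := by
    ext x y
    simp [multigraphLaplacian, Matrix.mul_apply, B]
  have h4 : Matrix.vecMul y B = 0 := by
    refine dotProduct_self_eq_zero.mp ?_
    rw [h3, ← Matrix.vecMul_vecMul] at h2
    nth_rewrite 2 [← Matrix.mulVec_transpose]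
    rw [Matrix.dotProduct_mulVec, h2, zero_dotProduct]
  let z : α → ℤ := fun x => if hx : x ∈ U then y ⟨x, hx⟩ else 0
  have hz : ∀ x : α, ∑ u : U, y u * (if x = u then 1 else 0) = z x := by
    intro x
    by_cases hx : x ∈ U
    · rw [Finset.sum_eq_single ⟨x, hx⟩]
      · simp [z, hx]
      · intro b _ hb
        rw [if_neg (fun h : x = b.1 => hb (Subtype.ext h.symm)), mul_zero]
      · simp
    · simp only [z, hx, dif_neg, not_false_eq_true]
      refine Finset.sum_eq_zero fun b _ => ?_
      rw [if_neg (fun h : x = b.1 => hx (h ▸ b.2)), mul_zero]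
  have hst : ∀ e, z (s e) = z (t e) := by
    intro e
    have := congrFun h4 e
    simp only [Matrix.vecMul, dotProduct, B, Matrix.submatrix_apply, incidenceMatrix, id,
      Matrix.of_apply, mul_sub, Finset.sum_sub_distrib, hz, Pi.zero_apply] at this
    linarith
  apply hy
  ext u
  obtain ⟨r, hr, hu⟩ := h u
  have : z u = 0 := by
    have hzr : z r = 0 := by
      rw [← hz]
      refine Finset.sum_eq_zero fun b _ => ?_
      rw [if_neg (fun h : r = b.1 => hr (h ▸ b.2)), mul_zero]
    generalize (u : α) = x at hu
    induction hu with
    | refl => exact hzr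
    | tail _ hxy ih =>
      obtain ⟨e, _, h | h⟩ := hxy
      · rw [← h.2, ← hst, h.1, ih]
      · rw [← h.1, hst, h.2, ih]
  simpa [z] using this

/-- This is `rootedForests_nonempty` for the multigraph whose only edges are those of `F`. -/
theorem SpansFrom.exists_subset {U : Finset α} {F : Finset β} (h : SpansFrom s t U F) :
    ∃ F' ⊆ F, F' ∈ rootedForests s t U := by
  have h1 : SpansFrom (fun e : F => s e) (fun e : F => t e) U Set.univ := fun x => by
    obtain ⟨r, hr, hx⟩ := h x
    exact ⟨r, hr, Relation.ReflTransGen.mono (fun _ _ ⟨e, he, h⟩ => ⟨⟨e, he⟩, trivial, h⟩) _ _ hx⟩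
  obtain ⟨F', hF'⟩ := rootedForests_nonempty _ _ h1
  rw [mem_rootedForests] at hF'
  refine ⟨F'.map (Function.Embedding.subtype _), ?_, ?_⟩
  · intro e he
    simp only [Finset.mem_map, Function.Embedding.subtype_apply, Subtype.exists] at he
    obtain ⟨e, he, _, rfl⟩ := he
    exact he
  · rw [mem_rootedForests, Finset.card_map]
    refine ⟨hF'.1, fun x => ?_⟩
    obtain ⟨r, hr, hx⟩ := hF'.2 x
    refine ⟨r, hr, Relation.ReflTransGen.mono (fun _ _ ⟨e, he, h⟩ => ⟨e, ?_, h⟩) _ _ hx⟩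
    simpa using he

theorem SpansFrom.card_le {U : Finset α} {F : Finset β} (h : SpansFrom s t U F) :
    U.card ≤ F.card := by
  obtain ⟨F', hF, h'⟩ := h.exists_subset
  rw [mem_rootedForests] at h'
  exact h'.1 ▸ Finset.card_le_card hF

end MatrixTree

/-! ### Complexity and the trailing coefficient of the characteristic polynomial -/

namespace Graph

section Reach

variable {α β : Type*} {H : Graph α β}

instance : Std.Symm H.Reachable := Relation.ReflTransGen.stdSymm

theorem Reachable.symm {x y : α} (h : H.Reachable x y) : H.Reachable y x :=
  Std.Symm.symm _ _ h

theorem Reachable.trans {x y z : α} (h : H.Reachable x y) (h' : H.Reachable y z) :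
    H.Reachable x z := Relation.ReflTransGen.trans h h'

theorem eq_of_mem_components {C : Set α} (hC : C ∈ H.components) {x : α} (hx : x ∈ C) :
    C = {y | H.Reachable x y} := by
  obtain ⟨z, _, rfl⟩ := hC
  ext y
  exact ⟨fun h => Reachable.trans (Reachable.symm hx) h, fun h => Reachable.trans hx h⟩

theorem mem_component_of_reachable {C : Set α} (hC : C ∈ H.components) {x y : α} (hx : x ∈ C)
    (h : H.Reachable x y) : y ∈ C := by
  rw [eq_of_mem_components hC hx]
  exact h

theorem reachable_of_mem_component {C : Set α} (hC : C ∈ H.components) {x y : α} (hx : x ∈ C)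
    (hy : y ∈ C) : H.Reachable x y := by
  rw [eq_of_mem_components hC hx] at hy
  exact hy

end Reach

section Complexity

variable {α β : Type*} {H : Graph α β} {s t : β → α}

theorem EdgeAdj.adj (hst : ∀ e, H.IsLink e (s e) (t e)) {F : Set β} {x y : α}
    (h : EdgeAdj s t F x y) : H.Adj x y := by
  obtain ⟨e, _, h⟩ := h
  exact ⟨e, (hst e).isLink_iff.mpr h⟩

theorem reachable_of_edgeAdj (hst : ∀ e, H.IsLink e (s e) (t e)) {F : Set β} {x y : α}
    (h : Relation.ReflTransGen (EdgeAdj s t F) x y) : H.Reachable x y :=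
  Relation.ReflTransGen.mono (fun _ _ h => EdgeAdj.adj hst h) _ _ h

instance {F : Set β} : Std.Symm (EdgeAdj s t F) where
  symm _ _ := fun ⟨e, he, h⟩ => ⟨e, he, h.symm⟩

theorem reflTransGen_edgeAdj_symm {F : Set β} {x y : α}
    (h : Relation.ReflTransGen (EdgeAdj s t F) x y) :
    Relation.ReflTransGen (EdgeAdj s t F) y x :=
  Relation.ReflTransGen.stdSymm.symm _ _ h

/-- The part of the subgraph with edge set `F` that lies in the vertex set `C`. -/
def inside (H : Graph α β) (C : Set α) (F : Set β) : Graph α β :=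
  (H.induce C).restrict (F ∩ (H.induce C).edgeSet)

theorem inside_isLink {C : Set α} {F : Set β} {e : β} {x y : α} :
    (H.inside C F).IsLink e x y ↔ e ∈ F ∧ H.IsLink e x y ∧ x ∈ C ∧ y ∈ C := by
  simp only [inside, restrict_isLink, induce_isLink, Set.mem_inter_iff]
  constructor
  · rintro ⟨⟨h1, _⟩, h2⟩
    exact ⟨h1, h2⟩
  · rintro ⟨h1, h2⟩
    exact ⟨⟨h1, ⟨x, y, h2⟩⟩, h2⟩

theorem inside_reachable (hst : ∀ e, H.IsLink e (s e) (t e)) {C : Set α} (hC : C ∈ H.components)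
    {F : Set β} {x y : α} (hx : x ∈ C) (h : Relation.ReflTransGen (EdgeAdj s t F) x y) :
    (H.inside C F).Reachable x y := by
  induction h with
  | refl => exact .refl
  | @tail y z hxy hyz ih =>
    have hy : y ∈ C := mem_component_of_reachable hC hx (reachable_of_edgeAdj hst hxy)
    have hz : z ∈ C := mem_component_of_reachable hC hy (.single (EdgeAdj.adj hst hyz))
    obtain ⟨e, he, h⟩ := hyz
    exact ih.tail ⟨e, inside_isLink.mpr ⟨he, (hst e).isLink_iff.mpr h, hy, hz⟩⟩

theorem edgeAdj_of_inside_reachable (hst : ∀ e, H.IsLink e (s e) (t e)) {C : Set α} {F : Set β}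
    {x y : α} (h : (H.inside C F).Reachable x y) :
    Relation.ReflTransGen (EdgeAdj s t F) x y :=
  Relation.ReflTransGen.mono (fun a b ⟨e, h⟩ => by
    rw [inside_isLink] at h
    exact ⟨e, h.1, (hst e).isLink_iff.mp h.2.1⟩) _ _ h

theorem edgeAdj_of_inside_deleteEdges_reachable (hst : ∀ e, H.IsLink e (s e) (t e)) {C : Set α}
    {F : Set β} {e : β} {x y : α} (h : ((H.inside C F).deleteEdges {e}).Reachable x y) :
    Relation.ReflTransGen (EdgeAdj s t (F \ {e})) x y :=
  Relation.ReflTransGen.mono (fun a b ⟨f, h⟩ => by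
    rw [deleteEdges_isLink, inside_isLink] at h
    exact ⟨f, ⟨h.1.1, h.2⟩, (hst f).isLink_iff.mp h.1.2.1⟩) _ _ h

/-- The complement of `U` has exactly one vertex in each component of `H`. -/
def IsRootComplement (H : Graph α β) (U : Finset α) : Prop :=
  ∀ x, ∃! r, r ∉ U ∧ H.Reachable r x

variable [Fintype α] [DecidableEq α] [Fintype β] [DecidableEq β]

/-- Each use of e is rerouted along the path that joins its ends. -/
theorem spansFrom_diff {U : Finset α} {F : Set β} {e : β} (h : SpansFrom s t U F)
    (he : Relation.ReflTransGen (EdgeAdj s t (F \ {e})) (s e) (t e)) :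
    SpansFrom s t U (F \ {e}) := fun z => by
  obtain ⟨r, hr, hz⟩ := h z
  refine ⟨r, hr, ?_⟩
  have he' : Relation.ReflTransGen (EdgeAdj s t (F \ {e})) (t e) (s e) :=
    reflTransGen_edgeAdj_symm he
  clear hr
  induction hz with
  | refl => exact .refl
  | @tail a b _ hab ih =>
    refine ih.trans ?_
    obtain ⟨f, hf, h⟩ := hab
    by_cases hfe : f = e
    · subst hfe
      rcases h with ⟨rfl, rfl⟩ | ⟨rfl, rfl⟩
      · exact he
      · exact he'
    · exact .single ⟨f, ⟨hf, hfe⟩, h⟩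

/-- Connectedness: two vertices of C are reached from the only root in C. Acyclicity: deleting an
edge on a cycle would leave a spanning set with fewer than |U| edges, against `SpansFrom.card_le`.
-/
theorem inter_mem_spanningTrees (hst : ∀ e, H.IsLink e (s e) (t e)) {U : Finset α}
    (hU : H.IsRootComplement U) {F : Finset β} (hF : F ∈ rootedForests s t U) {C : Set α}
    (hC : C ∈ H.components) :
    (F : Set β) ∩ (H.induce C).edgeSet ∈ (H.induce C).spanningTrees := by
  rw [mem_rootedForests] at hF
  refine ⟨Set.inter_subset_right, ⟨?_, ?_⟩, ?_⟩
  · obtain ⟨x, hx, rfl⟩ := hC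
    exact ⟨x, .refl⟩
  · intro x hx y hy
    change x ∈ C at hx
    change y ∈ C at hy
    obtain ⟨r, hr, hrx⟩ := hF.2 x
    obtain ⟨r', hr', hry⟩ := hF.2 y
    have h1 := reachable_of_edgeAdj hst hrx
    have h2 := reachable_of_edgeAdj hst hry
    have : r = r' := (hU y).unique ⟨hr, h1.trans (reachable_of_mem_component hC hx hy)⟩ ⟨hr', h2⟩
    subst this
    have hrC : r ∈ C := mem_component_of_reachable hC hx h1.symm
    exact (inside_reachable hst hC hrC hrx).symm.trans (inside_reachable hst hC hrC hry)
  · intro e x y hxy hreach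
    change (H.inside C F).IsLink e x y at hxy
    rw [inside_isLink] at hxy
    have h1 := edgeAdj_of_inside_deleteEdges_reachable hst hreach
    have h2 : Relation.ReflTransGen (EdgeAdj s t (F \ {e})) (s e) (t e) := by
      rcases (hst e).isLink_iff.mp hxy.2.1 with ⟨h, h'⟩ | ⟨h, h'⟩
      · rwa [h, h']
      · rw [h, h']
        exact reflTransGen_edgeAdj_symm h1
    have h3 := spansFrom_diff hF.2 h2
    rw [← Finset.coe_erase] at h3
    have h4 := h3.card_le
    have h5 := Finset.card_erase_lt_of_mem (Finset.mem_coe.mp hxy.1)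
    omega

/-- The edge count of `F` is obtained without counting edges of trees. `F` spans, so it contains a
rooted forest F'; an edge of `F` outside F' would have its ends joined through F', against
acyclicity. -/
theorem mem_rootedForests_of_forall (hV : H.vertexSet = Set.univ)
    (hst : ∀ e, H.IsLink e (s e) (t e)) {U : Finset α} (hU : H.IsRootComplement U) {F : Finset β}
    (hF : ∀ C ∈ H.components, (F : Set β) ∩ (H.induce C).edgeSet ∈ (H.induce C).spanningTrees) :
    F ∈ rootedForests s t U := by
  have hcomp : ∀ x, {y | H.Reachable x y} ∈ H.components := fun x => ⟨x, by simp [hV], rfl⟩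
  have hS : SpansFrom s t U F := fun x => by
    obtain ⟨r, ⟨hr, hrx⟩, _⟩ := hU x
    refine ⟨r, hr, ?_⟩
    have := (hF _ (hcomp r)).2.connected.reachable r .refl x hrx
    exact edgeAdj_of_inside_reachable hst this
  obtain ⟨F', hF', hmem⟩ := hS.exists_subset
  suffices F' = F from this ▸ hmem
  refine hF'.antisymm fun e he => ?_
  by_contra he'
  set C := {y | H.Reachable (s e) y}
  have hs : s e ∈ C := .refl
  have ht : t e ∈ C := .single ⟨e, hst e⟩
  refine (hF _ (hcomp (s e))).2.acyclic e (s e) (t e)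
    (inside_isLink.mpr ⟨he, hst e, hs, ht⟩) ?_
  have h1 := (inter_mem_spanningTrees hst hU hmem (hcomp (s e))).2.connected.reachable _ hs _ ht
  refine Relation.ReflTransGen.mono (fun a b ⟨f, hf⟩ => ⟨f, ?_⟩) _ _ h1
  change (H.inside C F').IsLink f a b at hf
  rw [inside_isLink] at hf
  change ((H.inside C F).deleteEdges {e}).IsLink f a b
  rw [deleteEdges_isLink, inside_isLink]
  refine ⟨⟨hF' hf.1, hf.2⟩, ?_⟩
  rintro rfl
  exact he' hf.1

/-- Every edge lies in exactly one component, so a forest with one root per component amounts to a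
choice of spanning tree in each component. -/
theorem card_rootedForests_eq_complexity (hV : H.vertexSet = Set.univ)
    (hst : ∀ e, H.IsLink e (s e) (t e)) {U : Finset α} (hU : H.IsRootComplement U) :
    (rootedForests s t U).card = H.complexity := by
  classical
  have hcomp : ∀ x, {y | H.Reachable x y} ∈ H.components := fun x => ⟨x, by simp [hV], rfl⟩
  have h1 : H.complexity = Nat.card (∀ C : H.components, (H.induce C.1).spanningTrees) := by
    rw [Nat.card_pi, complexity, ← finprod_set_coe_eq_finprod_mem, finprod_eq_prod_of_fintype]
    rfl
  have hmemE : ∀ e, e ∈ (H.induce {y | H.Reachable (s e) y}).edgeSet := fun e =>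
    ⟨s e, t e, hst e, .refl, .single ⟨e, hst e⟩⟩
  have huniq : ∀ e, ∀ C ∈ H.components, e ∈ (H.induce C).edgeSet →
      C = {y | H.Reachable (s e) y} := by
    rintro e C hC ⟨x, y, hl, hx, hy⟩
    refine eq_of_mem_components hC ?_
    rcases (hst e).isLink_iff.mp hl with ⟨h, h'⟩ | ⟨h, h'⟩
    · rwa [h]
    · rwa [h]
  rw [h1, ← Nat.card_eq_finsetCard]
  refine Nat.card_eq_of_bijective (fun F C => ⟨(F.1 : Set β) ∩ (H.induce C.1).edgeSet,
    inter_mem_spanningTrees hst hU F.2 C.2⟩) ⟨?_, ?_⟩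
  · intro F F' h
    ext e
    have := congrArg Subtype.val (congrFun h ⟨_, hcomp (s e)⟩)
    have := congrArg (e ∈ ·) this
    simpa [hmemE e] using this
  · intro f
    let F : Finset β := Finset.univ.filter fun e => e ∈ (f ⟨_, hcomp (s e)⟩).1
    have hF : ∀ C : H.components, (F : Set β) ∩ (H.induce C.1).edgeSet = (f C).1 := by
      intro C
      ext e
      simp only [F, Finset.coe_filter, Finset.mem_univ, true_and, Set.mem_inter_iff]
      constructor
      · rintro ⟨h, h'⟩
        have h2 : C = ⟨_, hcomp (s e)⟩ := Subtype.ext (huniq e C.1 C.2 h')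
        rw [h2]
        exact h
      · intro h
        have h' := (f C).2.1 h
        have h2 : C = ⟨_, hcomp (s e)⟩ := Subtype.ext (huniq e C.1 C.2 h')
        refine ⟨?_, h'⟩
        rw [h2] at h
        exact h
    refine ⟨⟨F, mem_rootedForests_of_forall hV hst hU fun C hC => ?_⟩, ?_⟩
    · rw [hF ⟨C, hC⟩]
      exact (f ⟨C, hC⟩).2
    · funext C
      exact Subtype.ext (hF C)

/-- Sending a root to its component is surjective; if the cardinalities agree it is also injective.
-/
theorem ncard_components_le (hV : H.vertexSet = Set.univ)
    (hst : ∀ e, H.IsLink e (s e) (t e)) {U : Finset α} {F : Set β} (hF : SpansFrom s t U F) :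
    H.components.ncard ≤ Uᶜ.card ∧
      (H.components.ncard = Uᶜ.card → H.IsRootComplement U) := by
  classical
  have hcomp : ∀ x, {y | H.Reachable x y} ∈ H.components := fun x => ⟨x, by simp [hV], rfl⟩
  let ρ : (Uᶜ : Finset α) → H.components := fun r => ⟨_, hcomp r⟩
  have hρ : Function.Surjective ρ := by
    rintro ⟨C, hC⟩
    obtain ⟨x, hx, rfl⟩ := id hC
    obtain ⟨r, hr, h⟩ := hF x
    refine ⟨⟨r, by simpa using hr⟩, Subtype.ext ?_⟩
    exact (eq_of_mem_components hC (reachable_of_edgeAdj hst h).symm).symm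
  have hc : Fintype.card H.components = H.components.ncard := by
    rw [← Nat.card_coe_set_eq, Nat.card_eq_fintype_card]
  rw [← hc]
  refine ⟨(Fintype.card_le_of_surjective ρ hρ).trans_eq (Fintype.card_coe _), fun heq x => ?_⟩
  have hinj : Function.Injective ρ :=
    ((Fintype.bijective_iff_surjective_and_card ρ).mpr ⟨hρ, (Fintype.card_coe _).trans heq.symm⟩).1
  obtain ⟨r, hr, h⟩ := hF x
  refine ⟨r, ⟨hr, reachable_of_edgeAdj hst h⟩, ?_⟩
  rintro r' ⟨hr', h'⟩
  have : ρ ⟨r', by simpa using hr'⟩ = ρ ⟨r, by simpa using hr⟩ := by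
    refine Subtype.ext ?_
    exact eq_of_mem_components (hcomp r') (h'.trans (reachable_of_edgeAdj hst h).symm)
  exact congrArg Subtype.val (hinj this)

theorem exists_isRootComplement (hV : H.vertexSet = Set.univ) :
    ∃ U : Finset α, H.IsRootComplement U ∧ Uᶜ.card = H.components.ncard := by
  classical
  have hcomp : ∀ x, {y | H.Reachable x y} ∈ H.components := fun x => ⟨x, by simp [hV], rfl⟩
  have hne : ∀ C : H.components, ∃ x, x ∈ C.1 := by
    rintro ⟨_, x, _, rfl⟩
    exact ⟨x, .refl⟩
  choose r hr using hne
  have hinj : Function.Injective r := fun C D h => Subtype.ext <| by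
    rw [eq_of_mem_components C.2 (hr C), h, ← eq_of_mem_components D.2 (hr D)]
  refine ⟨(Finset.univ.image r)ᶜ, fun x => ?_, ?_⟩
  · refine ⟨r ⟨_, hcomp x⟩, ⟨by simp, Reachable.symm (hr ⟨_, hcomp x⟩)⟩, ?_⟩
    rintro y ⟨hy, hyx⟩
    simp only [Finset.mem_compl, Finset.mem_image, Finset.mem_univ, true_and, not_not] at hy
    obtain ⟨C, rfl⟩ := hy
    congr 1
    refine Subtype.ext ?_
    exact eq_of_mem_components C.2 (mem_component_of_reachable C.2 (hr C) hyx)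
  · rw [compl_compl, Finset.card_image_of_injective _ hinj, Finset.card_univ,
      ← Nat.card_coe_set_eq, Nat.card_eq_fintype_card]

/-- The lowest nonzero coefficient of the characteristic polynomial of the Laplacian matrix of a
finite multigraph equals its complexity, up to a factor that is polynomial in the number of
vertices. -/
theorem exists_trailingCoeff_charpoly (hV : H.vertexSet = Set.univ)
    (hst : ∀ e, H.IsLink e (s e) (t e)) :
    0 < H.complexity ∧ H.complexity ≤ (multigraphLaplacian s t).charpoly.trailingCoeff.natAbs ∧
      (multigraphLaplacian s t).charpoly.trailingCoeff.natAbs ≤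
        Fintype.card α ^ H.components.ncard * H.complexity := by
  obtain ⟨U, hU, hcard⟩ := exists_isRootComplement (H := H) hV
  have hT := card_rootedForests_eq_complexity hV hst hU
  have hpos : 0 < H.complexity := by
    rw [← hT, Finset.card_pos]
    refine rootedForests_nonempty s t fun x => ?_
    obtain ⟨r, ⟨hr, h⟩, _⟩ := hU x
    exact ⟨r, hr, Relation.ReflTransGen.mono (fun a b ⟨e, he⟩ =>
      ⟨e, trivial, (hst e).isLink_iff.mp he⟩) _ _ h⟩
  set c := H.components.ncard
  set N := Fintype.card α
  have hcN : c ≤ N := by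
    rw [← hcard]
    exact Finset.card_le_univ _
  have hUc : U.card = N - c := by
    rw [Finset.card_compl] at hcard
    have := Finset.card_le_univ U
    omega
  -- Up to sign, the coefficients are sums of principal minors, so they count forests by their root
  -- sets.
  have hcoeff : ∀ k ≤ N, (multigraphLaplacian s t).charpoly.coeff (N - k) =
      (-1) ^ k * ((∑ S ∈ Finset.univ.powersetCard k, (rootedForests s t S).card : ℕ) : ℤ) := by
    intro k hk
    rw [Matrix.charpoly_coeff_eq_sum_minors _ k hk]
    congr 1
    push_cast
    exact Finset.sum_congr rfl fun S _ => det_submatrix_multigraphLaplacian s t S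
  -- A root set with fewer vertices than there are components spans nothing.
  have hlow : ∀ j < c, (multigraphLaplacian s t).charpoly.coeff j = 0 := by
    intro j hj
    have h1 := hcoeff (N - j) (by omega)
    rw [show N - (N - j) = j by omega] at h1
    rw [h1]
    simp only [mul_eq_zero, pow_eq_zero_iff', Int.reduceNeg, Nat.cast_eq_zero]
    right
    refine Finset.sum_eq_zero fun S hS => ?_
    rw [Finset.mem_powersetCard_univ] at hS
    rw [Finset.card_eq_zero, Finset.eq_empty_iff_forall_notMem]
    intro F hF
    rw [mem_rootedForests] at hF
    have h2 := (ncard_components_le hV hst hF.2).1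
    rw [Finset.card_compl, hS] at h2
    change c ≤ N - (N - j) at h2
    omega
  set K := ∑ S ∈ Finset.univ.powersetCard (N - c), (rootedForests s t S).card with hK
  have hmid : (multigraphLaplacian s t).charpoly.coeff c = (-1) ^ (N - c) * (K : ℤ) := by
    have h1 := hcoeff (N - c) (by omega)
    rwa [show N - (N - c) = c by omega] at h1
  have hK1 : H.complexity ≤ K := by
    rw [← hT]
    exact Finset.single_le_sum (f := fun S => (rootedForests s t S).card) (fun _ _ => Nat.zero_le _)
      (Finset.mem_powersetCard_univ.mpr hUc)
  -- A root set of size c that admits a forest has one vertex in each component and contributes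
  -- exactly the complexity. There are at most N choose c ≤ N^c root sets.
  have hK2 : K ≤ N ^ c * H.complexity := by
    have h1 : ∀ S ∈ Finset.univ.powersetCard (N - c),
        (rootedForests s t S).card ≤ H.complexity := by
      intro S hS
      rw [Finset.mem_powersetCard_univ] at hS
      rcases (rootedForests s t S).eq_empty_or_nonempty with h | ⟨F, hF⟩
      · simp [h]
      · rw [mem_rootedForests] at hF
        refine (card_rootedForests_eq_complexity hV hst
          ((ncard_components_le hV hst hF.2).2 ?_)).le
        rw [Finset.card_compl, hS]
        change c = N - (N - c)
        omega
    refine (Finset.sum_le_card_nsmul _ _ _ h1).trans ?_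
    rw [Finset.card_powersetCard, smul_eq_mul, Finset.card_univ]
    refine Nat.mul_le_mul_right _ ?_
    change N.choose (N - c) ≤ _
    rw [Nat.choose_symm hcN]
    exact Nat.choose_le_pow N c
  have hne : (multigraphLaplacian s t).charpoly.coeff c ≠ 0 := by
    rw [hmid]
    have : K ≠ 0 := (hpos.trans_le hK1).ne'
    simp [this]
  have htrail : (multigraphLaplacian s t).charpoly.natTrailingDegree = c :=
    le_antisymm (Polynomial.natTrailingDegree_le_of_ne_zero hne)
      (Polynomial.le_natTrailingDegree (Matrix.charpoly_monic _).ne_zero hlow)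
  have habs : (multigraphLaplacian s t).charpoly.trailingCoeff.natAbs = K := by
    rw [Polynomial.trailingCoeff, htrail, hmid, Int.natAbs_mul, Int.natAbs_pow]
    simp
  rw [habs]
  exact ⟨hpos, hK1, hK2⟩

end Complexity

end Graph

/-! ### A uniform bound for sums of |1 - ψ(a)|^(-1/2) over characters -/

section CharacterBound

/-- The function `z ↦ |1 - z| ^ (-1/2)`, with value `0` at `z = 1`. -/
noncomputable def invSqrtDist (z : ℂ) : ℝ := (√‖1 - z‖)⁻¹

theorem invSqrtDist_nonneg (z : ℂ) : 0 ≤ invSqrtDist z := by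
  unfold invSqrtDist
  positivity

/-- Telescoping: 1/√(r+1) ≤ 2√(r+1) - 2√r. -/
theorem sum_range_inv_sqrt_succ_le (r : ℕ) :
    ∑ j ∈ Finset.range r, (√((j : ℝ) + 1))⁻¹ ≤ 2 * √(r : ℝ) := by
  induction r with
  | zero => simp
  | succ r ih =>
    rw [Finset.sum_range_succ]
    have h1 : (√((r : ℝ) + 1))⁻¹ ≤ 2 * √((r : ℝ) + 1) - 2 * √(r : ℝ) := by
      have hp : 0 < √((r : ℝ) + 1) := by positivity
      rw [inv_le_iff_one_le_mul₀ hp]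
      have h2 : √((r : ℝ) + 1) ^ 2 = r + 1 := Real.sq_sqrt (by positivity)
      have h3 : √(r : ℝ) ^ 2 = r := Real.sq_sqrt (by positivity)
      nlinarith [sq_nonneg (√((r : ℝ) + 1) - √(r : ℝ))]
    push_cast
    linarith

/-- The term j = 0 is zero because the inverse of 0 is 0. -/
theorem sum_range_inv_sqrt_le (r : ℕ) :
    ∑ j ∈ Finset.range r, (√(j : ℝ))⁻¹ ≤ 2 * √(r : ℝ) := by
  cases r with
  | zero => simp
  | succ r =>
    rw [Finset.sum_range_succ']
    have h1 := sum_range_inv_sqrt_succ_le r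
    have h2 : √(r : ℝ) ≤ √((r + 1 : ℕ) : ℝ) := Real.sqrt_le_sqrt (by push_cast; linarith)
    simp only [Nat.cast_add, Nat.cast_one, Nat.cast_zero, Real.sqrt_zero, inv_zero,
      add_zero] at *
    linarith

/-- The distance is 2 sin(πx), and Jordan's inequality bounds it below by the distance from x to the
nearer endpoint. At the endpoints the convention that the inverse of 0 is 0 keeps the bound true. -/
theorem invSqrtDist_exp_le {x : ℝ} (h0 : 0 ≤ x) (h1 : x ≤ 1) :
    invSqrtDist (Complex.exp (Complex.I * ((2 * Real.pi * x : ℝ) : ℂ))) ≤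
      (√x)⁻¹ + (√(1 - x))⁻¹ := by
  rcases h0.eq_or_lt with rfl | h0
  · simp [invSqrtDist]
  rcases h1.eq_or_lt with rfl | h1
  · rw [invSqrtDist, norm_sub_rev, Complex.norm_exp_I_mul_ofReal_sub_one]
    simp
  have hpi := Real.pi_pos
  rw [invSqrtDist, norm_sub_rev, Complex.norm_exp_I_mul_ofReal_sub_one,
    show 2 * Real.pi * x / 2 = Real.pi * x by ring]
  have key : ∀ y : ℝ, 0 < y → y ≤ 1 / 2 → Real.sin (Real.pi * x) = Real.sin (Real.pi * y) →
      (√‖2 * Real.sin (Real.pi * x)‖)⁻¹ ≤ (√y)⁻¹ := by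
    intro y hy hy' he
    have h2 := Real.mul_le_sin (x := Real.pi * y) (by positivity) (by nlinarith)
    have h3 : 2 / Real.pi * (Real.pi * y) = 2 * y := by field_simp
    rw [h3, ← he] at h2
    refine inv_anti₀ (Real.sqrt_pos.mpr hy) (Real.sqrt_le_sqrt ?_)
    refine le_trans ?_ (Real.le_norm_self _)
    linarith
  rcases le_total x (1 / 2) with h | h
  · have := key x h0 h rfl
    have h2 : 0 ≤ (√(1 - x))⁻¹ := by positivity
    linarith
  · have := key (1 - x) (by linarith) (by linarith) (by
      rw [show Real.pi * (1 - x) = Real.pi - Real.pi * x by ring, Real.sin_pi_sub])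
    have h2 : 0 ≤ (√x)⁻¹ := by positivity
    linarith

/-- At x = j/r each of the two terms of `invSqrtDist_exp_le` is √r times an inverse square root of
an integer, and each sum of these is at most 2√r. -/
theorem sum_invSqrtDist_exp_le (r : ℕ) :
    ∑ j ∈ Finset.range r, invSqrtDist (Complex.exp (2 * Real.pi * Complex.I * (j / r : ℂ))) ≤
      4 * r := by
  rcases Nat.eq_zero_or_pos r with rfl | hr
  · simp
  have hr' : (0 : ℝ) < r := by exact_mod_cast hr
  have hs : √(r : ℝ) * √(r : ℝ) = r := Real.mul_self_sqrt hr'.le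
  have h1 : ∀ j ∈ Finset.range r,
      invSqrtDist (Complex.exp (2 * Real.pi * Complex.I * (j / r : ℂ))) ≤
        √(r : ℝ) * (√(j : ℝ))⁻¹ + √(r : ℝ) * (√((r - 1 - j : ℕ) + 1 : ℝ))⁻¹ := by
    intro j hj
    rw [Finset.mem_range] at hj
    have hj' : (j : ℝ) ≤ r := by exact_mod_cast hj.le
    have h2 := invSqrtDist_exp_le (x := (j : ℝ) / r) (by positivity) (by
      rw [div_le_one hr']
      exact hj')
    have h3 : (((r - 1 - j : ℕ) : ℝ) + 1) = r - j := by
      have : r - 1 - j + 1 + j = r := by omega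
      have : (((r - 1 - j + 1 + j : ℕ)) : ℝ) = r := by rw [this]
      push_cast at this
      linarith
    have h4 : 1 - (j : ℝ) / r = (r - j) / r := by field_simp
    rw [h4, Real.sqrt_div (by positivity), Real.sqrt_div (by linarith), inv_div, inv_div] at h2
    rw [h3, ← div_eq_mul_inv, ← div_eq_mul_inv,
      show 2 * Real.pi * Complex.I * (j / r : ℂ) =
        Complex.I * ((2 * Real.pi * ((j : ℝ) / r) : ℝ) : ℂ) by push_cast; ring]
    exact h2
  refine (Finset.sum_le_sum h1).trans ?_
  rw [Finset.sum_add_distrib, ← Finset.mul_sum, ← Finset.mul_sum,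
    Finset.sum_range_reflect (fun j => (√((j : ℝ) + 1))⁻¹)]
  have h2 := sum_range_inv_sqrt_le r
  have h3 := sum_range_inv_sqrt_succ_le r
  have h4 := Real.sqrt_nonneg (r : ℝ)
  nlinarith

/-- Evaluation at a maps the dual group onto a finite group S of roots of unity, with fibres of
equal size. The elements of S are |S|-th roots of unity, so the sum over S is at most 4|S|. The
constant depends neither on `A` nor on a; for a = 0 all terms vanish. -/
theorem sum_addChar_invSqrtDist_le {A : Type*} [AddCommGroup A] [Finite A] (a : A) :
    ∑ ψ : AddChar A ℂ, invSqrtDist (ψ a) ≤ 4 * Nat.card A := by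
  classical
  have := Fintype.ofFinite A
  let ev : AddChar A ℂ →* ℂ :=
    { toFun := fun ψ => ψ a
      map_one' := by simp
      map_mul' := fun ψ φ => by simp }
  let S : Finset ℂ := Finset.univ.image ev
  let κ := (Finset.univ.filter fun ψ => ev ψ = 1).card
  have hκ : ∀ z ∈ S, (Finset.univ.filter fun ψ => ev ψ = z).card = κ := fun z hz =>
    MonoidHom.card_fiber_eq_of_mem_range ev (by simpa [S] using hz) ⟨1, map_one ev⟩
  have hsum : ∀ h : ℂ → ℝ, ∑ ψ : AddChar A ℂ, h (ev ψ) = κ * ∑ z ∈ S, h z := by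
    intro h
    rw [← Finset.sum_fiberwise_of_maps_to (g := ev) (t := S) (fun ψ _ => by simp [S]),
      Finset.mul_sum]
    refine Finset.sum_congr rfl fun z hz => ?_
    rw [Finset.sum_congr rfl (g := fun _ => h z) (fun ψ hψ => by
      rw [(Finset.mem_filter.mp hψ).2]), Finset.sum_const, hκ z hz, nsmul_eq_mul]
  have hcard : (Nat.card A : ℝ) = κ * S.card := by
    have := hsum fun _ => 1
    simp only [Finset.sum_const, nsmul_eq_mul, mul_one, Finset.card_univ] at this
    rw [← this, AddChar.card_eq, Nat.card_eq_fintype_card]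
  have hne : NeZero S.card := ⟨by
    rw [Ne, Finset.card_eq_zero]
    exact (Finset.univ_nonempty.image _).ne_empty⟩
  have hroot : ∀ z ∈ S, ∃ i < S.card,
      Complex.exp (2 * Real.pi * Complex.I * (i / S.card : ℂ)) = z := by
    intro z hz
    simp only [S, Finset.mem_image, Finset.mem_univ, true_and] at hz
    obtain ⟨ψ, rfl⟩ := hz
    have hc : Fintype.card ev.toHomUnits.range = S.card := by
      rw [← Fintype.card_coe]
      refine Fintype.card_of_bijective (f := fun u => ⟨(u.1 : ℂ), ?_⟩) ⟨?_, ?_⟩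
      · obtain ⟨_, φ, rfl⟩ := u
        simp [S]
      · intro u v h
        exact Subtype.ext (Units.ext (by simpa using h))
      · rintro ⟨z, hz⟩
        simp only [S, Finset.mem_image, Finset.mem_univ, true_and] at hz
        obtain ⟨φ, rfl⟩ := hz
        exact ⟨⟨_, φ, rfl⟩, rfl⟩
    have h1 : (ev.toHomUnits ψ) ∈ rootsOfUnity S.card ℂ := by
      rw [mem_rootsOfUnity, ← hc]
      have := pow_card_eq_one (G := ev.toHomUnits.range) (x := ⟨_, ψ, rfl⟩)
      exact congrArg Subtype.val this
    exact (Complex.mem_rootsOfUnity _ _).mp h1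
  choose! i hi hexp using hroot
  have hle : ∑ z ∈ S, invSqrtDist z ≤ 4 * S.card := by
    refine le_trans ?_ (sum_invSqrtDist_exp_le S.card)
    have hinj : Set.InjOn i S := fun z hz w hw h => by
      rw [← hexp z hz, ← hexp w hw, h]
    have h2 : ∑ z ∈ S, invSqrtDist z = ∑ j ∈ S.image i,
        invSqrtDist (Complex.exp (2 * Real.pi * Complex.I * (j / S.card : ℂ))) := by
      rw [Finset.sum_image hinj]
      exact Finset.sum_congr rfl fun z hz => by rw [hexp z hz]
    rw [h2]
    refine Finset.sum_le_sum_of_subset_of_nonneg ?_ fun _ _ _ => invSqrtDist_nonneg _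
    intro j hj
    rw [Finset.mem_image] at hj
    obtain ⟨z, hz, rfl⟩ := hj
    exact Finset.mem_range.mpr (hi z hz)
  change ∑ ψ : AddChar A ℂ, invSqrtDist (ev ψ) ≤ _
  rw [hsum, hcard]
  have : (0 : ℝ) ≤ κ := Nat.cast_nonneg _
  nlinarith

end CharacterBound

/-! ### Annihilators of sublattices and their equidistribution on the torus -/

section Torus

instance isProbabilityMeasure_unitAddCircle :
    IsProbabilityMeasure (volume : Measure UnitAddCircle) := ⟨UnitAddCircle.measure_univ⟩

instance nullSingletonClass_unitAddCircle :
    NullSingletonClass (volume : Measure UnitAddCircle) where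
  measure_singleton x := by
    rw [← Metric.closedBall_zero, AddCircle.volume_closedBall]
    simp

variable {d : ℕ}

/-- The point of the torus given by a character of `ℤ ^ d / Λ`. -/
noncomputable def torusPoint {Λ : AddSubgroup (Fin d → ℤ)} (ψ : AddChar ((Fin d → ℤ) ⧸ Λ) ℂ) :
    UnitAddTorus (Fin d) := fun i =>
  ((Complex.arg (ψ (QuotientAddGroup.mk (Pi.single i 1))) / (2 * Real.pi) : ℝ) : UnitAddCircle)

theorem mFourier_eq_prod_zpow (s : Fin d → ℤ) (θ : UnitAddTorus (Fin d)) :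
    UnitAddTorus.mFourier s θ = ∏ i, (fourier 1 (θ i) : ℂ) ^ s i := by
  simp only [UnitAddTorus.mFourier, ContinuousMap.coe_mk, fourier_apply, one_zsmul,
    AddCircle.toCircle_zsmul, Circle.coe_zpow]

theorem norm_mFourier_apply (s : Fin d → ℤ) (θ : UnitAddTorus (Fin d)) :
    ‖UnitAddTorus.mFourier s θ‖ = 1 := by
  simp only [UnitAddTorus.mFourier, ContinuousMap.coe_mk, fourier_apply, norm_prod]
  exact Finset.prod_eq_one fun i _ => Circle.norm_coe _

variable {Λ : AddSubgroup (Fin d → ℤ)}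

theorem fourier_one_torusPoint [Finite ((Fin d → ℤ) ⧸ Λ)] (ψ : AddChar ((Fin d → ℤ) ⧸ Λ) ℂ)
    (i : Fin d) :
    (fourier 1 (torusPoint ψ i) : ℂ) = ψ (QuotientAddGroup.mk (Pi.single i 1)) := by
  rw [torusPoint, fourier_coe_apply]
  have h := Complex.norm_mul_exp_arg_mul_I (ψ (QuotientAddGroup.mk (Pi.single i 1)))
  rw [AddChar.norm_apply, Complex.ofReal_one, one_mul] at h
  conv_rhs => rw [← h]
  congr 1
  have : (Real.pi : ℂ) ≠ 0 := by exact_mod_cast Real.pi_ne_zero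
  push_cast
  field_simp

theorem mFourier_torusPoint [Finite ((Fin d → ℤ) ⧸ Λ)] (ψ : AddChar ((Fin d → ℤ) ⧸ Λ) ℂ)
    (s : Fin d → ℤ) :
    UnitAddTorus.mFourier s (torusPoint ψ) = ψ (QuotientAddGroup.mk s) := by
  rw [mFourier_eq_prod_zpow]
  simp only [fourier_one_torusPoint]
  have h : (QuotientAddGroup.mk s : (Fin d → ℤ) ⧸ Λ) =
      ∑ i, s i • QuotientAddGroup.mk (Pi.single i 1) := by
    have h1 : s = ∑ i, s i • Pi.single i (1 : ℤ) := by
      ext j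
      simp [Finset.sum_apply, Pi.single_apply]
    conv_lhs => rw [h1]
    change QuotientAddGroup.mk' Λ _ = _
    rw [map_sum]
    rfl
  have h2 : ∀ S : Finset (Fin d), ∀ g : Fin d → (Fin d → ℤ) ⧸ Λ,
      ψ (∑ i ∈ S, g i) = ∏ i ∈ S, ψ (g i) := fun S g => by
    classical
    induction S using Finset.induction_on with
    | empty => simp
    | insert i S hi ih => rw [Finset.sum_insert hi, Finset.prod_insert hi, AddChar.map_add_eq_mul, ih]
  rw [h, h2]
  exact Finset.prod_congr rfl fun i _ => (AddChar.map_zsmul_eq_zpow ψ _ _).symm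

theorem torusPoint_injective [Finite ((Fin d → ℤ) ⧸ Λ)] :
    Function.Injective (torusPoint (Λ := Λ)) := by
  intro ψ φ h
  ext a
  obtain ⟨s, rfl⟩ := QuotientAddGroup.mk_surjective a
  rw [← mFourier_torusPoint, h, mFourier_torusPoint]

/-- The average of a function over the points of the torus that annihilate `Λ`. -/
noncomputable def torusAverage {E : Type*} [AddCommGroup E] [Module ℝ E]
    (Λ : AddSubgroup (Fin d → ℤ)) (φ : UnitAddTorus (Fin d) → E) : E :=
  (Λ.index : ℝ)⁻¹ • ∑ᶠ ψ : AddChar ((Fin d → ℤ) ⧸ Λ) ℂ, φ (torusPoint ψ)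

theorem torusAverage_eq_sum {E : Type*} [AddCommGroup E] [Module ℝ E]
    [Finite ((Fin d → ℤ) ⧸ Λ)] (φ : UnitAddTorus (Fin d) → E) :
    torusAverage Λ φ = (Λ.index : ℝ)⁻¹ • ∑ ψ : AddChar ((Fin d → ℤ) ⧸ Λ) ℂ, φ (torusPoint ψ) := by
  rw [torusAverage, finsum_eq_sum_of_fintype]

theorem card_addChar_eq_index [Finite ((Fin d → ℤ) ⧸ Λ)] :
    Fintype.card (AddChar ((Fin d → ℤ) ⧸ Λ) ℂ) = Λ.index := by
  have := Fintype.ofFinite ((Fin d → ℤ) ⧸ Λ)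
  rw [AddChar.card_eq, AddSubgroup.index, Nat.card_eq_fintype_card]

theorem torusAverage_mFourier [Λ.FiniteIndex] (s : Fin d → ℤ) (hs : s ∉ Λ) :
    torusAverage Λ (UnitAddTorus.mFourier s) = 0 := by
  classical
  have := AddSubgroup.finite_quotient_of_finiteIndex (H := Λ)
  have := Fintype.ofFinite ((Fin d → ℤ) ⧸ Λ)
  rw [torusAverage_eq_sum]
  simp only [mFourier_torusPoint]
  rw [AddChar.sum_apply_eq_ite, if_neg, smul_zero]
  rwa [QuotientAddGroup.eq_zero_iff]

theorem torusAverage_const [Λ.FiniteIndex] (c : ℂ) :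
    torusAverage Λ (fun _ : UnitAddTorus (Fin d) => c) = c := by
  have := AddSubgroup.finite_quotient_of_finiteIndex (H := Λ)
  rw [torusAverage_eq_sum, Finset.sum_const, Finset.card_univ, card_addChar_eq_index,
    ← Nat.cast_smul_eq_nsmul ℝ, smul_smul, inv_mul_cancel₀, one_smul]
  exact_mod_cast AddSubgroup.FiniteIndex.index_ne_zero

theorem eventually_finiteIndex (d : ℕ) : ∀ᶠ Λ in Graph.minLengthAtTop d, Λ.FiniteIndex :=
  eventually_inf_principal.mpr (Eventually.of_forall fun _ h => h)

theorem minLength_le {v : Fin d → ℤ} (hv : v ∈ Λ) (h0 : v ≠ 0) :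
    Graph.minLength Λ ≤ √(∑ i, (v i : ℝ) ^ 2) := by
  refine csInf_le ⟨0, ?_⟩ ⟨v, hv, h0, rfl⟩
  rintro _ ⟨w, _, _, rfl⟩
  positivity

theorem tendsto_minLength (d : ℕ) : Tendsto Graph.minLength (Graph.minLengthAtTop d) atTop :=
  tendsto_comap.mono_left inf_le_left

theorem eventually_notMem {v : Fin d → ℤ} (h0 : v ≠ 0) :
    ∀ᶠ Λ in Graph.minLengthAtTop d, v ∉ Λ := by
  filter_upwards [(tendsto_minLength d).eventually_gt_atTop (√(∑ i, (v i : ℝ) ^ 2))] with Λ h hv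
  exact absurd (minLength_le hv h0) (not_le.mpr h)

/-- The index times a basis vector is a nonzero element of Λ, so ⟨Λ⟩ is at most the index. -/
theorem tendsto_index (hd : 1 ≤ d) :
    Tendsto (fun Λ : AddSubgroup (Fin d → ℤ) => (Λ.index : ℝ)) (Graph.minLengthAtTop d) atTop := by
  refine tendsto_atTop_mono' _ ?_ (tendsto_minLength d)
  filter_upwards [eventually_finiteIndex d] with Λ hΛ
  have hmem : Λ.index • (Pi.single ⟨0, hd⟩ 1 : Fin d → ℤ) ∈ Λ := AddSubgroup.nsmul_index_mem Λ _
  have hne : Λ.index ≠ 0 := AddSubgroup.FiniteIndex.index_ne_zero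
  refine (minLength_le hmem ?_).trans_eq ?_
  · intro h
    have := congrFun h ⟨0, hd⟩
    simp [hne] at this
  · rw [Finset.sum_eq_single ⟨0, hd⟩]
    · simp [Real.sqrt_sq]
    · intro j _ hj
      simp [Pi.single_eq_of_ne hj]
    · simp

/-- Translation by 1/(2 s_i) in a coordinate with s_i ≠ 0 changes the sign of the integrand. -/
theorem integral_mFourier_eq_zero {s : Fin d → ℤ} (hs : s ≠ 0) :
    ∫ θ, UnitAddTorus.mFourier s θ = 0 := by
  obtain ⟨i, hi⟩ := Function.ne_iff.mp hs
  refine integral_eq_zero_of_add_right_eq_neg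
    (g := Pi.single i (((1 : ℝ) / 2 / (s i : ℝ) : ℝ) : UnitAddCircle)) fun θ => ?_
  simp only [UnitAddTorus.mFourier, ContinuousMap.coe_mk]
  rw [← Finset.mul_prod_erase _ _ (Finset.mem_univ i),
    ← Finset.mul_prod_erase _ _ (Finset.mem_univ i), Pi.add_apply, Pi.single_eq_same,
    fourier_add_half_inv_index hi one_pos, neg_mul]
  congr 2
  refine Finset.prod_congr rfl fun j hj => ?_
  rw [Pi.add_apply, Pi.single_eq_of_ne (Finset.ne_of_mem_erase hj), add_zero]

theorem norm_torusAverage_le [Λ.FiniteIndex] {φ : UnitAddTorus (Fin d) → ℂ} {C : ℝ}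
    (h : ∀ θ, ‖φ θ‖ ≤ C) : ‖torusAverage Λ φ‖ ≤ C := by
  have := AddSubgroup.finite_quotient_of_finiteIndex (H := Λ)
  have hpos : (0 : ℝ) < Λ.index := by
    exact_mod_cast Nat.pos_of_ne_zero AddSubgroup.FiniteIndex.index_ne_zero
  rw [torusAverage_eq_sum, norm_smul, norm_inv, Real.norm_of_nonneg hpos.le,
    inv_mul_le_iff₀ hpos]
  refine (norm_sum_le _ _).trans ((Finset.sum_le_sum fun ψ _ => h _).trans_eq ?_)
  rw [Finset.sum_const, Finset.card_univ, card_addChar_eq_index, nsmul_eq_mul]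

theorem torusAverage_add [Λ.FiniteIndex] {E : Type*} [AddCommGroup E] [Module ℝ E]
    (φ φ' : UnitAddTorus (Fin d) → E) :
    torusAverage Λ (fun θ => φ θ + φ' θ) = torusAverage Λ φ + torusAverage Λ φ' := by
  have := AddSubgroup.finite_quotient_of_finiteIndex (H := Λ)
  rw [torusAverage_eq_sum, torusAverage_eq_sum, torusAverage_eq_sum, Finset.sum_add_distrib,
    smul_add]

theorem torusAverage_sub [Λ.FiniteIndex] {E : Type*} [AddCommGroup E] [Module ℝ E]
    (φ φ' : UnitAddTorus (Fin d) → E) :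
    torusAverage Λ (fun θ => φ θ - φ' θ) = torusAverage Λ φ - torusAverage Λ φ' := by
  have := AddSubgroup.finite_quotient_of_finiteIndex (H := Λ)
  rw [torusAverage_eq_sum, torusAverage_eq_sum, torusAverage_eq_sum, Finset.sum_sub_distrib,
    smul_sub]

theorem torusAverage_mul [Λ.FiniteIndex] (c : ℂ) (φ : UnitAddTorus (Fin d) → ℂ) :
    torusAverage Λ (fun θ => c * φ θ) = c * torusAverage Λ φ := by
  have := AddSubgroup.finite_quotient_of_finiteIndex (H := Λ)
  rw [torusAverage_eq_sum, torusAverage_eq_sum, ← Finset.mul_sum, mul_smul_comm]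

/-- The torus points that annihilate `Λ` become equidistributed as `⟨Λ⟩ → ∞`. -/
theorem tendsto_torusAverage_complex (φ : C(UnitAddTorus (Fin d), ℂ)) :
    Tendsto (fun Λ => torusAverage Λ φ) (Graph.minLengthAtTop d) (𝓝 (∫ θ, φ θ)) := by
  have hint : ∀ φ : C(UnitAddTorus (Fin d), ℂ), Integrable φ := fun φ =>
    φ.continuous.integrable_of_hasCompactSupport (HasCompactSupport.of_compactSpace _)
  -- For trigonometric polynomials the average eventually equals the integral: a nonzero frequency s
  -- lies outside Λ once ⟨Λ⟩ exceeds its length, and the character sum then vanishes. Uniform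
  -- density of these polynomials gives the general case.
  have hspan : ∀ φ ∈ Submodule.span ℂ (Set.range (UnitAddTorus.mFourier (d := Fin d))),
      Tendsto (fun Λ => torusAverage Λ φ) (Graph.minLengthAtTop d) (𝓝 (∫ θ, φ θ)) := by
    intro φ hφ
    induction hφ using Submodule.span_induction with
    | mem φ h =>
      obtain ⟨s, rfl⟩ := h
      by_cases hs : s = 0
      · subst hs
        rw [UnitAddTorus.mFourier_zero]
        refine tendsto_nhds_of_eventually_eq ?_
        filter_upwards [eventually_finiteIndex d] with Λ hΛ
        refine (torusAverage_const (Λ := Λ) 1).trans ?_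
        simp
      · rw [integral_mFourier_eq_zero hs]
        refine tendsto_nhds_of_eventually_eq ?_
        filter_upwards [eventually_finiteIndex d, eventually_notMem hs] with Λ hΛ h
        exact torusAverage_mFourier s h
    | zero =>
      refine tendsto_nhds_of_eventually_eq ?_
      filter_upwards [eventually_finiteIndex d] with Λ hΛ
      refine (torusAverage_const (Λ := Λ) 0).trans ?_
      simp
    | add φ φ' _ _ h h' =>
      have := h.add h'
      rw [← integral_add (hint _) (hint _)] at this
      refine this.congr' ?_
      filter_upwards [eventually_finiteIndex d] with Λ hΛ
      exact (torusAverage_add _ _).symm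
    | smul c φ _ h =>
      have := h.const_mul c
      rw [← integral_const_mul] at this
      refine this.congr' ?_
      filter_upwards [eventually_finiteIndex d] with Λ hΛ
      exact (torusAverage_mul _ _).symm
  rw [Metric.tendsto_nhds]
  intro ε hε
  have hmem : φ ∈ closure (Submodule.span ℂ (Set.range (UnitAddTorus.mFourier (d := Fin d))) :
      Set C(UnitAddTorus (Fin d), ℂ)) := by
    rw [← Submodule.topologicalClosure_coe, UnitAddTorus.span_mFourier_closure_eq_top]
    trivial
  obtain ⟨φ', hφ', hdist⟩ := Metric.mem_closure_iff.mp hmem (ε / 3) (by positivity)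
  have hpt : ∀ θ, ‖φ θ - φ' θ‖ ≤ ε / 3 := fun θ => by
    rw [← dist_eq_norm]
    exact ((ContinuousMap.dist_apply_le_dist θ).trans hdist.le)
  filter_upwards [eventually_finiteIndex d,
    Metric.tendsto_nhds.mp (hspan φ' hφ') (ε / 3) (by positivity)] with Λ hΛ h
  have h1 : ‖torusAverage Λ φ - torusAverage Λ φ'‖ ≤ ε / 3 := by
    rw [← torusAverage_sub]
    exact norm_torusAverage_le hpt
  have h2 : ‖(∫ θ, φ θ) - ∫ θ, φ' θ‖ ≤ ε / 3 := by
    rw [← integral_sub (hint _) (hint _)]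
    refine (norm_integral_le_of_norm_le_const (Eventually.of_forall hpt)).trans_eq ?_
    simp
  rw [← dist_eq_norm] at h1 h2
  rw [dist_comm] at h2
  have h3 := dist_triangle4 (torusAverage Λ φ) (torusAverage Λ φ') (∫ θ, φ' θ) (∫ θ, φ θ)
  linarith

theorem tendsto_torusAverage {φ : UnitAddTorus (Fin d) → ℝ} (hφ : Continuous φ) :
    Tendsto (fun Λ => torusAverage Λ φ) (Graph.minLengthAtTop d) (𝓝 (∫ θ, φ θ)) := by
  have h := (Complex.continuous_re.tendsto _).comp
    (tendsto_torusAverage_complex ⟨fun θ => (φ θ : ℂ), by fun_prop⟩)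
  simp only [ContinuousMap.coe_mk, integral_complex_ofReal, Complex.ofReal_re] at h
  refine h.congr' ?_
  filter_upwards [eventually_finiteIndex d] with Λ hΛ
  have := AddSubgroup.finite_quotient_of_finiteIndex (H := Λ)
  rw [Function.comp_apply, torusAverage_eq_sum, torusAverage_eq_sum]
  simp

theorem torusAverage_invSqrtDist_le [Λ.FiniteIndex] (s : Fin d → ℤ) :
    torusAverage Λ (fun θ => invSqrtDist (UnitAddTorus.mFourier s θ)) ≤ 4 := by
  have := AddSubgroup.finite_quotient_of_finiteIndex (H := Λ)
  have hpos : (0 : ℝ) < Λ.index := by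
    exact_mod_cast Nat.pos_of_ne_zero AddSubgroup.FiniteIndex.index_ne_zero
  rw [torusAverage_eq_sum, smul_eq_mul, inv_mul_le_iff₀ hpos]
  simp only [mFourier_torusPoint]
  refine (sum_addChar_invSqrtDist_le _).trans_eq ?_
  rw [AddSubgroup.index, mul_comm]

end Torus

/-! ### Averages of functions with logarithmic singularities -/

section LogAverage

variable {d : ℕ}

/-- The kernel is (Nℤ)^d. These sublattices show that the filter ⟨Λ⟩ → ∞ is nontrivial. The
condition d ≥ 1 provides a nonzero vector; otherwise the infimum would be over the empty set. -/
theorem le_minLength_ker (hd : 1 ≤ d) {N : ℕ} (hN : 0 < N) :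
    (N : ℝ) ≤ Graph.minLength ((Int.castAddHom (ZMod N)).compLeft (Fin d)).ker := by
  refine le_csInf ?_ ?_
  · refine ⟨_, Pi.single ⟨0, hd⟩ (N : ℤ), ?_, ?_, rfl⟩
    · rw [AddMonoidHom.mem_ker]
      ext i
      by_cases h : i = ⟨0, hd⟩
      · subst h; simp
      · simp [Pi.single_eq_of_ne h]
    · intro h
      have := congrFun h ⟨0, hd⟩
      simp at this
      omega
  · rintro _ ⟨v, hv, h0, rfl⟩
    obtain ⟨i, hi⟩ := Function.ne_iff.mp h0
    have h1 : (N : ℤ) ∣ v i := by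
      rw [AddMonoidHom.mem_ker] at hv
      have := congrFun hv i
      exact (ZMod.intCast_zmod_eq_zero_iff_dvd _ _).mp this
    have h2 : (N : ℤ) ≤ |v i| := Int.le_of_dvd (abs_pos.mpr hi) ((dvd_abs _ _).mpr h1)
    refine Real.le_sqrt_of_sq_le ?_
    have h3 : (N : ℝ) ≤ |(v i : ℝ)| := by exact_mod_cast h2
    have h4 : (N : ℝ) ^ 2 ≤ (v i : ℝ) ^ 2 := by
      rw [← sq_abs (v i : ℝ)]
      gcongr
    exact h4.trans (Finset.single_le_sum (f := fun j => (v j : ℝ) ^ 2)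
      (fun _ _ => sq_nonneg _) (Finset.mem_univ i))

theorem minLengthAtTop_neBot (hd : 1 ≤ d) : (Graph.minLengthAtTop d).NeBot := by
  have h : Tendsto (fun N : ℕ => ((Int.castAddHom (ZMod (N + 1))).compLeft (Fin d)).ker) atTop
      (Graph.minLengthAtTop d) := by
    refine tendsto_inf.mpr ⟨tendsto_comap_iff.mpr ?_, tendsto_principal.mpr ?_⟩
    · refine tendsto_atTop_mono (fun N => le_minLength_ker hd N.succ_pos) ?_
      exact tendsto_natCast_atTop_atTop.comp (tendsto_add_atTop_nat 1)
    · refine Eventually.of_forall fun N => ?_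
      exact AddSubgroup.finiteIndex_ker _
  exact h.neBot

theorem torusAverage_mono {Λ : AddSubgroup (Fin d → ℤ)} [Λ.FiniteIndex]
    {φ φ' : UnitAddTorus (Fin d) → ℝ} (h : ∀ θ, φ θ ≤ φ' θ) :
    torusAverage Λ φ ≤ torusAverage Λ φ' := by
  have := AddSubgroup.finite_quotient_of_finiteIndex (H := Λ)
  rw [torusAverage_eq_sum, torusAverage_eq_sum]
  exact smul_le_smul_of_nonneg_left (Finset.sum_le_sum fun ψ _ => h _) (by positivity)

theorem torusAverage_const_mul {Λ : AddSubgroup (Fin d → ℤ)} [Λ.FiniteIndex]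
    (c : ℝ) (φ : UnitAddTorus (Fin d) → ℝ) :
    torusAverage Λ (fun θ => c * φ θ) = c * torusAverage Λ φ := by
  have := AddSubgroup.finite_quotient_of_finiteIndex (H := Λ)
  rw [torusAverage_eq_sum, torusAverage_eq_sum, ← Finset.mul_sum, mul_smul_comm]

theorem torusAverage_sum_le {Λ : AddSubgroup (Fin d → ℤ)} [Λ.FiniteIndex]
    {ι : Type*} [Fintype ι] (S : ι → Fin d → ℤ) :
    torusAverage Λ (fun θ => ∑ i, invSqrtDist (UnitAddTorus.mFourier (S i) θ)) ≤
      4 * Fintype.card ι := by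
  have := AddSubgroup.finite_quotient_of_finiteIndex (H := Λ)
  have h : torusAverage Λ (fun θ => ∑ i, invSqrtDist (UnitAddTorus.mFourier (S i) θ)) =
      ∑ i, torusAverage Λ (fun θ => invSqrtDist (UnitAddTorus.mFourier (S i) θ)) := by
    simp only [torusAverage_eq_sum, ← Finset.smul_sum]
    rw [Finset.sum_comm]
  rw [h]
  refine (Finset.sum_le_sum fun i _ => torusAverage_invSqrtDist_le (S i)).trans_eq ?_
  simp [mul_comm]

/-- Distinct characters give distinct points, so the sum is bounded by the total of |g| over `Z`,
while the index tends to infinity. -/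
theorem tendsto_torusAverage_indicator (hd : 1 ≤ d) {Z : Set (UnitAddTorus (Fin d))}
    (hZ : Z.Finite) (g : UnitAddTorus (Fin d) → ℝ) :
    Tendsto (fun Λ => torusAverage Λ (Z.indicator g)) (Graph.minLengthAtTop d) (𝓝 0) := by
  classical
  have h1 : Tendsto (fun Λ : AddSubgroup (Fin d → ℤ) =>
      (Λ.index : ℝ)⁻¹ * ∑ z ∈ hZ.toFinset, |g z|) (Graph.minLengthAtTop d) (𝓝 0) := by
    have := (tendsto_index hd).inv_tendsto_atTop.mul_const (∑ z ∈ hZ.toFinset, |g z|)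
    simpa using this
  refine squeeze_zero_norm' ?_ h1
  filter_upwards [eventually_finiteIndex d] with Λ hΛ
  have := AddSubgroup.finite_quotient_of_finiteIndex (H := Λ)
  rw [torusAverage_eq_sum, norm_smul, Real.norm_of_nonneg (by positivity)]
  refine mul_le_mul_of_nonneg_left ?_ (by positivity)
  refine (norm_sum_le _ _).trans ?_
  have h2 : ∑ ψ : AddChar ((Fin d → ℤ) ⧸ Λ) ℂ, ‖Z.indicator g (torusPoint ψ)‖ =
      ∑ θ ∈ Finset.univ.image (torusPoint (Λ := Λ)), ‖Z.indicator g θ‖ :=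
    (Finset.sum_image (f := fun θ => ‖Z.indicator g θ‖) (torusPoint_injective.injOn)).symm
  rw [h2]
  have h3 : ∑ z ∈ hZ.toFinset, |g z| = ∑ z ∈ hZ.toFinset, ‖Z.indicator g z‖ :=
    Finset.sum_congr rfl fun z hz => by
      rw [Set.indicator_of_mem (hZ.mem_toFinset.mp hz), Real.norm_eq_abs]
  rw [h3, Finset.sum_subset (Finset.subset_union_right (s₁ :=
    Finset.univ.image (torusPoint (Λ := Λ))) (s₂ := hZ.toFinset)) (fun z _ hz => by
      rw [Set.indicator_of_notMem (fun h => hz (hZ.mem_toFinset.mpr h)), norm_zero])]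
  exact Finset.sum_le_sum_of_subset_of_nonneg Finset.subset_union_left fun _ _ _ => norm_nonneg _

variable {f : UnitAddTorus (Fin d) → ℝ} {Z : Set (UnitAddTorus (Fin d))} {p : ℝ}
  {ι : Type*} [Fintype ι] {S : ι → Fin d → ℤ}

/-- The singularities of `log f` are controlled by finitely many characters. -/
structure HasLogControl (f : UnitAddTorus (Fin d) → ℝ) (Z : Set (UnitAddTorus (Fin d))) (p : ℝ)
    {ι : Type*} [Fintype ι] (S : ι → Fin d → ℤ) : Prop where
  continuous : Continuous f
  finite : Z.Finite
  exponent_pos : 0 < p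
  pos : ∀ θ ∉ Z, 0 < f θ
  rpow_neg_le : ∀ θ ∉ Z, f θ ^ (-p) ≤ ∑ i, invSqrtDist (UnitAddTorus.mFourier (S i) θ)

namespace HasLogControl

variable (h : HasLogControl f Z p S)
include h

/-- Apply log x ≤ x^p / p to x = ε / f(θ). -/
theorem log_max_sub_le {ε : ℝ} (hε : 0 < ε) {θ : UnitAddTorus (Fin d)} (hθ : θ ∉ Z) :
    Real.log (max (f θ) ε) - Real.log (f θ) ≤
      ε ^ p / p * ∑ i, invSqrtDist (UnitAddTorus.mFourier (S i) θ) := by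
  have hp := h.exponent_pos
  have hf := h.pos θ hθ
  have hH : 0 ≤ ∑ i, invSqrtDist (UnitAddTorus.mFourier (S i) θ) :=
    Finset.sum_nonneg fun _ _ => invSqrtDist_nonneg _
  rcases le_total ε (f θ) with hle | hle
  · rw [max_eq_left hle, sub_self]
    positivity
  · rw [max_eq_right hle, ← Real.log_div hε.ne' hf.ne']
    refine (Real.log_le_rpow_div (by positivity) hp).trans ?_
    rw [Real.div_rpow hε.le hf.le, div_eq_mul_inv (ε ^ p), ← Real.rpow_neg hf.le, mul_div_right_comm]
    exact mul_le_mul_of_nonneg_left (h.rpow_neg_le θ hθ) (by positivity)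

theorem continuous_log_max {ε : ℝ} (hε : 0 < ε) : Continuous fun θ => Real.log (max (f θ) ε) :=
  (h.continuous.max continuous_const).log fun _ => (lt_max_of_lt_right hε).ne'

theorem integrable_log_max {ε : ℝ} (hε : 0 < ε) : Integrable fun θ => Real.log (max (f θ) ε) :=
  (h.continuous_log_max hε).integrable_of_hasCompactSupport (HasCompactSupport.of_compactSpace _)

theorem log_le_log_max {ε : ℝ} {θ : UnitAddTorus (Fin d)} (hθ : θ ∉ Z) :
    Real.log (f θ) ≤ Real.log (max (f θ) ε) :=
  Real.log_le_log (h.pos θ hθ) (le_max_left _ _)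

/-- Both truncations are continuous, so the integral is a limit of averages, and these are bounded
uniformly in Λ. What matters is that the bound does not involve ε'. -/
theorem integral_log_max_sub_le (hd : 1 ≤ d) {ε ε' : ℝ} (hε : 0 < ε) (hε' : 0 < ε') :
    ∫ θ, (Real.log (max (f θ) ε) - Real.log (max (f θ) ε')) ≤
      ε ^ p / p * (4 * Fintype.card ι) := by
  have := minLengthAtTop_neBot hd
  have hp := h.exponent_pos
  have h1 := tendsto_torusAverage ((h.continuous_log_max hε).sub (h.continuous_log_max hε'))
  have h2 := (tendsto_torusAverage_indicator hd h.finite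
    fun θ => |Real.log (max (f θ) ε) - Real.log (max (f θ) ε')|).const_add
      (ε ^ p / p * (4 * Fintype.card ι))
  rw [add_zero] at h2
  refine le_of_tendsto_of_tendsto h1 h2 ?_
  filter_upwards [eventually_finiteIndex d] with Λ hΛ
  have h3 : torusAverage Λ (fun θ => Real.log (max (f θ) ε) - Real.log (max (f θ) ε')) ≤
      torusAverage Λ (fun θ => ε ^ p / p * (∑ i, invSqrtDist (UnitAddTorus.mFourier (S i) θ)) +
        Z.indicator (fun θ => |Real.log (max (f θ) ε) - Real.log (max (f θ) ε')|) θ) := by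
    refine torusAverage_mono fun θ => ?_
    have hH : 0 ≤ ∑ i, invSqrtDist (UnitAddTorus.mFourier (S i) θ) :=
      Finset.sum_nonneg fun _ _ => invSqrtDist_nonneg _
    by_cases hθ : θ ∈ Z
    · rw [Set.indicator_of_mem hθ]
      have := le_abs_self (Real.log (max (f θ) ε) - Real.log (max (f θ) ε'))
      have : 0 ≤ ε ^ p / p * ∑ i, invSqrtDist (UnitAddTorus.mFourier (S i) θ) := by positivity
      linarith
    · rw [Set.indicator_of_notMem hθ]
      have := h.log_max_sub_le hε hθ
      have := h.log_le_log_max (ε := ε') hθ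
      linarith
  rw [torusAverage_add, torusAverage_const_mul] at h3
  refine h3.trans (add_le_add_left ?_ _)
  exact mul_le_mul_of_nonneg_left (torusAverage_sum_le S) (by positivity)

theorem ae_notMem (hd : 1 ≤ d) : ∀ᵐ θ : UnitAddTorus (Fin d), θ ∉ Z := by
  have : NullSingletonClass (volume : Measure (UnitAddTorus (Fin d))) :=
    Measure.pi_nullSingletonClass (⟨0, hd⟩ : Fin d)
  exact measure_eq_zero_iff_ae_notMem.mp (h.finite.measure_zero _)

/-- Fatou's lemma along the truncation levels ε/(n+1) removes the second truncation; integrability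
of log f follows. -/
theorem lintegral_log_max_sub_le (hd : 1 ≤ d) {ε : ℝ} (hε : 0 < ε) :
    ∫⁻ θ, ENNReal.ofReal (Real.log (max (f θ) ε) - Real.log (f θ)) ≤
      ENNReal.ofReal (ε ^ p / p * (4 * Fintype.card ι)) := by
  let u : ℕ → ℝ := fun n => ε / (n + 1)
  have hu : ∀ n, 0 < u n := fun n => by positivity
  have hule : ∀ n, u n ≤ ε := fun n => div_le_self hε.le (by
    have : (0 : ℝ) ≤ n := Nat.cast_nonneg n
    linarith)
  have hutend : Tendsto u atTop (𝓝 0) := by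
    have := (tendsto_one_div_add_atTop_nhds_zero_nat (𝕜 := ℝ)).const_mul ε
    simpa [u, div_eq_mul_inv] using this
  have h1 : ∀ᵐ θ : UnitAddTorus (Fin d),
      ENNReal.ofReal (Real.log (max (f θ) ε) - Real.log (f θ)) =
        liminf (fun n => ENNReal.ofReal
          (Real.log (max (f θ) ε) - Real.log (max (f θ) (u n)))) atTop := by
    filter_upwards [h.ae_notMem hd] with θ hθ
    refine (Tendsto.liminf_eq (tendsto_nhds_of_eventually_eq ?_)).symm
    filter_upwards [hutend.eventually_lt_const (h.pos θ hθ)] with n hn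
    rw [max_eq_left hn.le]
  rw [lintegral_congr_ae h1]
  refine (lintegral_liminf_le fun n => ?_).trans ?_
  · exact ((h.continuous_log_max hε).sub (h.continuous_log_max (hu n))).measurable.ennreal_ofReal
  · refine liminf_le_of_le (by isBoundedDefault) fun b hb => ?_
    obtain ⟨n, hn⟩ := hb.exists
    refine hn.trans ?_
    rw [← ofReal_integral_eq_lintegral_ofReal (f := fun θ =>
      Real.log (max (f θ) ε) - Real.log (max (f θ) (u n)))
      ((h.integrable_log_max hε).sub (h.integrable_log_max (hu n)))]
    · exact ENNReal.ofReal_le_ofReal (h.integral_log_max_sub_le hd hε (hu n))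
    · filter_upwards with θ
      refine sub_nonneg.mpr (Real.log_le_log (lt_max_of_lt_right (hu n)) ?_)
      exact max_le_max le_rfl (hule n)

theorem integrable_log_max_sub (hd : 1 ≤ d) {ε : ℝ} (hε : 0 < ε) :
    Integrable fun θ => Real.log (max (f θ) ε) - Real.log (f θ) := by
  refine ⟨((h.continuous_log_max hε).measurable.sub
    (Real.measurable_log.comp h.continuous.measurable)).aestronglyMeasurable, ?_⟩
  rw [hasFiniteIntegral_iff_ofReal]
  · exact (h.lintegral_log_max_sub_le hd hε).trans_lt ENNReal.ofReal_lt_top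
  · filter_upwards [h.ae_notMem hd] with θ hθ
    exact sub_nonneg.mpr (h.log_le_log_max hθ)

theorem integrable_log (hd : 1 ≤ d) : Integrable fun θ => Real.log (f θ) := by
  have := (h.integrable_log_max one_pos).sub (h.integrable_log_max_sub hd one_pos)
  refine this.congr (Eventually.of_forall fun θ => ?_)
  simp

theorem abs_integral_sub_le (hd : 1 ≤ d) {ε : ℝ} (hε : 0 < ε) :
    |(∫ θ, Real.log (max (f θ) ε)) - ∫ θ, Real.log (f θ)| ≤ ε ^ p / p * (4 * Fintype.card ι) := by
  have hp := h.exponent_pos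
  have hnn : 0 ≤ᵐ[volume] fun θ => Real.log (max (f θ) ε) - Real.log (f θ) := by
    filter_upwards [h.ae_notMem hd] with θ hθ
    exact sub_nonneg.mpr (h.log_le_log_max hθ)
  rw [← integral_sub (h.integrable_log_max hε) (h.integrable_log hd),
    abs_of_nonneg (integral_nonneg_of_ae hnn),
    integral_eq_lintegral_of_nonneg_ae hnn (h.integrable_log_max_sub hd hε).1]
  exact ENNReal.toReal_le_of_le_ofReal (by positivity) (h.lintegral_log_max_sub_le hd hε)

theorem abs_torusAverage_sub_le {Λ : AddSubgroup (Fin d → ℤ)} [Λ.FiniteIndex] {ε : ℝ}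
    (hε : 0 < ε) :
    |torusAverage Λ (fun θ => Real.log (max (f θ) ε)) - torusAverage Λ fun θ => Real.log (f θ)| ≤
      ε ^ p / p * (4 * Fintype.card ι) +
        torusAverage Λ (Z.indicator fun θ => |Real.log (max (f θ) ε) - Real.log (f θ)|) := by
  have hp := h.exponent_pos
  have hbd : ∀ θ, |Real.log (max (f θ) ε) - Real.log (f θ)| ≤
      ε ^ p / p * (∑ i, invSqrtDist (UnitAddTorus.mFourier (S i) θ)) +
        Z.indicator (fun θ => |Real.log (max (f θ) ε) - Real.log (f θ)|) θ := by
    intro θ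
    have hH : 0 ≤ ∑ i, invSqrtDist (UnitAddTorus.mFourier (S i) θ) :=
      Finset.sum_nonneg fun _ _ => invSqrtDist_nonneg _
    by_cases hθ : θ ∈ Z
    · rw [Set.indicator_of_mem hθ]
      have : 0 ≤ ε ^ p / p * ∑ i, invSqrtDist (UnitAddTorus.mFourier (S i) θ) := by positivity
      linarith
    · rw [Set.indicator_of_notMem hθ, add_zero,
        abs_of_nonneg (sub_nonneg.mpr (h.log_le_log_max hθ))]
      exact h.log_max_sub_le hε hθ
  have h1 : torusAverage Λ (fun θ =>
      ε ^ p / p * (∑ i, invSqrtDist (UnitAddTorus.mFourier (S i) θ)) +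
        Z.indicator (fun θ => |Real.log (max (f θ) ε) - Real.log (f θ)|) θ) ≤
      ε ^ p / p * (4 * Fintype.card ι) +
        torusAverage Λ (Z.indicator fun θ => |Real.log (max (f θ) ε) - Real.log (f θ)|) := by
    rw [torusAverage_add, torusAverage_const_mul]
    refine add_le_add_left ?_ _
    exact mul_le_mul_of_nonneg_left (torusAverage_sum_le S) (by positivity)
  rw [← torusAverage_sub]
  refine le_trans (abs_le.mpr ⟨?_, ?_⟩) h1
  · have := torusAverage_mono (Λ := Λ) fun θ => neg_le_of_abs_le (hbd θ)
    refine le_trans (le_of_eq ?_) this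
    have h2 := torusAverage_const_mul (Λ := Λ) (-1) (fun θ =>
      ε ^ p / p * (∑ i, invSqrtDist (UnitAddTorus.mFourier (S i) θ)) +
        Z.indicator (fun θ => |Real.log (max (f θ) ε) - Real.log (f θ)|) θ)
    simp only [neg_one_mul] at h2
    exact h2.symm
  · exact torusAverage_mono fun θ => le_of_abs_le (hbd θ)

/-- The averages of `log f` over the annihilators of `Λ` converge to the integral of `log f`. -/
theorem tendsto_torusAverage_log (hd : 1 ≤ d) :
    Tendsto (fun Λ => torusAverage Λ fun θ => Real.log (f θ)) (Graph.minLengthAtTop d)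
      (𝓝 (∫ θ, Real.log (f θ))) := by
  have hp := h.exponent_pos
  rw [Metric.tendsto_nhds]
  intro δ hδ
  have hlim : Tendsto (fun ε : ℝ => ε ^ p / p * (4 * Fintype.card ι)) (𝓝[>] 0) (𝓝 0) := by
    have h1 : Tendsto (fun ε : ℝ => ε ^ p) (𝓝[>] 0) (𝓝 0) := by
      have := (Real.continuousAt_rpow_const 0 p (Or.inr hp.le)).tendsto
      rw [Real.zero_rpow hp.ne'] at this
      exact this.mono_left nhdsWithin_le_nhds
    have := (h1.div_const p).mul_const (4 * (Fintype.card ι : ℝ))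
    simpa using this
  -- The level ε is fixed before Λ varies, since the truncation error off `Z` is bounded uniformly
  -- in Λ. Four errors of at most δ/4 add up: equidistribution, truncation in the average, the
  -- points of `Z`, and truncation in the integral.
  obtain ⟨ε, hεδ, hε⟩ := ((hlim.eventually_lt_const (show 0 < δ / 4 by positivity)).and
    self_mem_nhdsWithin).exists
  have hε : 0 < ε := hε
  filter_upwards [eventually_finiteIndex d,
    Metric.tendsto_nhds.mp (tendsto_torusAverage (h.continuous_log_max hε)) (δ / 4) (by positivity),
    (tendsto_torusAverage_indicator hd h.finite
      fun θ => |Real.log (max (f θ) ε) - Real.log (f θ)|).eventually_lt_const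
        (show 0 < δ / 4 by positivity)] with Λ hΛ h1 h2
  have h3 := h.abs_torusAverage_sub_le (Λ := Λ) hε
  have h4 := h.abs_integral_sub_le hd hε
  rw [Real.dist_eq] at h1 ⊢
  rw [abs_le] at h3 h4
  rw [abs_lt] at h1 ⊢
  constructor <;> linarith [h1.1, h1.2, h3.1, h3.2, h4.1, h4.2]

end HasLogControl

end LogAverage

/-! ### Integer matrices as endomorphisms of the torus -/

section LatticeHom

variable {d : ℕ}

/-- The index times each basis vector lies in the subgroup generated by `S`, so `S` spans ℚ^d and
contains a basis. -/
theorem exists_det_ne_zero_of_finite_quotient (S : Set (Fin d → ℤ))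
    [Finite ((Fin d → ℤ) ⧸ AddSubgroup.closure S)] :
    ∃ c : Fin d → Fin d → ℤ, (∀ i, c i ∈ S) ∧ (Matrix.of c).det ≠ 0 := by
  let φ : (Fin d → ℤ) →+ (Fin d → ℚ) := (Int.castAddHom ℚ).compLeft (Fin d)
  have hspan : Submodule.span ℚ (φ '' S) = ⊤ := by
    have h1 : ∀ v ∈ AddSubgroup.closure S, φ v ∈ Submodule.span ℚ (φ '' S) := by
      intro v hv
      induction hv using AddSubgroup.closure_induction with
      | mem v hv => exact Submodule.subset_span ⟨v, hv, rfl⟩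
      | zero => simp
      | add v w _ _ hv hw => rw [map_add]; exact Submodule.add_mem _ hv hw
      | neg v _ hv => rw [map_neg]; exact Submodule.neg_mem _ hv
    rw [eq_top_iff, ← (Pi.basisFun ℚ (Fin d)).span_eq, Submodule.span_le]
    rintro _ ⟨i, rfl⟩
    have h2 := h1 _ (AddSubgroup.nsmul_index_mem (AddSubgroup.closure S) (Pi.single i 1))
    have h3 : (AddSubgroup.closure S).index ≠ 0 := AddSubgroup.index_ne_zero_of_finite
    rw [map_nsmul, ← Nat.cast_smul_eq_nsmul ℚ] at h2
    have h4 : φ (Pi.single i 1) = Pi.basisFun ℚ (Fin d) i := by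
      ext j
      by_cases h : j = i
      · subst h; simp [φ]
      · simp [φ, Pi.single_eq_of_ne h]
    rw [h4] at h2
    exact (Submodule.smul_mem_iff _ (by exact_mod_cast h3)).mp h2
  obtain ⟨b, hb, hbspan, hli⟩ := exists_linearIndependent ℚ (φ '' S)
  rw [hspan] at hbspan
  let B : Module.Basis b ℚ (Fin d → ℚ) := Module.Basis.mk hli (by
    rw [Subtype.range_coe, hbspan])
  have e : Fin d ≃ b := (Pi.basisFun ℚ (Fin d)).indexEquiv B
  have hc : ∀ i, ∃ v ∈ S, φ v = (e i).1 := fun i => hb (e i).2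
  choose c hcS hc using hc
  refine ⟨c, hcS, fun hdet => ?_⟩
  have h5 : LinearIndependent ℚ fun i => φ (c i) := by
    simp only [hc]
    exact hli.comp e e.injective
  have h6 : IsUnit ((Matrix.of c).map (Int.cast : ℤ → ℚ)) :=
    Matrix.linearIndependent_rows_iff_isUnit.mp h5
  have h7 := (Matrix.isUnit_iff_isUnit_det _).mp h6
  have h8 : ((Matrix.of c).map (Int.cast : ℤ → ℚ)).det = 0 := by
    have := (Int.castRingHom ℚ).map_det (Matrix.of c)
    rw [hdet, map_zero] at this
    exact this.symm
  rw [h8] at h7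
  exact not_isUnit_zero h7

/-- The endomorphism of the torus given by an integer matrix. -/
def torusHom (c : Matrix (Fin d) (Fin d) ℤ) : UnitAddTorus (Fin d) →+ UnitAddTorus (Fin d) where
  toFun θ i := ∑ j, c i j • θ j
  map_zero' := by ext; simp
  map_add' θ θ' := by ext i; simp [Finset.sum_add_distrib]

theorem torusHom_apply (c : Matrix (Fin d) (Fin d) ℤ) (θ : UnitAddTorus (Fin d)) (i : Fin d) :
    torusHom c θ i = ∑ j, c i j • θ j := rfl

theorem mFourier_eq_toCircle (s : Fin d → ℤ) (θ : UnitAddTorus (Fin d)) :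
    UnitAddTorus.mFourier s θ = ((AddCircle.toCircle (∑ j, s j • θ j) : Circle) : ℂ) := by
  have h : ∀ S : Finset (Fin d), ((AddCircle.toCircle (∑ j ∈ S, s j • θ j) : Circle) : ℂ) =
      ∏ j ∈ S, ((AddCircle.toCircle (s j • θ j) : Circle) : ℂ) := fun S => by
    classical
    induction S using Finset.induction_on with
    | empty => simp
    | insert i S hi ih =>
      rw [Finset.sum_insert hi, Finset.prod_insert hi, AddCircle.toCircle_add, Circle.coe_mul, ih]
  rw [h]
  simp only [UnitAddTorus.mFourier, ContinuousMap.coe_mk, fourier_apply]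

theorem mFourier_row (c : Matrix (Fin d) (Fin d) ℤ) (θ : UnitAddTorus (Fin d)) (i : Fin d) :
    UnitAddTorus.mFourier (c i) θ = fourier 1 (torusHom c θ i) := by
  rw [mFourier_eq_toCircle, fourier_one, torusHom_apply]

theorem mFourier_eq_one_iff (s : Fin d → ℤ) (θ : UnitAddTorus (Fin d)) :
    UnitAddTorus.mFourier s θ = 1 ↔ ∑ j, s j • θ j = 0 := by
  rw [mFourier_eq_toCircle, Circle.coe_eq_one, ← AddCircle.toCircle_zero (T := 1)]
  exact (AddCircle.injective_toCircle one_ne_zero).eq_iff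

theorem torusHom_comp_apply (b c : Matrix (Fin d) (Fin d) ℤ) (θ : UnitAddTorus (Fin d)) :
    torusHom b (torusHom c θ) = torusHom (b * c) θ := by
  ext i
  simp only [torusHom_apply, Finset.smul_sum, Matrix.mul_apply, Finset.sum_smul, mul_smul]
  rw [Finset.sum_comm]

theorem torusHom_scalar (D : ℤ) (θ : UnitAddTorus (Fin d)) :
    torusHom (D • (1 : Matrix (Fin d) (Fin d) ℤ)) θ = D • θ := by
  ext i
  rw [torusHom_apply, Finset.sum_eq_single i]
  · simp
  · intro j _ hj
    simp [Matrix.one_apply_ne hj.symm]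
  · simp

theorem finite_zsmul_eq_zero {D : ℤ} (hD : D ≠ 0) : {x : UnitAddCircle | D • x = 0}.Finite := by
  refine (AddCircle.finite_torsion (1 : ℝ) (Int.natAbs_pos.mpr hD)).subset fun x hx => ?_
  have h1 : D • x = 0 := hx
  change D.natAbs • x = 0
  rcases Int.natAbs_eq D with h | h
  · rwa [h, natCast_zsmul] at h1
  · rwa [h, neg_smul, natCast_zsmul, neg_eq_zero] at h1

/-- Multiplying by the adjugate shows that every coordinate of a kernel element is killed by det c,
and the circle has finite torsion. -/
theorem finite_torusHom_ker {c : Matrix (Fin d) (Fin d) ℤ} (hc : c.det ≠ 0) :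
    {θ | torusHom c θ = 0}.Finite := by
  refine Set.Finite.subset (Set.Finite.pi fun _ : Fin d => finite_zsmul_eq_zero hc) ?_
  intro θ hθ i _
  have h1 : torusHom c θ = 0 := hθ
  have h2 := torusHom_comp_apply c.adjugate c θ
  rw [h1, map_zero] at h2
  rw [Matrix.adjugate_mul, torusHom_scalar] at h2
  exact (congrFun h2 i).symm

/-- The circle is divisible: divide by det c, then apply the adjugate. -/
theorem torusHom_surjective {c : Matrix (Fin d) (Fin d) ℤ} (hc : c.det ≠ 0) :
    Function.Surjective (torusHom c) := by
  intro y
  have h1 : ∃ z : UnitAddTorus (Fin d), c.det • z = y := by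
    have : ∀ i, ∃ x : UnitAddCircle, c.det • x = y i := fun i => by
      obtain ⟨r, hr⟩ := QuotientAddGroup.mk_surjective (y i)
      refine ⟨((r / c.det : ℝ) : UnitAddCircle), ?_⟩
      rw [← hr, ← AddCircle.coe_zsmul, zsmul_eq_mul]
      congr 1
      have : (c.det : ℝ) ≠ 0 := by exact_mod_cast hc
      field_simp
    choose z hz using this
    exact ⟨z, funext hz⟩
  obtain ⟨z, rfl⟩ := h1
  refine ⟨torusHom c.adjugate z, ?_⟩
  rw [torusHom_comp_apply, Matrix.mul_adjugate, torusHom_scalar]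

/-- A continuous surjective endomorphism of a compact group carries Haar measure to an invariant
measure of the same mass. -/
theorem measurePreserving_torusHom {c : Matrix (Fin d) (Fin d) ℤ} (hc : c.det ≠ 0) :
    MeasurePreserving (torusHom c) :=
  AddMonoidHom.measurePreserving
    (continuous_pi fun i => by
      change Continuous fun θ : UnitAddTorus (Fin d) => ∑ j, c i j • θ j
      fun_prop)
    (torusHom_surjective hc) rfl

end LatticeHom

/-! ### Logarithmic control by Cayley graph Laplacians -/

section LogControl

variable {d : ℕ}

/-- The value `∑ i, |1 - χ (c i)| ^ 2` of the Laplacian polynomial of the Cayley graph with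
generators `c i`. -/
noncomputable def cayleyLaplacian (c : Matrix (Fin d) (Fin d) ℤ) (θ : UnitAddTorus (Fin d)) : ℝ :=
  ∑ i, ‖1 - UnitAddTorus.mFourier (c i) θ‖ ^ 2

theorem cayleyLaplacian_nonneg (c : Matrix (Fin d) (Fin d) ℤ) (θ : UnitAddTorus (Fin d)) :
    0 ≤ cayleyLaplacian c θ := Finset.sum_nonneg fun _ _ => by positivity

theorem cayleyLaplacian_eq_zero_iff {c : Matrix (Fin d) (Fin d) ℤ} {θ : UnitAddTorus (Fin d)} :
    cayleyLaplacian c θ = 0 ↔ torusHom c θ = 0 := by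
  rw [cayleyLaplacian, Finset.sum_eq_zero_iff_of_nonneg fun _ _ => by positivity]
  simp only [Finset.mem_univ, true_implies, sq_eq_zero_iff, norm_eq_zero, sub_eq_zero,
    eq_comm (a := (1 : ℂ)), mFourier_eq_one_iff]
  exact funext_iff.symm

/-- Some summand |1 - χ|² is nonzero, and the exponent -1/4 turns this square into |1 - χ|^(-1/2).
-/
theorem cayleyLaplacian_rpow_le {c : Matrix (Fin d) (Fin d) ℤ} {θ : UnitAddTorus (Fin d)}
    (h : 0 < cayleyLaplacian c θ) :
    cayleyLaplacian c θ ^ (-(1 / 4) : ℝ) ≤ ∑ i, invSqrtDist (UnitAddTorus.mFourier (c i) θ) := by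
  have h1 : ∃ i, UnitAddTorus.mFourier (c i) θ ≠ 1 := by
    by_contra! hne
    simp [cayleyLaplacian, hne] at h
  obtain ⟨i, hi⟩ := h1
  have h2 : 0 < ‖1 - UnitAddTorus.mFourier (c i) θ‖ := by
    rw [norm_pos_iff, sub_ne_zero]
    exact hi.symm
  have h3 : ‖1 - UnitAddTorus.mFourier (c i) θ‖ ^ 2 ≤ cayleyLaplacian c θ :=
    Finset.single_le_sum (f := fun i => ‖1 - UnitAddTorus.mFourier (c i) θ‖ ^ 2)
      (fun _ _ => by positivity) (Finset.mem_univ i)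
  refine (Real.rpow_le_rpow_of_nonpos (by positivity) h3 (by norm_num)).trans ?_
  have h4 : (‖1 - UnitAddTorus.mFourier (c i) θ‖ ^ 2) ^ (-(1 / 4) : ℝ) =
      invSqrtDist (UnitAddTorus.mFourier (c i) θ) := by
    rw [invSqrtDist, ← Real.rpow_natCast, ← Real.rpow_mul h2.le, Real.sqrt_eq_rpow,
      ← Real.rpow_neg h2.le]
    norm_num
  rw [h4]
  exact Finset.single_le_sum (f := fun i => invSqrtDist (UnitAddTorus.mFourier (c i) θ))
    (fun _ _ => invSqrtDist_nonneg _) (Finset.mem_univ i)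

/-- The exceptional set attached to finitely many integer matrices. -/
def exceptionalSet {K : ℕ} (c : Fin K → Matrix (Fin d) (Fin d) ℤ) : Set (UnitAddTorus (Fin d)) :=
  ⋃ k, {θ | torusHom (c k) θ = 0}

/-- The K-th power of the smallest factor bounds f from below, so the exponent 1/(4K) leaves that
factor to the power -1/4. -/
theorem hasLogControl_of_prod_le {f : UnitAddTorus (Fin d) → ℝ} (hf : Continuous f) {K : ℕ}
    (hK : 0 < K) {c : Fin K → Matrix (Fin d) (Fin d) ℤ} (hc : ∀ k, (c k).det ≠ 0)
    (hle : ∀ θ, ∏ k, cayleyLaplacian (c k) θ ≤ f θ) :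
    HasLogControl f (exceptionalSet c) (1 / (4 * K))
      (fun x : Fin K × Fin d => c x.1 x.2) := by
  have hK' : (0 : ℝ) < K := by exact_mod_cast hK
  have hpos : ∀ θ ∉ exceptionalSet c, ∀ k, 0 < cayleyLaplacian (c k) θ := by
    intro θ hθ k
    refine (cayleyLaplacian_nonneg _ _).lt_of_ne fun h => hθ ?_
    exact Set.mem_iUnion.mpr ⟨k, cayleyLaplacian_eq_zero_iff.mp h.symm⟩
  refine ⟨hf, Set.finite_iUnion fun k => finite_torusHom_ker (hc k), by positivity, ?_, ?_⟩
  · intro θ hθ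
    exact (Finset.prod_pos fun k _ => hpos θ hθ k).trans_le (hle θ)
  · intro θ hθ
    have : Nonempty (Fin K) := ⟨⟨0, hK⟩⟩
    obtain ⟨k₀, _, hk₀⟩ := Finset.exists_min_image Finset.univ
      (fun k => cayleyLaplacian (c k) θ) Finset.univ_nonempty
    have h1 : cayleyLaplacian (c k₀) θ ^ K ≤ ∏ k, cayleyLaplacian (c k) θ := by
      have := Finset.prod_le_prod (s := Finset.univ) (f := fun _ : Fin K =>
        cayleyLaplacian (c k₀) θ) (g := fun k => cayleyLaplacian (c k) θ)
        (fun _ _ => cayleyLaplacian_nonneg _ _) (fun k _ => hk₀ k (Finset.mem_univ k))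
      simpa using this
    have h2 := hpos θ hθ k₀
    have h3 : f θ ^ (-(1 / (4 * K)) : ℝ) ≤ (cayleyLaplacian (c k₀) θ ^ K) ^ (-(1 / (4 * K)) : ℝ) :=
      Real.rpow_le_rpow_of_nonpos (by positivity) (h1.trans (hle θ)) (by
        rw [neg_nonpos]
        positivity)
    have h4 : (cayleyLaplacian (c k₀) θ ^ K) ^ (-(1 / (4 * K)) : ℝ) =
        cayleyLaplacian (c k₀) θ ^ (-(1 / 4) : ℝ) := by
      rw [← Real.rpow_natCast, ← Real.rpow_mul h2.le]
      congr 1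
      field_simp
    rw [h4] at h3
    refine h3.trans ((cayleyLaplacian_rpow_le h2).trans ?_)
    rw [Fintype.sum_prod_type]
    exact Finset.single_le_sum (f := fun k =>
      ∑ i, invSqrtDist (UnitAddTorus.mFourier (c k i) θ))
      (fun _ _ => Finset.sum_nonneg fun _ _ => invSqrtDist_nonneg _) (Finset.mem_univ k₀)

end LogControl

/-! ### Lower bound for the Laplacian determinant by contracting edges -/

section Contraction

theorem mFourier_add_apply {d : ℕ} (s t : Fin d → ℤ) (θ : UnitAddTorus (Fin d)) :
    UnitAddTorus.mFourier (s + t) θ = UnitAddTorus.mFourier s θ * UnitAddTorus.mFourier t θ :=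
  UnitAddTorus.mFourier_add

open scoped ComplexOrder

/-- If a row of `W` is a multiple of modulus one of a basis vector, then deleting the corresponding
column of `W` does not increase the Gram determinant. -/
theorem det_gram_submatrix_le {n : ℕ} {ε : Type*} [Fintype ε] [DecidableEq ε]
    (W : Matrix ε (Fin (n + 1)) ℂ) (e : ε) (u : Fin (n + 1)) {z : ℂ} (hz : ‖z‖ = 1)
    (hW : W e = Pi.single u z) :
    ((W.submatrix id u.succAbove).conjTranspose * W.submatrix id u.succAbove).det ≤
      (W.conjTranspose * W).det := by
  -- Since |z| = 1, the Gram matrix of `W` is N + E_uu. Linearity of the determinant in row u gives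
  -- det N ≥ 0 plus the principal minor with u deleted, which is the same for N as for the Gram
  -- matrix of `W`.
  set W₀ := W.updateRow e 0
  set N := W₀.conjTranspose * W₀
  have hzz : star z * z = 1 := by
    rw [Complex.star_def, Complex.conj_mul', hz]
    simp
  have h1 : W.conjTranspose * W = N.updateRow u (N u + Pi.single u 1) := by
    ext i j
    have h2 : (W.conjTranspose * W) i j = N i j + star (W e i) * W e j := by
      simp only [N, Matrix.mul_apply, Matrix.conjTranspose_apply]
      rw [← Finset.add_sum_erase _ _ (Finset.mem_univ e),
        ← Finset.add_sum_erase (a := e) (f := fun k => star (W₀ k i) * W₀ k j) _ (Finset.mem_univ e),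
        add_comm]
      have : star (W₀ e i) * W₀ e j = 0 := by simp [W₀]
      rw [this, zero_add]
      congr 1
      refine Finset.sum_congr rfl fun k hk => ?_
      simp [W₀, Matrix.updateRow_ne (Finset.ne_of_mem_erase hk)]
    rw [h2, hW]
    by_cases hi : i = u
    · subst hi
      rw [Matrix.updateRow_self, Pi.add_apply, Pi.single_eq_same]
      by_cases hj : j = i
      · subst hj
        rw [Pi.single_eq_same, Pi.single_eq_same, hzz]
      · simp [Pi.single_eq_of_ne hj]
    · rw [Matrix.updateRow_ne hi, Pi.single_eq_of_ne hi]
      simp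
  have h3 : (W.conjTranspose * W).det = N.det + N.adjugate u u := by
    rw [h1, Matrix.det_updateRow_add, Matrix.updateRow_eq_self, Matrix.adjugate_apply]
  have h4 : N.adjugate u u =
      ((W.submatrix id u.succAbove).conjTranspose * W.submatrix id u.succAbove).det := by
    rw [Matrix.adjugate_fin_succ_eq_det_submatrix, ← two_mul, pow_mul]
    simp only [even_two, Even.neg_pow, one_pow, one_mul]
    congr 1
    ext i j
    have := congrFun (congrFun h1 (u.succAbove i)) (u.succAbove j)
    rw [Matrix.updateRow_ne (Fin.succAbove_ne u i)] at this
    rw [Matrix.submatrix_apply, ← this]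
    rfl
  rw [h3, h4]
  exact le_add_of_nonneg_left (Matrix.posSemidef_conjTranspose_mul_self W₀).det_nonneg

variable {d : ℕ} {ε : Type*} [Fintype ε]

/-- The coboundary matrix at the point `θ` of the torus, of the periodic graph with vertex set
`Fin n × ℤ ^ d` whose edge orbits are represented by edges with ends `a k` and `b k`. -/
noncomputable def coboundary {n : ℕ} (a b : ε → Fin n × (Fin d → ℤ))
    (θ : UnitAddTorus (Fin d)) : Matrix ε (Fin n) ℂ :=
  Matrix.of fun k j => (if j = (a k).1 then UnitAddTorus.mFourier (a k).2 θ else 0) -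
    (if j = (b k).1 then UnitAddTorus.mFourier (b k).2 θ else 0)

/-- Every function on the vertices that is constant along edges has finite range: the periodic
graph has finitely many connected components. -/
def HasFiniteRanges {n : ℕ} (a b : ε → Fin n × (Fin d → ℤ)) : Prop :=
  ∀ (X : Type) (F : Fin n × (Fin d → ℤ) → X),
    (∀ k t, F ((a k).1, t + (a k).2) = F ((b k).1, t + (b k).2)) → (Set.range F).Finite

/-- The Gram matrix is diagonal, and its j-th entry is the sum of |1 - χ|² over the shifts χ of the
edges at orbit j. Keeping d edges with independent shifts bounds the entry from below by a
`cayleyLaplacian`. -/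
theorem exists_prod_le_det_of_diagonal {n : ℕ} (a b : ε → Fin n × (Fin d → ℤ))
    (hfin : HasFiniteRanges a b) (hab : ∀ k, (a k).1 = (b k).1) :
    ∃ c : Fin n → Matrix (Fin d) (Fin d) ℤ, (∀ k, (c k).det ≠ 0) ∧
      ∀ θ, ((∏ k, cayleyLaplacian (c k) θ : ℝ) : ℂ) ≤
        ((coboundary a b θ).conjTranspose * coboundary a b θ).det := by
  classical
  have key : ∀ j : Fin n, ∃ e : Fin d → ε, (∀ i, (a (e i)).1 = j) ∧
      (Matrix.of fun i => (b (e i)).2 - (a (e i)).2).det ≠ 0 := by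
    intro j
    let S : Set (Fin d → ℤ) := {s | ∃ k, (a k).1 = j ∧ s = (b k).2 - (a k).2}
    -- Reducing the translation part on orbit j modulo the subgroup of edge shifts is constant along
    -- edges, so the quotient is finite.
    have h1 := hfin ((Fin d → ℤ) ⧸ AddSubgroup.closure S)
      (fun x => if x.1 = j then QuotientAddGroup.mk x.2 else 0) (fun k t => by
        simp only [← hab]
        split_ifs with hk
        · refine (QuotientAddGroup.eq).mpr ?_
          have : -(t + (a k).2) + (t + (b k).2) = (b k).2 - (a k).2 := by abel
          rw [this]
          exact AddSubgroup.subset_closure ⟨k, hk, rfl⟩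
        · rfl)
    have h2 : Finite ((Fin d → ℤ) ⧸ AddSubgroup.closure S) := by
      rw [← Set.finite_univ_iff]
      refine h1.subset fun q _ => ?_
      obtain ⟨s, rfl⟩ := QuotientAddGroup.mk_surjective q
      exact ⟨(j, s), by simp⟩
    obtain ⟨c, hcS, hdet⟩ := exists_det_ne_zero_of_finite_quotient S
    choose e he hce using hcS
    refine ⟨e, he, ?_⟩
    rwa [show (fun i => (b (e i)).2 - (a (e i)).2) = c from funext fun i => (hce i).symm]
  choose e he hdet using key
  refine ⟨fun j => Matrix.of fun i => (b (e j i)).2 - (a (e j i)).2, hdet, fun θ => ?_⟩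
  let w : ε → ℝ := fun k =>
    ‖UnitAddTorus.mFourier (a k).2 θ - UnitAddTorus.mFourier (b k).2 θ‖ ^ 2
  have h1 : (coboundary a b θ).conjTranspose * coboundary a b θ =
      Matrix.diagonal fun j => ((∑ k with (a k).1 = j, w k : ℝ) : ℂ) := by
    ext i j
    have h2 : ∀ k j, coboundary a b θ k j = if j = (a k).1 then
        UnitAddTorus.mFourier (a k).2 θ - UnitAddTorus.mFourier (b k).2 θ else 0 := by
      intro k j
      rw [coboundary, Matrix.of_apply, ← hab]
      split_ifs <;> simp
    simp only [Matrix.mul_apply, Matrix.conjTranspose_apply, h2]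
    by_cases hij : i = j
    · subst hij
      rw [Matrix.diagonal_apply_eq, Finset.sum_filter, Complex.ofReal_sum]
      refine Finset.sum_congr rfl fun k _ => ?_
      by_cases hk : i = (a k).1
      · rw [if_pos hk, if_pos hk.symm, Complex.star_def, Complex.conj_mul']
        simp only [w]
        push_cast
        rfl
      · rw [if_neg hk, if_neg fun h => hk h.symm]
        simp
    · rw [Matrix.diagonal_apply_ne _ hij]
      refine Finset.sum_eq_zero fun k _ => ?_
      by_cases hk : i = (a k).1
      · rw [if_pos hk, if_neg fun h : j = (a k).1 => hij (hk.trans h.symm), mul_zero]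
      · rw [if_neg hk, star_zero, zero_mul]
  rw [h1, Matrix.det_diagonal]
  rw [← Complex.ofReal_prod, Complex.real_le_real]
  refine Finset.prod_le_prod (fun j _ => cayleyLaplacian_nonneg _ _) fun j _ => ?_
  -- Independent rows come from distinct edges, so the chosen terms form a subsum.
  have hinj : Function.Injective (e j) := by
    intro i i' h
    by_contra hne
    refine hdet j (Matrix.det_zero_of_row_eq hne ?_)
    change (b (e j i)).2 - (a (e j i)).2 = (b (e j i')).2 - (a (e j i')).2
    rw [h]
  have h2 : cayleyLaplacian (Matrix.of fun i => (b (e j i)).2 - (a (e j i)).2) θ =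
      ∑ k ∈ Finset.univ.image (e j), w k := by
    rw [Finset.sum_image hinj.injOn, cayleyLaplacian]
    refine Finset.sum_congr rfl fun i _ => ?_
    have h3 : UnitAddTorus.mFourier (b (e j i)).2 θ = UnitAddTorus.mFourier (a (e j i)).2 θ *
        UnitAddTorus.mFourier ((b (e j i)).2 - (a (e j i)).2) θ := by
      rw [← mFourier_add_apply, add_sub_cancel]
    simp only [w]
    rw [h3, ← mul_one_sub, norm_mul, norm_mFourier_apply, one_mul]
    rfl
  rw [h2]
  refine Finset.sum_le_sum_of_subset_of_nonneg ?_ fun _ _ _ => by positivity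
  intro k hk
  simp only [Finset.mem_image, Finset.mem_univ, true_and] at hk
  obtain ⟨i, rfl⟩ := hk
  simp [he]

/-- Induction on the number of vertex orbits: as long as an edge joins two different orbits, it is
contracted. Finite ranges survive, because a function on the contracted graph pulls back along `q`
with the same range. At least one orbit remains, whence K > 0. -/
theorem exists_prod_le_det {n : ℕ} (hn : 0 < n) (a b : ε → Fin n × (Fin d → ℤ))
    (hfin : HasFiniteRanges a b) :
    ∃ K, 0 < K ∧ ∃ c : Fin K → Matrix (Fin d) (Fin d) ℤ, (∀ k, (c k).det ≠ 0) ∧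
      ∀ θ, ((∏ k, cayleyLaplacian (c k) θ : ℝ) : ℂ) ≤
        ((coboundary a b θ).conjTranspose * coboundary a b θ).det := by
  classical
  induction n with
  | zero => exact absurd hn (lt_irrefl 0)
  | succ n ih =>
    by_cases hab : ∀ k, (a k).1 = (b k).1
    · obtain ⟨c, hc, h⟩ := exists_prod_le_det_of_diagonal a b hfin hab
      exact ⟨n + 1, hn, c, hc, h⟩
    push Not at hab
    obtain ⟨e, he⟩ := hab
    set u := (a e).1 with hu
    obtain ⟨w', hw'⟩ := Fin.exists_succAbove_eq he.symm
    set δ := (b e).2 - (a e).2 with hδ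
    -- Vertex orbit u is glued, with shift δ, to the orbit of the other end of e; `q` then sends
    -- both ends of e to the same vertex.
    let τ : Fin (n + 1) → Fin n × (Fin d → ℤ) :=
      u.insertNth (α := fun _ => Fin n × (Fin d → ℤ)) (w', δ) fun j => (j, 0)
    have hτu : τ u = (w', δ) := Fin.insertNth_apply_same _ _ _
    have hτ : ∀ j, τ (u.succAbove j) = (j, 0) := fun j => Fin.insertNth_apply_succAbove _ _ _ _
    let q : Fin (n + 1) × (Fin d → ℤ) → Fin n × (Fin d → ℤ) :=
      fun x => ((τ x.1).1, x.2 + (τ x.1).2)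
    have hn' : 0 < n := Fin.pos w'
    have hfin' : HasFiniteRanges (fun k => q (a k)) (fun k => q (b k)) := by
      intro X F hF
      refine (hfin X (F ∘ q) fun k t => ?_).subset ?_
      · have := hF k t
        simp only [q, Function.comp_apply, add_assoc] at this ⊢
        exact this
      · rintro _ ⟨⟨j, p⟩, rfl⟩
        exact ⟨(u.succAbove j, p), by simp [q, hτ]⟩
    obtain ⟨K, hK, c, hc, hle⟩ := ih hn' _ _ hfin'
    refine ⟨K, hK, c, hc, fun θ => (hle θ).trans ?_⟩
    -- This column operation adds χ_δ times column u to the column of the other end. It clears that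
    -- entry in row e and on the remaining columns realizes the gluing `q`.
    let U : Matrix (Fin (n + 1)) (Fin (n + 1)) ℂ :=
      Matrix.transvection u (b e).1 (UnitAddTorus.mFourier δ θ)
    have hU : U.det = 1 := Matrix.det_transvection_of_ne _ _ he _
    have hUapply : ∀ (k : ε) (j : Fin (n + 1)), (coboundary a b θ * U) k j =
        coboundary a b θ k j + if j = (b e).1 then
          coboundary a b θ k u * UnitAddTorus.mFourier δ θ else 0 := by
      intro k j
      simp only [U, Matrix.transvection, Matrix.mul_add, Matrix.mul_one, Matrix.add_apply]
      congr 1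
      split_ifs with h
      · subst h
        rw [Matrix.mul_single_apply_same]
      · rw [Matrix.mul_single_apply_of_ne _ _ _ _ _ h]
    have hrow : (coboundary a b θ * U) e = Pi.single u (UnitAddTorus.mFourier (a e).2 θ) := by
      ext j
      rw [hUapply]
      simp only [coboundary, Matrix.of_apply, ← hu]
      have h0 : UnitAddTorus.mFourier (a e).2 θ * UnitAddTorus.mFourier δ θ =
          UnitAddTorus.mFourier (b e).2 θ := by
        rw [← mFourier_add_apply, hδ, add_sub_cancel]
      rw [if_pos trivial, if_neg he, sub_zero, h0]
      by_cases h1 : j = u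
      · subst h1
        rw [if_pos rfl, if_neg he, Pi.single_eq_same]
        ring
      · rw [if_neg h1, Pi.single_eq_of_ne h1]
        split_ifs <;> ring
    have hterm : ∀ (x : Fin (n + 1) × (Fin d → ℤ)) (j : Fin n),
        (if u.succAbove j = x.1 then UnitAddTorus.mFourier x.2 θ else 0) +
          (if u.succAbove j = (b e).1 then (if u = x.1 then UnitAddTorus.mFourier x.2 θ else 0) *
            UnitAddTorus.mFourier δ θ else 0) =
        if j = (q x).1 then UnitAddTorus.mFourier (q x).2 θ else 0 := by
      rintro ⟨x, p⟩ j
      simp only [q]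
      rcases Fin.eq_self_or_eq_succAbove u x with rfl | ⟨x, rfl⟩
      · rw [hτu, if_neg (Fin.succAbove_ne _ _), if_pos rfl, zero_add, ← hw',
          mFourier_add_apply]
        simp only [Fin.succAbove_right_inj]
      · rw [hτ, if_neg (Fin.succAbove_ne _ _).symm, zero_mul, ite_self, add_zero, add_zero]
        simp only [Fin.succAbove_right_inj]
    have hsub : (coboundary a b θ * U).submatrix id u.succAbove =
        coboundary (fun k => q (a k)) (fun k => q (b k)) θ := by
      ext k j
      rw [Matrix.submatrix_apply, hUapply]
      simp only [coboundary, Matrix.of_apply, id, ← hterm]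
      split_ifs <;> ring
    have hdet : ((coboundary a b θ * U).conjTranspose * (coboundary a b θ * U)).det =
        ((coboundary a b θ).conjTranspose * coboundary a b θ).det := by
      rw [Matrix.conjTranspose_mul, Matrix.mul_assoc, Matrix.det_mul, Matrix.det_conjTranspose, hU,
        ← Matrix.mul_assoc, Matrix.det_mul, hU]
      simp
    rw [← hdet, ← hsub]
    exact det_gram_submatrix_le _ e u (norm_mFourier_apply _ _) hrow

end Contraction

/-! ### Evaluation of Laurent polynomials on the torus -/

section Evaluation

variable {d : ℕ}

/-- Evaluation of a Laurent polynomial at a point of the torus. -/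
noncomputable def laurentEval (θ : UnitAddTorus (Fin d)) :
    AddMonoidAlgebra ℤ (Fin d → ℤ) →ₐ[ℤ] ℂ :=
  AddMonoidAlgebra.lift ℤ ℂ (Fin d → ℤ)
    { toFun := fun s => UnitAddTorus.mFourier s.toAdd θ
      map_one' := by
        rw [toAdd_one, UnitAddTorus.mFourier_zero]
        rfl
      map_mul' := fun s t => mFourier_add_apply s.toAdd t.toAdd θ }

theorem laurentEval_single (θ : UnitAddTorus (Fin d)) (s : Fin d → ℤ) (c : ℤ) :
    laurentEval θ (AddMonoidAlgebra.single s c) = c * UnitAddTorus.mFourier s θ := by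
  rw [laurentEval, AddMonoidAlgebra.lift_single, zsmul_eq_mul]
  rfl

theorem torusEval_eq_laurentEval (f : AddMonoidAlgebra ℤ (Fin d → ℤ)) (θ : Fin d → ℝ) :
    torusEval f θ = laurentEval (fun i => (θ i : UnitAddCircle)) f := by
  rw [laurentEval, AddMonoidAlgebra.lift_apply, torusEval]
  refine Finsupp.sum_congr fun s _ => ?_
  rw [zsmul_eq_mul]
  congr 1
  change _ = UnitAddTorus.mFourier s _
  rw [mFourier_eq_prod_zpow]
  refine Finset.prod_congr rfl fun j _ => ?_
  rw [fourier_coe_apply]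
  congr 2
  push_cast
  ring

end Evaluation

/-! ### Coordinates on a periodic graph and its Laplacian matrix as a Gram matrix -/

namespace Graph

section Presentation

variable {d n : ℕ} {V E ε : Type*} [AddAction (Fin d → ℤ) V] [AddAction (Fin d → ℤ) E]
  [Fintype ε]

/-- The edges `edge k` represent the edge orbits of `G`, and in the coordinates on the vertices
given by the transversal `v`, the ends of `edge k` are `a k` and `b k`. -/
structure IsPresentation (G : Graph V E) (v : Fin n → V) (edge : ε → E)
    (a b : ε → Fin n × (Fin d → ℤ)) : Prop where
  cofinite : G.IsCofiniteFree d
  transversal : IsTransversal d v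
  bijective : Function.Bijective fun p : ε × (Fin d → ℤ) => p.2 +ᵥ edge p.1
  isLink : ∀ k, G.IsLink (edge k) ((a k).2 +ᵥ v (a k).1) ((b k).2 +ᵥ v (b k).1)

theorem exists_bijective_vadd {d : ℕ} {X : Type*} [AddAction (Fin d → ℤ) X]
    (hfree : ∀ (s : Fin d → ℤ) (x : X), s +ᵥ x = x → s = 0)
    [Finite (AddAction.orbitRel.Quotient (Fin d → ℤ) X)] :
    ∃ (m : ℕ) (v : Fin m → X), Function.Bijective
      fun p : Fin m × (Fin d → ℤ) => p.2 +ᵥ v p.1 := by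
  obtain ⟨m, ⟨e⟩⟩ := Finite.exists_equiv_fin (AddAction.orbitRel.Quotient (Fin d → ℤ) X)
  refine ⟨m, fun k => (e.symm k).out, ?_, ?_⟩
  · rintro ⟨k, s⟩ ⟨l, t⟩ h
    change s +ᵥ (e.symm k).out = t +ᵥ (e.symm l).out at h
    have h1 : k = l := by
      apply e.symm.injective
      rw [← (e.symm k).out_eq', ← (e.symm l).out_eq']
      refine Quotient.sound' ⟨-s + t, ?_⟩
      change (-s + t) +ᵥ (e.symm l).out = (e.symm k).out
      rw [add_vadd, ← h, neg_vadd_vadd]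
    subst h1
    have h2 : (-t + s) +ᵥ (e.symm k).out = (e.symm k).out := by
      rw [add_vadd, h, neg_vadd_vadd]
    rw [neg_add_eq_zero.mp (hfree _ _ h2)]
  · intro x
    obtain ⟨s, hs⟩ := Quotient.exact' ((Quotient.mk'' x :
      AddAction.orbitRel.Quotient (Fin d → ℤ) X).out_eq')
    refine ⟨(e (Quotient.mk'' x), -s), ?_⟩
    change -s +ᵥ (e.symm (e (Quotient.mk'' x))).out = x
    rw [Equiv.symm_apply_apply, ← hs]
    exact neg_vadd_vadd s x

theorem IsCofiniteFree.exists_isTransversal {G : Graph V E} (hG : G.IsCofiniteFree d) :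
    ∃ (n : ℕ) (v : Fin n → V), IsTransversal d v :=
  have := hG.finite_vertex
  exists_bijective_vadd hG.free_vertex

theorem IsCofiniteFree.exists_isPresentation {G : Graph V E} (hG : G.IsCofiniteFree d)
    {v : Fin n → V} (hv : IsTransversal d v) :
    ∃ (m : ℕ) (edge : Fin m → E) (a b : Fin m → Fin n × (Fin d → ℤ)),
      G.IsPresentation v edge a b := by
  have := hG.finite_edge
  obtain ⟨m, edge, hedge⟩ := exists_bijective_vadd hG.free_edge
  have key : ∀ k, ∃ a b : Fin n × (Fin d → ℤ), G.IsLink (edge k) (a.2 +ᵥ v a.1) (b.2 +ᵥ v b.1) := by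
    intro k
    have hk : edge k ∈ G.edgeSet := by simp [hG.edgeSet_eq]
    obtain ⟨x, y, h⟩ := G.exists_isLink_of_mem_edgeSet hk
    obtain ⟨a, rfl⟩ := hv.2 x
    obtain ⟨b, rfl⟩ := hv.2 y
    exact ⟨a, b, h⟩
  choose a b hab using key
  exact ⟨m, edge, a, b, hG, hv, hedge, hab⟩

variable {G : Graph V E} {v : Fin n → V} {edge : ε → E} {a b : ε → Fin n × (Fin d → ℤ)}

theorem IsPresentation.isLink_vadd (h : G.IsPresentation v edge a b) (k : ε) (t : Fin d → ℤ) :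
    G.IsLink (t +ᵥ edge k) ((t + (a k).2) +ᵥ v (a k).1) ((t + (b k).2) +ᵥ v (b k).1) := by
  rw [add_vadd, add_vadd]
  exact h.cofinite.vadd_isLink _ _ _ _ (h.isLink k)

theorem IsPresentation.vadd_inj (h : G.IsPresentation v edge a b) {i j : Fin n}
    {s t : Fin d → ℤ} : s +ᵥ v i = t +ᵥ v j ↔ i = j ∧ s = t := by
  constructor
  · intro hst
    have := h.transversal.1 (a₁ := (i, s)) (a₂ := (j, t)) hst
    exact ⟨congrArg Prod.fst this, congrArg Prod.snd this⟩
  · rintro ⟨rfl, rfl⟩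
    rfl

/-- The tail of an oriented edge. -/
def dartTail (a b : ε → Fin n × (Fin d → ℤ)) (x : ε × Bool) : Fin n × (Fin d → ℤ) :=
  bif x.2 then a x.1 else b x.1

/-- The head of an oriented edge. -/
def dartHead (a b : ε → Fin n × (Fin d → ℤ)) (x : ε × Bool) : Fin n × (Fin d → ℤ) :=
  bif x.2 then b x.1 else a x.1

/-- The difference of the translation parts of the ends of an oriented edge. -/
def dartShift (a b : ε → Fin n × (Fin d → ℤ)) (x : ε × Bool) : Fin d → ℤ :=
  (dartHead a b x).2 - (dartTail a b x).2

/-- Freeness lets each non-loop edge at `v i` be recorded by one oriented edge representative,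
translated so that its tail is `v i`. An edge orbit joining `v i` to its own translates counts
twice, once per orientation. The predicate `P` on the far end is free, so that both degrees and
adjacency coefficients are covered. -/
theorem IsPresentation.card_isLink [DecidableEq ε] (h : G.IsPresentation v edge a b)
    (i : Fin n) (P : Fin n × (Fin d → ℤ) → Prop) [DecidablePred P] :
    Nat.card {e // ∃ y, P y ∧ v i ≠ y.2 +ᵥ v y.1 ∧ G.IsLink e (v i) (y.2 +ᵥ v y.1)} =
      (Finset.univ.filter fun x : ε × Bool => (a x.1 ≠ b x.1 ∧ (dartTail a b x).1 = i) ∧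
        P ((dartHead a b x).1, dartShift a b x)).card := by
  classical
  rw [← Fintype.card_subtype, ← Nat.card_eq_fintype_card]
  symm
  have hlink : ∀ x : ε × Bool, G.IsLink (-(dartTail a b x).2 +ᵥ edge x.1)
      (v (dartTail a b x).1) (dartShift a b x +ᵥ v (dartHead a b x).1) := by
    rintro ⟨k, _ | _⟩
    · have := h.isLink_vadd k (-(b k).2)
      rw [neg_add_cancel, zero_vadd, neg_add_eq_sub] at this
      exact this.symm
    · have := h.isLink_vadd k (-(a k).2)
      rw [neg_add_cancel, zero_vadd, neg_add_eq_sub] at this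
      exact this
  have hne : ∀ x : ε × Bool, a x.1 ≠ b x.1 →
      v (dartTail a b x).1 ≠ dartShift a b x +ᵥ v (dartHead a b x).1 := by
    intro x hx heq
    rw [← zero_vadd (Fin d → ℤ) (v (dartTail a b x).1), h.vadd_inj, dartShift, eq_comm (a := 0),
      sub_eq_zero] at heq
    have h2 : dartTail a b x = dartHead a b x := Prod.ext heq.1 heq.2.symm
    obtain ⟨k, _ | _⟩ := x
    · exact hx h2.symm
    · exact hx h2
  have hprop : ∀ x : {x : ε × Bool // (a x.1 ≠ b x.1 ∧ (dartTail a b x).1 = i) ∧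
      P ((dartHead a b x).1, dartShift a b x)}, ∃ y, P y ∧ v i ≠ y.2 +ᵥ v y.1 ∧
        G.IsLink (-(dartTail a b x).2 +ᵥ edge x.1.1) (v i) (y.2 +ᵥ v y.1) := by
    rintro ⟨x, ⟨hab, rfl⟩, hP⟩
    exact ⟨_, hP, hne x hab, hlink x⟩
  refine Nat.card_eq_of_bijective
    (f := fun x => ⟨-(dartTail a b x.1).2 +ᵥ edge x.1.1, hprop x⟩) ⟨?_, ?_⟩
  · rintro ⟨⟨k, o⟩, ⟨hk, hi⟩, hP⟩ ⟨⟨l, o'⟩, ⟨hl, hi'⟩, hP'⟩ heq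
    have h1 := h.bijective.1 (a₁ := (k, -(dartTail a b (k, o)).2))
      (a₂ := (l, -(dartTail a b (l, o')).2)) (Subtype.mk.inj heq)
    obtain ⟨rfl, h2⟩ := Prod.mk.inj h1
    have h3 : dartTail a b (k, o) = dartTail a b (k, o') :=
      Prod.ext (hi.trans hi'.symm) (neg_inj.mp h2)
    obtain _ | _ := o <;> obtain _ | _ := o'
    · rfl
    · exact absurd h3.symm hk
    · exact absurd h3 hk
    · rfl
  · rintro ⟨e, y, hy, hney, hy'⟩
    obtain ⟨⟨k, t⟩, rfl⟩ := h.bijective.2 e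
    have h1 := h.isLink_vadd k t
    have hcases := hy'.eq_and_eq_or_eq_and_eq h1
    rw [← zero_vadd (Fin d → ℤ) (v i), h.vadd_inj, h.vadd_inj, h.vadd_inj, h.vadd_inj] at hcases
    have hab : a k ≠ b k := by
      intro hab
      refine hney ?_
      rw [hab] at h1
      rcases hy'.eq_and_eq_or_eq_and_eq h1 with ⟨h2, h3⟩ | ⟨h2, h3⟩ <;> rw [h2, h3]
    rcases hcases with ⟨⟨h2, h3⟩, h4, h5⟩ | ⟨⟨h2, h3⟩, h4, h5⟩
    · refine ⟨⟨(k, true), ⟨hab, h2.symm⟩, ?_⟩, Subtype.ext ?_⟩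
      · convert hy using 1
        refine Prod.ext h4.symm ?_
        change (b k).2 - (a k).2 = y.2
        rw [h5, eq_neg_of_add_eq_zero_left h3.symm, neg_add_eq_sub]
      · change -(a k).2 +ᵥ edge k = t +ᵥ edge k
        rw [eq_neg_of_add_eq_zero_left h3.symm]
    · refine ⟨⟨(k, false), ⟨hab, h2.symm⟩, ?_⟩, Subtype.ext ?_⟩
      · convert hy using 1
        refine Prod.ext h4.symm ?_
        change (a k).2 - (b k).2 = y.2
        rw [h5, eq_neg_of_add_eq_zero_left h3.symm, neg_add_eq_sub]
      · change -(b k).2 +ᵥ edge k = t +ᵥ edge k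
        rw [eq_neg_of_add_eq_zero_left h3.symm]

theorem IsPresentation.card_isNonloopAt [DecidableEq ε] (h : G.IsPresentation v edge a b)
    (i : Fin n) : Nat.card {e // G.IsNonloopAt e (v i)} =
      (Finset.univ.filter fun x : ε × Bool =>
        a x.1 ≠ b x.1 ∧ (dartTail a b x).1 = i).card := by
  have := h.card_isLink i (fun _ => True)
  simp only [and_true, true_and] at this
  rw [← this]
  refine Nat.card_congr (Equiv.subtypeEquivRight fun e => ?_)
  constructor
  · rintro ⟨y, hy, hl⟩
    obtain ⟨p, rfl⟩ := h.transversal.2 y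
    exact ⟨p, hy.symm, hl⟩
  · rintro ⟨p, hp, hl⟩
    exact ⟨_, hp.symm, hl⟩

theorem IsPresentation.card_isLink_and [DecidableEq ε] (h : G.IsPresentation v edge a b)
    (i j : Fin n) (s : Fin d → ℤ) :
    Nat.card {e // G.IsLink e (v i) (s +ᵥ v j) ∧ v i ≠ s +ᵥ v j} =
      (Finset.univ.filter fun x : ε × Bool => (a x.1 ≠ b x.1 ∧ (dartTail a b x).1 = i) ∧
        ((dartHead a b x).1, dartShift a b x) = (j, s)).card := by
  rw [← h.card_isLink i (fun y => y = (j, s))]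
  refine Nat.card_congr (Equiv.subtypeEquivRight fun e => ?_)
  constructor
  · rintro ⟨h1, h2⟩
    exact ⟨_, rfl, h2, h1⟩
  · rintro ⟨_, rfl, h2, h1⟩
    exact ⟨h1, h2⟩

theorem IsPresentation.laurentEval_laplacianMatrix [DecidableEq ε]
    (h : G.IsPresentation v edge a b) (θ : UnitAddTorus (Fin d)) (i j : Fin n) :
    laurentEval θ (G.laplacianMatrix d v i j) =
      ∑ x : ε × Bool with a x.1 ≠ b x.1 ∧ (dartTail a b x).1 = i, ((if i = j then 1 else 0) -
        if (dartHead a b x).1 = j then UnitAddTorus.mFourier (dartShift a b x) θ else 0) := by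
  have h1 : (∑ᶠ s : Fin d → ℤ, AddMonoidAlgebra.single s
      ((Nat.card {e // G.IsLink e (v i) (s +ᵥ v j) ∧ v i ≠ s +ᵥ v j} : ℕ) : ℤ)) =
      ∑ x : ε × Bool with a x.1 ≠ b x.1 ∧ (dartTail a b x).1 = i,
        if (dartHead a b x).1 = j then
          AddMonoidAlgebra.single (dartShift a b x) (1 : ℤ) else 0 := by
    have h2 : ∀ s : Fin d → ℤ, AddMonoidAlgebra.single s
        ((Nat.card {e // G.IsLink e (v i) (s +ᵥ v j) ∧ v i ≠ s +ᵥ v j} : ℕ) : ℤ) =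
        ∑ x : ε × Bool with a x.1 ≠ b x.1 ∧ (dartTail a b x).1 = i,
          if dartShift a b x = s then (if (dartHead a b x).1 = j then
            AddMonoidAlgebra.single s (1 : ℤ) else 0) else 0 := by
      intro s
      rw [h.card_isLink_and, ← Finset.filter_filter, Finset.card_filter]
      push_cast
      rw [← AddMonoidAlgebra.singleAddHom_apply, map_sum]
      refine Finset.sum_congr rfl fun x _ => ?_
      rw [AddMonoidAlgebra.singleAddHom_apply]
      simp only [Prod.mk.injEq]
      split_ifs <;> simp_all
    simp only [h2]
    rw [finsum_sum_comm]
    · refine Finset.sum_congr rfl fun x _ => ?_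
      rw [finsum_eq_single _ (dartShift a b x) fun s hs => if_neg hs.symm, if_pos rfl]
    · intro x _
      refine (Set.finite_singleton (dartShift a b x)).subset fun s hs => ?_
      by_contra hne
      exact hs (if_neg fun h => hne h.symm)
  rw [laplacianMatrix, Matrix.sub_apply, Matrix.of_apply, h1, map_sub, map_sum,
    Finset.sum_sub_distrib]
  congr 1
  · rw [Matrix.diagonal_apply, h.card_isNonloopAt]
    split_ifs <;> simp
  · refine Finset.sum_congr rfl fun x _ => ?_
    split_ifs
    · rw [laurentEval_single]
      simp
    · simp

/-- Each edge orbit contributes the outer product of its coboundary row: two diagonal terms for the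
degrees, two cross terms for the two orientations. A loop has zero row, matching the convention that
loops are ignored. -/
theorem IsPresentation.map_laplacianMatrix [DecidableEq ε] (h : G.IsPresentation v edge a b)
    (θ : UnitAddTorus (Fin d)) :
    (laurentEval θ).toRingHom.mapMatrix (G.laplacianMatrix d v) =
      (coboundary a b θ).conjTranspose * coboundary a b θ := by
  ext i j
  rw [RingHom.mapMatrix_apply, Matrix.map_apply]
  change laurentEval θ (G.laplacianMatrix d v i j) = _
  rw [h.laurentEval_laplacianMatrix, Finset.sum_filter, Fintype.sum_prod_type, Matrix.mul_apply]
  refine Finset.sum_congr rfl fun k _ => ?_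
  rw [Fintype.sum_bool, Matrix.conjTranspose_apply]
  simp only [dartTail, dartHead, dartShift, cond_true, cond_false, coboundary, Matrix.of_apply]
  have hmul : ∀ p q : Fin n × (Fin d → ℤ),
      star (if i = p.1 then UnitAddTorus.mFourier p.2 θ else 0) *
        (if j = q.1 then UnitAddTorus.mFourier q.2 θ else 0) =
      if p.1 = i then (if q.1 = j then UnitAddTorus.mFourier (q.2 - p.2) θ else 0) else 0 := by
    intro p q
    rw [← neg_add_eq_sub, mFourier_add_apply, UnitAddTorus.mFourier_neg, ← Complex.star_def]
    simp only [eq_comm (b := i), eq_comm (b := j)]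
    split_ifs <;> simp
  have hone : ∀ p : Fin n × (Fin d → ℤ),
      star (if i = p.1 then UnitAddTorus.mFourier p.2 θ else 0) *
        (if j = p.1 then UnitAddTorus.mFourier p.2 θ else 0) =
      if p.1 = i then (if i = j then 1 else 0) else 0 := by
    intro p
    rw [hmul, sub_self, UnitAddTorus.mFourier_zero]
    split_ifs with h1 h2 h3 h3
    · rfl
    · exact absurd (h1.symm.trans h2) h3
    · exact absurd (h1.trans h3) h2
    · rfl
    · rfl
  by_cases hk : a k = b k
  · simp [hk]
  · rw [star_sub, sub_mul, mul_sub, mul_sub, hone, hone, hmul, hmul]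
    simp only [ne_eq, hk, not_false_eq_true, true_and]
    by_cases hij : i = j
    · subst hij
      by_cases ha : (a k).1 = i <;> by_cases hb : (b k).1 = i <;> simp [ha, hb]
      ring
    · by_cases ha : (a k).1 = i <;> by_cases hb : (b k).1 = i <;>
        by_cases ha' : (a k).1 = j <;> by_cases hb' : (b k).1 = j <;> simp [ha, hb, ha', hb', hij, Ne.symm hij]

end Presentation

end Graph

/-! ### The Fourier matrix of a finite abelian group -/

section FourierMatrix

open Polynomial

theorem charpoly_blockDiagonal {R m o : Type*} [CommRing R] [Fintype m] [DecidableEq m] [Fintype o]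
    [DecidableEq o] (M : o → Matrix m m R) :
    (Matrix.blockDiagonal M).charpoly = ∏ k, (M k).charpoly := by
  rw [Matrix.charpoly]
  have h : (Matrix.blockDiagonal M).charmatrix =
      Matrix.blockDiagonal fun k => (M k).charmatrix := by
    ext ⟨i, k⟩ ⟨j, l⟩ : 2
    rw [Matrix.blockDiagonal_apply]
    by_cases hkl : k = l
    · subst hkl
      rw [if_pos rfl]
      by_cases hij : i = j
      · subst hij
        rw [Matrix.charmatrix_apply_eq, Matrix.charmatrix_apply_eq, Matrix.blockDiagonal_apply,
          if_pos rfl]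
      · rw [Matrix.charmatrix_apply_ne _ _ _ hij,
          Matrix.charmatrix_apply_ne _ _ _ fun h => hij (congrArg Prod.fst h),
          Matrix.blockDiagonal_apply, if_pos rfl]
    · rw [if_neg hkl, Matrix.charmatrix_apply_ne _ _ _ fun h => hkl (congrArg Prod.snd h),
        Matrix.blockDiagonal_apply, if_neg hkl, C_0, neg_zero]
  rw [h, Matrix.det_blockDiagonal]
  rfl

variable {A : Type*} [AddCommGroup A] [Finite A]

/-- The Fourier matrix of the finite abelian group `A`, acting on vectors indexed by `ι × A`. -/
noncomputable def fourierMatrix (ι A : Type*) [AddCommGroup A] [DecidableEq ι] :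
    Matrix (ι × A) (ι × AddChar A ℂ) ℂ :=
  Matrix.of fun x y => if x.1 = y.1 then y.2 x.2 else 0

theorem conjTranspose_fourierMatrix_mul [Fintype A] [DecidableEq (AddChar A ℂ)] (ι : Type*)
    [Fintype ι] [DecidableEq ι] :
    (fourierMatrix ι A).conjTranspose * fourierMatrix ι A = (Fintype.card A : ℂ) • 1 := by
  ext ⟨i, ψ⟩ ⟨j, φ⟩
  rw [Matrix.mul_apply, Fintype.sum_prod_type, Matrix.smul_apply, smul_eq_mul]
  simp only [fourierMatrix, Matrix.conjTranspose_apply, Matrix.of_apply]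
  rw [Finset.sum_eq_single i]
  · simp only [if_true]
    by_cases hij : i = j
    · subst hij
      simp only [if_true]
      have h1 : ∀ a, star (ψ a) * φ a = (φ - ψ) a := fun a => by
        rw [AddChar.sub_apply, AddChar.map_neg_eq_conj, mul_comm]
        rfl
      simp only [h1]
      rw [AddChar.sum_eq_ite, Matrix.one_apply]
      by_cases h : ψ = φ
      · simp [h]
      · rw [if_neg fun h' => h (sub_eq_zero.mp h').symm, if_neg fun h' => h (congrArg Prod.snd h')]
        simp
    · rw [Matrix.one_apply_ne fun h => hij (congrArg Prod.fst h)]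
      simp [hij]
  · intro k _ hk
    simp [hk]
  · simp

end FourierMatrix

/-! ### Vertices, edges and components of the quotient graphs -/

section Quotient

variable {d : ℕ}

theorem exists_orbitQuotient_equiv {ι X : Type*} [AddAction (Fin d → ℤ) X] {v : ι → X}
    (hv : Function.Bijective fun p : ι × (Fin d → ℤ) => p.2 +ᵥ v p.1)
    (Λ : AddSubgroup (Fin d → ℤ)) :
    ∃ φ : ι × ((Fin d → ℤ) ⧸ Λ) ≃ AddAction.orbitRel.Quotient Λ X,
      ∀ i s, φ (i, QuotientAddGroup.mk s) = Quotient.mk'' (s +ᵥ v i) := by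
  let f : ι × ((Fin d → ℤ) ⧸ Λ) → AddAction.orbitRel.Quotient Λ X := fun x =>
    Quotient.liftOn' x.2 (fun s => Quotient.mk'' (s +ᵥ v x.1)) fun s t hst => by
      rw [QuotientAddGroup.leftRel_apply] at hst
      refine Quotient.sound' ⟨-⟨_, hst⟩, ?_⟩
      change -(-s + t) +ᵥ (t +ᵥ v x.1) = s +ᵥ v x.1
      rw [vadd_vadd]
      congr 1
      abel
  have hf : ∀ i s, f (i, QuotientAddGroup.mk s) = Quotient.mk'' (s +ᵥ v i) := fun _ _ => rfl
  refine ⟨Equiv.ofBijective f ⟨?_, ?_⟩, hf⟩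
  · rintro ⟨i, α⟩ ⟨j, β⟩ h
    obtain ⟨s, rfl⟩ := QuotientAddGroup.mk_surjective α
    obtain ⟨t, rfl⟩ := QuotientAddGroup.mk_surjective β
    rw [hf, hf] at h
    obtain ⟨l, hl⟩ := Quotient.exact' h
    have hl' : ((l : Fin d → ℤ) + t) +ᵥ v j = s +ᵥ v i := by
      rw [add_vadd]
      exact hl
    obtain ⟨rfl, h2⟩ := Prod.mk.inj (hv.1 (a₁ := (j, (l : Fin d → ℤ) + t)) (a₂ := (i, s)) hl')
    refine Prod.ext rfl ?_
    refine (QuotientAddGroup.eq).mpr ?_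
    rw [← h2, neg_add_rev, neg_add_eq_sub, sub_add_cancel]
    exact neg_mem l.2
  · intro q
    induction q using Quotient.inductionOn' with
    | h x =>
      obtain ⟨⟨i, s⟩, rfl⟩ := hv.2 x
      exact ⟨(i, QuotientAddGroup.mk s), rfl⟩

end Quotient

namespace Graph

variable {d n : ℕ} {V E ε : Type*} [AddAction (Fin d → ℤ) V] [AddAction (Fin d → ℤ) E]
  [Fintype ε] {G : Graph V E} {v : Fin n → V} {edge : ε → E} {a b : ε → Fin n × (Fin d → ℤ)}

/-- Walks lift: each edge of the quotient has a Λ-translate starting at the vertex already reached.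
-/
theorem exists_reachable_of_quotientGraph (hG : G.IsCofiniteFree d)
    (Λ : AddSubgroup (Fin d → ℤ)) {x : V} {q : AddAction.orbitRel.Quotient Λ V}
    (h : (quotientGraph hG Λ).Reachable (Quotient.mk'' x) q) :
    ∃ y, G.Reachable x y ∧ Quotient.mk'' y = q := by
  induction h with
  | refl => exact ⟨x, Relation.ReflTransGen.refl, rfl⟩
  | tail _ h ih =>
    obtain ⟨y, hy, rfl⟩ := ih
    obtain ⟨e, e', x', y', rfl, hx', rfl, hl⟩ := h
    obtain ⟨l, hl'⟩ := Quotient.exact' hx'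
    have hl'' : (l : Fin d → ℤ) +ᵥ y = x' := hl'
    have h1 := hG.vadd_isLink (-(l : Fin d → ℤ)) _ _ _ hl
    rw [← hl'', neg_vadd_vadd] at h1
    exact ⟨_, hy.tail ⟨_, h1⟩, Quotient.sound' ⟨-l, rfl⟩⟩

theorem reachable_quotientGraph (hG : G.IsCofiniteFree d) (Λ : AddSubgroup (Fin d → ℤ)) {x y : V}
    (h : G.Reachable x y) : (quotientGraph hG Λ).Reachable (Quotient.mk'' x) (Quotient.mk'' y) := by
  refine Relation.ReflTransGen.lift (fun z => (Quotient.mk'' z : AddAction.orbitRel.Quotient Λ V))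
    ?_ _ _ h
  rintro y z ⟨e, he⟩
  exact ⟨_, _, _, _, rfl, rfl, rfl, he⟩

/-- By walk lifting, every component of the quotient is the image of a component of `G`. This bounds
the polynomial error exponent independently of Λ. -/
theorem ncard_components_quotientGraph_le (hG : G.IsCofiniteFree d) (hfin : G.components.Finite)
    (Λ : AddSubgroup (Fin d → ℤ)) :
    (quotientGraph hG Λ).components.ncard ≤ G.components.ncard := by
  refine (Set.ncard_le_ncard (t := (fun C : Set V => (Quotient.mk'' : V →
    AddAction.orbitRel.Quotient Λ V) '' C) '' G.components) ?_ (hfin.image _)).trans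
    (Set.ncard_image_le hfin)
  rintro _ ⟨q, _, rfl⟩
  induction q using Quotient.inductionOn' with
  | h x =>
    refine ⟨_, ⟨x, hG.vertexSet_eq ▸ Set.mem_univ x, rfl⟩, ?_⟩
    ext q
    constructor
    · rintro ⟨y, hy, rfl⟩
      exact reachable_quotientGraph hG Λ hy
    · intro hq
      exact exists_reachable_of_quotientGraph hG Λ hq

theorem IsPresentation.hasFiniteRanges (h : G.IsPresentation v edge a b)
    (hfin : G.components.Finite) : HasFiniteRanges a b := by
  intro X F hF
  let φ : Fin n × (Fin d → ℤ) ≃ V := Equiv.ofBijective _ h.transversal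
  have hφ : ∀ i s, φ.symm (s +ᵥ v i) = (i, s) := fun i s => φ.symm_apply_apply (i, s)
  have hadj : ∀ x y, G.Adj x y → F (φ.symm x) = F (φ.symm y) := by
    rintro x y ⟨e, he⟩
    obtain ⟨⟨k, t⟩, rfl⟩ := h.bijective.2 e
    rcases he.eq_and_eq_or_eq_and_eq (h.isLink_vadd k t) with ⟨rfl, rfl⟩ | ⟨rfl, rfl⟩
    · rw [hφ, hφ, hF]
    · rw [hφ, hφ, hF]
  have hreach : ∀ x y, G.Reachable x y → F (φ.symm x) = F (φ.symm y) := by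
    intro x y hxy
    induction hxy with
    | refl => rfl
    | tail _ h' ih => exact ih.trans (hadj _ _ h')
  refine (hfin.biUnion (t := fun C => (fun x => F (φ.symm x)) '' C) fun C hC => ?_).subset ?_
  · refine Set.Subsingleton.finite ?_
    rintro _ ⟨x, hx, rfl⟩ _ ⟨y, hy, rfl⟩
    exact hreach x y (reachable_of_mem_component hC hx hy)
  · rintro _ ⟨p, rfl⟩
    simp only [Set.mem_iUnion]
    refine ⟨_, ⟨φ p, by simp [h.cofinite.vertexSet_eq], rfl⟩, φ p, Relation.ReflTransGen.refl, ?_⟩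
    simp

end Graph

/-! ### Trailing coefficients and the Fourier decomposition of the quotient Laplacian -/

section TrailingCoeff

theorem Polynomial.trailingCoeff_map_of_injective {R S : Type*} [Semiring R] [Semiring S]
    {f : R →+* S} (hf : Function.Injective f) (p : Polynomial R) :
    (p.map f).trailingCoeff = f p.trailingCoeff := by
  have h : (p.map f).natTrailingDegree = p.natTrailingDegree := by
    rw [Polynomial.natTrailingDegree, Polynomial.natTrailingDegree, Polynomial.trailingDegree,
      Polynomial.trailingDegree, Polynomial.support_map_of_injective p hf]
  rw [Polynomial.trailingCoeff, h, Polynomial.coeff_map, Polynomial.trailingCoeff]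

theorem Polynomial.trailingCoeff_prod {R ι : Type*} [CommRing R] [IsDomain R] (s : Finset ι)
    (p : ι → Polynomial R) : (∏ i ∈ s, p i).trailingCoeff = ∏ i ∈ s, (p i).trailingCoeff :=
  map_prod (⟨⟨Polynomial.trailingCoeff, by simp [Polynomial.trailingCoeff]⟩,
    Polynomial.trailingCoeff_mul⟩ : Polynomial R →* R) _ _

end TrailingCoeff

section FourierBlock

variable {d n : ℕ} {ε : Type*} [Fintype ε] [DecidableEq ε] {Λ : AddSubgroup (Fin d → ℤ)}

/-- The coboundary matrix of the quotient by `Λ` of the periodic graph given by `a` and `b`. -/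
noncomputable def quotientCoboundary (Λ : AddSubgroup (Fin d → ℤ))
    [DecidableEq ((Fin d → ℤ) ⧸ Λ)] (a b : ε → Fin n × (Fin d → ℤ)) :
    Matrix (ε × ((Fin d → ℤ) ⧸ Λ)) (Fin n × ((Fin d → ℤ) ⧸ Λ)) ℤ :=
  (incidenceMatrix (fun e => ((a e.1).1, e.2 + QuotientAddGroup.mk (a e.1).2))
    (fun e => ((b e.1).1, e.2 + QuotientAddGroup.mk (b e.1).2))).transpose

/-- A translation acts on a character ψ by a scalar, which is the value of a monomial at `torusPoint
ψ`. The coboundary of the quotient thus acts on ψ through its symbol at that point. -/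
theorem quotientCoboundary_mul_fourierMatrix [Fintype ((Fin d → ℤ) ⧸ Λ)]
    [DecidableEq ((Fin d → ℤ) ⧸ Λ)] [DecidableEq (AddChar ((Fin d → ℤ) ⧸ Λ) ℂ)]
    (a b : ε → Fin n × (Fin d → ℤ)) :
    (quotientCoboundary Λ a b).map (Int.castRingHom ℂ) *
        fourierMatrix (Fin n) ((Fin d → ℤ) ⧸ Λ) =
      fourierMatrix ε ((Fin d → ℤ) ⧸ Λ) *
        Matrix.blockDiagonal fun ψ => coboundary a b (torusPoint ψ) := by
  ext ⟨k, α⟩ ⟨j, ψ⟩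
  have key : ∀ p : Fin n × (Fin d → ℤ), ∑ y : Fin n × ((Fin d → ℤ) ⧸ Λ),
      (if (p.1, α + QuotientAddGroup.mk p.2) = y then (1 : ℂ) else 0) *
        fourierMatrix (Fin n) ((Fin d → ℤ) ⧸ Λ) y (j, ψ) =
      ψ α * if j = p.1 then UnitAddTorus.mFourier p.2 (torusPoint ψ) else 0 := by
    intro p
    simp only [ite_mul, one_mul, zero_mul, Finset.sum_ite_eq, Finset.mem_univ, if_true]
    rw [fourierMatrix, Matrix.of_apply, mFourier_torusPoint, AddChar.map_add_eq_mul]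
    simp only [mul_ite, mul_zero, eq_comm]
  have hL : ((quotientCoboundary Λ a b).map (Int.castRingHom ℂ) *
      fourierMatrix (Fin n) ((Fin d → ℤ) ⧸ Λ)) (k, α) (j, ψ) =
      ψ α * coboundary a b (torusPoint ψ) k j := by
    rw [coboundary, Matrix.of_apply, mul_sub, ← key, ← key, ← Finset.sum_sub_distrib,
      Matrix.mul_apply]
    refine Finset.sum_congr rfl fun y _ => ?_
    rw [← sub_mul]
    congr 1
    simp [quotientCoboundary, incidenceMatrix]
  refine hL.trans (Eq.trans ?_ (Matrix.mul_apply ..).symm)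
  rw [Fintype.sum_prod_type, Finset.sum_eq_single k]
  · rw [Finset.sum_eq_single ψ]
    · rw [Matrix.blockDiagonal_apply_eq, fourierMatrix, Matrix.of_apply, if_pos rfl]
    · intro φ _ hφ
      rw [Matrix.blockDiagonal_apply_ne _ _ _ hφ, mul_zero]
    · simp
  · intro l _ hl
    refine Finset.sum_eq_zero fun φ _ => ?_
    rw [fourierMatrix, Matrix.of_apply, if_neg hl.symm, zero_mul]
  · simp

theorem charpoly_quotientLaplacian [Fintype ((Fin d → ℤ) ⧸ Λ)] [DecidableEq ((Fin d → ℤ) ⧸ Λ)]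
    (a b : ε → Fin n × (Fin d → ℤ)) :
    (multigraphLaplacian (fun e : ε × ((Fin d → ℤ) ⧸ Λ) =>
        ((a e.1).1, e.2 + QuotientAddGroup.mk (a e.1).2))
      (fun e => ((b e.1).1, e.2 + QuotientAddGroup.mk (b e.1).2))).charpoly.map
        (Int.castRingHom ℂ) =
      ∏ ψ : AddChar ((Fin d → ℤ) ⧸ Λ) ℂ, ((coboundary a b (torusPoint ψ)).conjTranspose *
        coboundary a b (torusPoint ψ)).charpoly := by
  classical
  set C := (quotientCoboundary Λ a b).map (Int.castRingHom ℂ) with hC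
  set U := fourierMatrix (Fin n) ((Fin d → ℤ) ⧸ Λ)
  set W := fourierMatrix ε ((Fin d → ℤ) ⧸ Λ)
  set B := Matrix.blockDiagonal fun ψ : AddChar ((Fin d → ℤ) ⧸ Λ) ℂ => coboundary a b (torusPoint ψ) with hB
  have hCU : C * U = W * B := quotientCoboundary_mul_fourierMatrix a b
  have hm : (Fintype.card ((Fin d → ℤ) ⧸ Λ) : ℂ) ≠ 0 := Nat.cast_ne_zero.mpr Fintype.card_ne_zero
  have hL : (multigraphLaplacian (fun e : ε × ((Fin d → ℤ) ⧸ Λ) =>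
        ((a e.1).1, e.2 + QuotientAddGroup.mk (a e.1).2))
      (fun e => ((b e.1).1, e.2 + QuotientAddGroup.mk (b e.1).2))).map (Int.castRingHom ℂ) =
      C.conjTranspose * C := by
    rw [multigraphLaplacian, Matrix.map_mul]
    congr 1
    ext i j
    simp [hC, quotientCoboundary]
  have h1 : (Fintype.card ((Fin d → ℤ) ⧸ Λ) : ℂ)⁻¹ • U.conjTranspose * U = 1 := by
    rw [Matrix.smul_mul, conjTranspose_fourierMatrix_mul, smul_smul, inv_mul_cancel₀ hm, one_smul]
  have h2 : U * ((Fintype.card ((Fin d → ℤ) ⧸ Λ) : ℂ)⁻¹ • U.conjTranspose) = 1 := by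
    rwa [Matrix.mul_eq_one_comm_of_card_eq]
    rw [Fintype.card_prod, Fintype.card_prod, AddChar.card_eq]
  have h3 : ((Fintype.card ((Fin d → ℤ) ⧸ Λ) : ℂ)⁻¹ • U.conjTranspose) * (C.conjTranspose * C * U) =
      Matrix.blockDiagonal fun ψ : AddChar ((Fin d → ℤ) ⧸ Λ) ℂ =>
        (coboundary a b (torusPoint ψ)).conjTranspose * coboundary a b (torusPoint ψ) := by
    rw [Matrix.smul_mul, Matrix.mul_assoc, ← Matrix.mul_assoc U.conjTranspose,
      ← Matrix.conjTranspose_mul, hCU, Matrix.conjTranspose_mul, Matrix.mul_assoc,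
      ← Matrix.mul_assoc W.conjTranspose, conjTranspose_fourierMatrix_mul, Matrix.smul_mul,
      Matrix.one_mul, Matrix.mul_smul, smul_smul, inv_mul_cancel₀ hm, one_smul, hB,
      Matrix.blockDiagonal_conjTranspose, Matrix.blockDiagonal_mul]
  rw [← Matrix.charpoly_map, hL, ← charpoly_blockDiagonal, ← h3]
  -- The Fourier matrix is indexed by the group on one side and by its dual on the other. The
  -- comparison therefore goes through the charpolys of products in both orders, whose powers of X
  -- agree as the two index sets have equal size.
  have h4 := Matrix.charpoly_mul_comm' (C.conjTranspose * C * U)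
    ((Fintype.card ((Fin d → ℤ) ⧸ Λ) : ℂ)⁻¹ • U.conjTranspose)
  rw [Matrix.mul_assoc _ U, h2, Matrix.mul_one] at h4
  have hcard : Fintype.card (Fin n × AddChar ((Fin d → ℤ) ⧸ Λ) ℂ) = Fintype.card (Fin n × ((Fin d → ℤ) ⧸ Λ)) := by
    rw [Fintype.card_prod, Fintype.card_prod, AddChar.card_eq]
  rw [hcard] at h4
  exact mul_left_cancel₀ (pow_ne_zero _ Polynomial.X_ne_zero) h4

end FourierBlock

namespace Graph

variable {d n : ℕ} {V E ε : Type*} [AddAction (Fin d → ℤ) V] [AddAction (Fin d → ℤ) E]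
  [Fintype ε] {G : Graph V E} {v : Fin n → V} {edge : ε → E} {a b : ε → Fin n × (Fin d → ℤ)}

theorem multigraphLaplacian_reindex {α β α' β' : Type*} [Fintype α] [DecidableEq α] [Fintype β]
    [DecidableEq β] [Fintype α'] [DecidableEq α'] [Fintype β'] [DecidableEq β'] (φ : α ≃ α')
    (χ : β ≃ β') (s t : β → α) :
    multigraphLaplacian (fun e => φ (s (χ.symm e))) (fun e => φ (t (χ.symm e))) =
      Matrix.reindex φ φ (multigraphLaplacian s t) := by
  have h : incidenceMatrix (fun e => φ (s (χ.symm e))) (fun e => φ (t (χ.symm e))) =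
      (incidenceMatrix s t).submatrix φ.symm χ.symm := by
    ext x e
    simp [incidenceMatrix, Equiv.eq_symm_apply]
  rw [multigraphLaplacian, multigraphLaplacian, h, Matrix.reindex_apply, Matrix.transpose_submatrix,
    Matrix.submatrix_mul_equiv]

/-- The trailing coefficient of the characteristic polynomial of the Laplacian of `G_Λ` is the
product of those of the matrices `M(θ)`, and gives the complexity of `G_Λ` up to a factor that is
polynomial in the index of `Λ`. -/
theorem IsPresentation.complexity_quotientGraph (h : G.IsPresentation v edge a b)
    (hn : 0 < n) (hfin : G.components.Finite) (Λ : AddSubgroup (Fin d → ℤ)) [Λ.FiniteIndex] :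
    0 < (quotientGraph h.cofinite Λ).complexity ∧
    ((quotientGraph h.cofinite Λ).complexity : ℝ) ≤
      ∏ᶠ ψ : AddChar ((Fin d → ℤ) ⧸ Λ) ℂ, ‖((coboundary a b (torusPoint ψ)).conjTranspose *
        coboundary a b (torusPoint ψ)).charpoly.trailingCoeff‖ ∧
    ∏ᶠ ψ : AddChar ((Fin d → ℤ) ⧸ Λ) ℂ, ‖((coboundary a b (torusPoint ψ)).conjTranspose *
        coboundary a b (torusPoint ψ)).charpoly.trailingCoeff‖ ≤
      (n * Λ.index : ℝ) ^ G.components.ncard * (quotientGraph h.cofinite Λ).complexity := by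
  classical
  have := AddSubgroup.finite_quotient_of_finiteIndex (H := Λ)
  have := Fintype.ofFinite ((Fin d → ℤ) ⧸ Λ)
  obtain ⟨φ, hφ⟩ := exists_orbitQuotient_equiv h.transversal Λ
  obtain ⟨χ, hχ⟩ := exists_orbitQuotient_equiv h.bijective Λ
  let := Fintype.ofEquiv _ φ
  let := Fintype.ofEquiv _ χ
  let s : ε × ((Fin d → ℤ) ⧸ Λ) → Fin n × ((Fin d → ℤ) ⧸ Λ) :=
    fun e => ((a e.1).1, e.2 + QuotientAddGroup.mk (a e.1).2)
  let t : ε × ((Fin d → ℤ) ⧸ Λ) → Fin n × ((Fin d → ℤ) ⧸ Λ) :=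
    fun e => ((b e.1).1, e.2 + QuotientAddGroup.mk (b e.1).2)
  have hst : ∀ e, (quotientGraph h.cofinite Λ).IsLink e (φ (s (χ.symm e))) (φ (t (χ.symm e))) := by
    intro e
    obtain ⟨⟨k, α⟩, rfl⟩ := χ.surjective e
    obtain ⟨p, rfl⟩ := QuotientAddGroup.mk_surjective α
    rw [Equiv.symm_apply_apply]
    exact ⟨p +ᵥ edge k, _, _, (hχ k p).symm, (hφ _ _).symm, (hφ _ _).symm, h.isLink_vadd k p⟩
  obtain ⟨h1, h2, h3⟩ := exists_trailingCoeff_charpoly (H := quotientGraph h.cofinite Λ) rfl hst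
  rw [multigraphLaplacian_reindex φ χ s t, Matrix.charpoly_reindex] at h2 h3
  have hp : (((multigraphLaplacian s t).charpoly.trailingCoeff.natAbs : ℕ) : ℝ) =
      ∏ᶠ ψ : AddChar ((Fin d → ℤ) ⧸ Λ) ℂ, ‖((coboundary a b (torusPoint ψ)).conjTranspose *
        coboundary a b (torusPoint ψ)).charpoly.trailingCoeff‖ := by
    have h4 : (((multigraphLaplacian s t).charpoly.map (Int.castRingHom ℂ)).trailingCoeff) =
        ((multigraphLaplacian s t).charpoly.trailingCoeff : ℂ) :=
      Polynomial.trailingCoeff_map_of_injective (RingHom.injective_int _) _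
    rw [finprod_eq_prod_of_fintype, Nat.cast_natAbs, Int.cast_abs, ← Complex.norm_intCast, ← h4,
      charpoly_quotientLaplacian, Polynomial.trailingCoeff_prod, norm_prod]
  have hcard : Fintype.card (AddAction.orbitRel.Quotient Λ V) = n * Λ.index := by
    rw [← Fintype.card_congr φ, Fintype.card_prod, Fintype.card_fin, AddSubgroup.index,
      Nat.card_eq_fintype_card]
  refine ⟨h1, ?_, ?_⟩
  · rw [← hp]
    exact_mod_cast h2
  · rw [← hp]
    rw [hcard] at h3
    have hpos : 0 < n * Λ.index :=
      Nat.mul_pos hn (Nat.pos_of_ne_zero AddSubgroup.FiniteIndex.index_ne_zero)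
    have h5 := h3.trans (Nat.mul_le_mul_right _ (Nat.pow_le_pow_right hpos
      (ncard_components_quotientGraph_le h.cofinite hfin Λ)))
    exact_mod_cast h5

end Graph

/-! ### From the cube to the torus, and comparison of integrals with the grid -/

section Cube

variable {d : ℕ}

theorem measurePreserving_cube :
    MeasurePreserving (fun (θ : Fin d → ℝ) i => (θ i : UnitAddCircle))
      (volume.restrict (Set.Icc 0 1)) volume := by
  have h := measurePreserving_pi (fun _ : Fin d => (volume : Measure ℝ).restrict (Set.Ioc 0 (0 + 1)))
    (fun _ : Fin d => (volume : Measure UnitAddCircle))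
    (fun _ => UnitAddCircle.measurePreserving_mk 0)
  rw [← Measure.restrict_pi_pi] at h
  have h2 : (volume : Measure (Fin d → ℝ)).restrict (Set.Icc 0 1) =
      (Measure.pi fun _ : Fin d => (volume : Measure ℝ)).restrict
        (Set.univ.pi fun _ => Set.Ioc 0 (0 + 1)) := by
    rw [zero_add]
    exact (Measure.restrict_congr_set Measure.univ_pi_Ioc_ae_eq_Icc).symm
  rw [h2]
  exact h

end Cube

section Determinant

variable {d n : ℕ} {ε : Type*} [Fintype ε] {a b : ε → Fin n × (Fin d → ℤ)}

/-- The absolute value of the Laplacian polynomial at a point of the torus. -/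
noncomputable def laplacianDet (a b : ε → Fin n × (Fin d → ℤ)) (θ : UnitAddTorus (Fin d)) : ℝ :=
  ‖((coboundary a b θ).conjTranspose * coboundary a b θ).det‖

theorem continuous_coboundary (a b : ε → Fin n × (Fin d → ℤ)) : Continuous (coboundary a b) := by
  refine continuous_matrix fun k j => ?_
  simp only [coboundary, Matrix.of_apply]
  split_ifs <;> fun_prop

theorem continuous_laplacianDet (a b : ε → Fin n × (Fin d → ℤ)) :
    Continuous (laplacianDet a b) := by
  have h := continuous_coboundary a b
  exact (h.matrix_conjTranspose.matrix_mul h).matrix_det.norm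

theorem continuous_cayleyLaplacian (c : Matrix (Fin d) (Fin d) ℤ) :
    Continuous (cayleyLaplacian c) := by
  unfold cayleyLaplacian
  fun_prop

theorem prod_cayleyLaplacian_le_laplacianDet {K : ℕ} {c : Fin K → Matrix (Fin d) (Fin d) ℤ}
    {θ : UnitAddTorus (Fin d)}
    (h : letI := Complex.partialOrder
      ((∏ k, cayleyLaplacian (c k) θ : ℝ) : ℂ) ≤
      ((coboundary a b θ).conjTranspose * coboundary a b θ).det) :
    ∏ k, cayleyLaplacian (c k) θ ≤ laplacianDet a b θ := by
  have h1 := (Complex.le_def.mp h).1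
  rw [Complex.ofReal_re] at h1
  exact h1.trans (Complex.re_le_norm _)

theorem exists_hasLogControl_laplacianDet (hn : 0 < n) (hfin : HasFiniteRanges a b) :
    ∃ K, 0 < K ∧ ∃ c : Fin K → Matrix (Fin d) (Fin d) ℤ, (∀ k, (c k).det ≠ 0) ∧
      (∀ θ, ∏ k, cayleyLaplacian (c k) θ ≤ laplacianDet a b θ) ∧
      HasLogControl (laplacianDet a b) (exceptionalSet c) (1 / (4 * K))
        (fun x : Fin K × Fin d => c x.1 x.2) := by
  obtain ⟨K, hK, c, hc, hle⟩ := exists_prod_le_det hn a b hfin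
  have hle' : ∀ θ, ∏ k, cayleyLaplacian (c k) θ ≤ laplacianDet a b θ :=
    fun θ => prod_cayleyLaplacian_le_laplacianDet (hle θ)
  exact ⟨K, hK, c, hc, hle', hasLogControl_of_prod_le (continuous_laplacianDet a b) hK hc hle'⟩

/-- The constant term of the charpoly is ± the determinant, so it is the trailing coefficient when
nonzero. -/
theorem norm_trailingCoeff_charpoly_of_det_ne_zero {m : Type*} [Fintype m] [DecidableEq m]
    {M : Matrix m m ℂ} (hM : M.det ≠ 0) : ‖M.charpoly.trailingCoeff‖ = ‖M.det‖ := by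
  have h := Matrix.det_eq_sign_charpoly_coeff M
  have h0 : M.charpoly.coeff 0 ≠ 0 := by
    intro h0
    rw [h0, mul_zero] at h
    exact hM h
  rw [Polynomial.trailingCoeff, Polynomial.natTrailingDegree_eq_zero.mpr (Or.inr h0), h, norm_mul]
  simp

theorem hasLogControl_cayleyLaplacian {c : Matrix (Fin d) (Fin d) ℤ} (hc : c.det ≠ 0) :
    HasLogControl (cayleyLaplacian c) (exceptionalSet fun _ : Fin 1 => c) (1 / (4 * (1 : ℕ)))
      (fun x : Fin 1 × Fin d => c x.2) :=
  hasLogControl_of_prod_le (continuous_cayleyLaplacian c) one_pos (fun _ => hc) (by simp)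

theorem cayleyLaplacian_eq_comp_torusHom (c : Matrix (Fin d) (Fin d) ℤ)
    (θ : UnitAddTorus (Fin d)) : cayleyLaplacian c θ = cayleyLaplacian 1 (torusHom c θ) := by
  have h : torusHom (1 : Matrix (Fin d) (Fin d) ℤ) (torusHom c θ) = torusHom c θ := by
    ext i
    rw [torusHom_apply, Finset.sum_eq_single i]
    · simp
    · intro j _ hj
      simp [Matrix.one_apply_ne hj.symm]
    · simp
  rw [cayleyLaplacian, cayleyLaplacian]
  refine Finset.sum_congr rfl fun i _ => ?_
  rw [mFourier_row, mFourier_row, h]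

/-- The integrand is the grid integrand composed with the measure-preserving map `torusHom c`. -/
theorem integral_log_cayleyLaplacian {c : Matrix (Fin d) (Fin d) ℤ} (hc : c.det ≠ 0) :
    ∫ θ, Real.log (cayleyLaplacian c θ) =
      ∫ θ : UnitAddTorus (Fin d), Real.log (cayleyLaplacian 1 θ) := by
  have h := measurePreserving_torusHom hc
  have hm : Measurable fun θ : UnitAddTorus (Fin d) => Real.log (cayleyLaplacian 1 θ) :=
    Real.measurable_log.comp (continuous_cayleyLaplacian 1).measurable
  have h1 := integral_map (μ := volume) h.measurable.aemeasurable hm.aestronglyMeasurable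
  rw [h.map_eq] at h1
  rw [h1]
  simp only [← cayleyLaplacian_eq_comp_torusHom]

/-- The logarithmic Mahler measure of a periodic graph with finitely many components is at least a
positive multiple of that of the grid. -/
theorem exists_mul_integral_log_le (hd : 1 ≤ d) (hn : 0 < n) (hfin : HasFiniteRanges a b) :
    ∃ K : ℕ, 0 < K ∧ K * ∫ θ : UnitAddTorus (Fin d), Real.log (cayleyLaplacian 1 θ) ≤
      ∫ θ, Real.log (laplacianDet a b θ) := by
  obtain ⟨K, hK, c, hc, hle, h⟩ := exists_hasLogControl_laplacianDet hn hfin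
  refine ⟨K, hK, ?_⟩
  have h1 : ∑ k, ∫ θ, Real.log (cayleyLaplacian (c k) θ) =
      K * ∫ θ : UnitAddTorus (Fin d), Real.log (cayleyLaplacian 1 θ) := by
    simp only [integral_log_cayleyLaplacian (hc _)]
    simp
  have hint : ∀ k, Integrable fun θ => Real.log (cayleyLaplacian (c k) θ) := fun k =>
    (hasLogControl_cayleyLaplacian (hc k)).integrable_log hd
  rw [← h1, ← integral_finsetSum _ fun k _ => hint k]
  refine integral_mono_ae (integrable_finsetSum _ fun k _ => hint k) (h.integrable_log hd) ?_
  filter_upwards [h.ae_notMem hd] with θ hθ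
  have hne : ∀ k, cayleyLaplacian (c k) θ ≠ 0 := fun k h0 =>
    hθ (Set.mem_iUnion.mpr ⟨k, cayleyLaplacian_eq_zero_iff.mp h0⟩)
  rw [← Real.log_prod fun k _ => hne k]
  exact Real.log_le_log (Finset.prod_pos fun k _ =>
    (cayleyLaplacian_nonneg _ _).lt_of_ne (hne k).symm) (hle θ)

end Determinant

/-! ### Growth rate and Mahler measure as the same integral -/

namespace Graph

variable {d n : ℕ} {V E ε : Type*} [AddAction (Fin d → ℤ) V] [AddAction (Fin d → ℤ) E]
  [Fintype ε] {G : Graph V E} {v : Fin n → V} {edge : ε → E} {a b : ε → Fin n × (Fin d → ℤ)}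

/-- The complexity growth rate exists and is the integral over the torus of the logarithm of the
absolute value of the Laplacian polynomial. -/
theorem IsPresentation.tendsto_normalizedLogComplexity (h : G.IsPresentation v edge a b)
    (hd : 1 ≤ d) (hn : 0 < n) (hfin : G.components.Finite) :
    Tendsto (normalizedLogComplexity h.cofinite) (minLengthAtTop d)
      (𝓝 (∫ θ, Real.log (laplacianDet a b θ))) := by
  classical
  obtain ⟨K, hK, c, hc, hle, hlog⟩ :=
    exists_hasLogControl_laplacianDet hn (h.hasFiniteRanges hfin)
  set Z := exceptionalSet c
  let g : UnitAddTorus (Fin d) → ℝ := fun θ => Real.log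
    ‖((coboundary a b θ).conjTranspose * coboundary a b θ).charpoly.trailingCoeff‖
  -- Trailing coefficient and determinant differ only on the finite set Z, which does not affect the
  -- limit of the averages.
  have hg : g = fun θ => Real.log (laplacianDet a b θ) +
      Z.indicator (fun θ => g θ - Real.log (laplacianDet a b θ)) θ := by
    funext θ
    by_cases hθ : θ ∈ Z
    · rw [Set.indicator_of_mem hθ]
      ring
    · rw [Set.indicator_of_notMem hθ, add_zero]
      have hpos := hlog.pos θ hθ
      simp only [g]
      rw [norm_trailingCoeff_charpoly_of_det_ne_zero (norm_pos_iff.mp hpos), laplacianDet]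
  have hlim : Tendsto (fun Λ => torusAverage Λ g) (minLengthAtTop d)
      (𝓝 (∫ θ, Real.log (laplacianDet a b θ))) := by
    have h1 := (hlog.tendsto_torusAverage_log hd).add (tendsto_torusAverage_indicator hd
      hlog.finite fun θ => g θ - Real.log (laplacianDet a b θ))
    rw [add_zero] at h1
    refine h1.congr' ?_
    filter_upwards [eventually_finiteIndex d] with Λ hΛ
    rw [← torusAverage_add, ← hg]
  -- The factor (n · index)^c between complexity and trailing coefficient costs c log(n · index) /
  -- index, which tends to 0.
  have herr : Tendsto (fun Λ : AddSubgroup (Fin d → ℤ) =>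
      G.components.ncard * (Real.log (n * Λ.index) / Λ.index)) (minLengthAtTop d) (𝓝 0) := by
    have h1 : Tendsto (fun x : ℝ => G.components.ncard * (Real.log (n * x) / x)) atTop (𝓝 0) := by
      have h2 : Tendsto (fun x : ℝ => Real.log x / x) atTop (𝓝 0) :=
        Real.isLittleO_log_id_atTop.tendsto_div_nhds_zero
      have hn' : (0 : ℝ) < n := by exact_mod_cast hn
      have h3 := ((h2.comp (tendsto_id.const_mul_atTop hn')).const_mul
        (n : ℝ)).const_mul (G.components.ncard : ℝ)
      rw [mul_zero, mul_zero] at h3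
      refine h3.congr fun x => ?_
      simp only [Function.comp_apply, id]
      field_simp
    exact h1.comp (tendsto_index hd)
  have hlow := hlim.sub herr
  rw [sub_zero] at hlow
  have hbounds : ∀ᶠ Λ in minLengthAtTop d,
      torusAverage Λ g - G.components.ncard * (Real.log (n * Λ.index) / Λ.index) ≤
        normalizedLogComplexity h.cofinite Λ ∧
      normalizedLogComplexity h.cofinite Λ ≤ torusAverage Λ g := by
    filter_upwards [eventually_finiteIndex d] with Λ hΛ
    have := AddSubgroup.finite_quotient_of_finiteIndex (H := Λ)
    have hidx : (0 : ℝ) < Λ.index := by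
      exact_mod_cast Nat.pos_of_ne_zero AddSubgroup.FiniteIndex.index_ne_zero
    have hn' : (0 : ℝ) < n := by exact_mod_cast hn
    obtain ⟨h1, h2, h3⟩ := h.complexity_quotientGraph hn hfin Λ
    rw [finprod_eq_prod_of_fintype] at h2 h3
    have hT : (0 : ℝ) < (quotientGraph h.cofinite Λ).complexity := by exact_mod_cast h1
    have hsum : torusAverage Λ g = Real.log (∏ ψ : AddChar ((Fin d → ℤ) ⧸ Λ) ℂ,
        ‖((coboundary a b (torusPoint ψ)).conjTranspose *
          coboundary a b (torusPoint ψ)).charpoly.trailingCoeff‖) / Λ.index := by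
      rw [torusAverage_eq_sum, Real.log_prod, smul_eq_mul, div_eq_inv_mul]
      intro ψ _
      rw [norm_ne_zero_iff, Ne, Polynomial.trailingCoeff_eq_zero]
      exact (Matrix.charpoly_monic _).ne_zero
    rw [hsum, normalizedLogComplexity]
    constructor
    · rw [sub_le_iff_le_add, ← mul_div_assoc, ← add_div]
      gcongr
      have h4 := Real.log_le_log (hT.trans_le h2) h3
      rw [Real.log_mul (by positivity) hT.ne', Real.log_pow] at h4
      linarith
    · gcongr
  exact tendsto_of_tendsto_of_tendsto_of_le_of_le' hlow hlim
    (hbounds.mono fun _ h => h.1) (hbounds.mono fun _ h => h.2)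

theorem IsPresentation.complexityGrowthRate_eq (h : G.IsPresentation v edge a b)
    (hd : 1 ≤ d) (hn : 0 < n) (hfin : G.components.Finite) :
    complexityGrowthRate h.cofinite = ∫ θ, Real.log (laplacianDet a b θ) :=
  have := minLengthAtTop_neBot hd
  (h.tendsto_normalizedLogComplexity hd hn hfin).limUnder_eq

theorem IsPresentation.norm_laurentEval_laplacianPolynomial [DecidableEq ε]
    (h : G.IsPresentation v edge a b) (θ : UnitAddTorus (Fin d)) :
    ‖laurentEval θ (G.laplacianPolynomial d v)‖ = laplacianDet a b θ := by
  rw [laplacianDet, ← h.map_laplacianMatrix, ← RingHom.map_det]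
  rfl

theorem IsPresentation.logAbsTorusEval_laplacianPolynomial [DecidableEq ε]
    (h : G.IsPresentation v edge a b) (θ : Fin d → ℝ) :
    logAbsTorusEval (G.laplacianPolynomial d v) θ =
      Real.log (laplacianDet a b fun i => (θ i : UnitAddCircle)) := by
  rw [logAbsTorusEval, torusEval_eq_laurentEval, h.norm_laurentEval_laplacianPolynomial]

theorem IsPresentation.laplacianPolynomial_ne_zero [DecidableEq ε]
    (h : G.IsPresentation v edge a b) (hd : 1 ≤ d) (hn : 0 < n) (hfin : G.components.Finite) :
    G.laplacianPolynomial d v ≠ 0 := by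
  obtain ⟨K, hK, c, hc, hle, hlog⟩ :=
    exists_hasLogControl_laplacianDet hn (h.hasFiniteRanges hfin)
  obtain ⟨θ, hθ⟩ := (hlog.ae_notMem hd).exists
  intro h0
  have h1 := h.norm_laurentEval_laplacianPolynomial θ
  rw [h0, map_zero, norm_zero] at h1
  exact (hlog.pos θ hθ).ne h1

theorem IsPresentation.integrableOn_logAbsTorusEval [DecidableEq ε]
    (h : G.IsPresentation v edge a b) (hd : 1 ≤ d) (hn : 0 < n) (hfin : G.components.Finite) :
    IntegrableOn (logAbsTorusEval (G.laplacianPolynomial d v)) (Set.Icc (0 : Fin d → ℝ) 1) := by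
  obtain ⟨K, hK, c, hc, hle, hlog⟩ :=
    exists_hasLogControl_laplacianDet hn (h.hasFiniteRanges hfin)
  have h1 := measurePreserving_cube.integrable_comp_of_integrable (hlog.integrable_log hd)
  rw [IntegrableOn, funext h.logAbsTorusEval_laplacianPolynomial]
  exact h1

theorem IsPresentation.logMahlerMeasureTorus_eq [DecidableEq ε]
    (h : G.IsPresentation v edge a b) :
    logMahlerMeasureTorus (G.laplacianPolynomial d v) = ∫ θ, Real.log (laplacianDet a b θ) := by
  have hm : Measurable fun θ => Real.log (laplacianDet a b θ) :=
    Real.measurable_log.comp (continuous_laplacianDet a b).measurable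
  rw [logMahlerMeasureTorus, funext h.logAbsTorusEval_laplacianPolynomial,
    ← measurePreserving_cube.map_eq, integral_map measurePreserving_cube.measurable.aemeasurable
      hm.aestronglyMeasurable]

theorem IsTransversal.pos [Nonempty V] (hv : IsTransversal d v) : 0 < n := by
  obtain ⟨⟨i, _⟩, _⟩ := hv.2 (Classical.arbitrary V)
  exact Fin.pos i

end Graph

/-! ### The grid graph -/

section Grid

variable (d : ℕ)

theorem gridGraph_isPresentation :
    (gridGraph d).IsPresentation (fun _ : Fin 1 => (0 : Fin d → ℤ))
      (fun i : Fin d => (⟨0, i⟩ : GridEdge d)) (fun _ => (0, 0))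
      (fun i => (0, Pi.single i 1)) where
  cofinite := gridGraph_isCofiniteFree d
  transversal := by
    constructor
    · rintro ⟨i, s⟩ ⟨j, t⟩ h
      have h' : s + 0 = t + 0 := h
      rw [add_zero, add_zero] at h'
      exact Prod.ext (Subsingleton.elim _ _) h'
    · intro x
      exact ⟨(0, x), add_zero x⟩
  bijective := by
    constructor
    · rintro ⟨i, s⟩ ⟨j, t⟩ h
      have h1 : s + 0 = t + 0 := congrArg GridEdge.base h
      have h2 : i = j := congrArg GridEdge.dir h
      rw [add_zero, add_zero] at h1
      exact Prod.ext h2 h1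
    · rintro ⟨x, i⟩
      exact ⟨(i, x), GridEdge.ext (add_zero x) rfl⟩
  isLink i := Or.inl ⟨add_zero 0, (add_zero _).trans (zero_add _).symm⟩

theorem gridGraph_reachable (x s : Fin d → ℤ) : (gridGraph d).Reachable x (x + s) := by
  -- The shifts that join every vertex to its translate form a subgroup, which contains the standard
  -- basis vectors.
  let S : AddSubgroup (Fin d → ℤ) :=
    { carrier := {s | ∀ x, (gridGraph d).Reachable x (x + s)}
      zero_mem' := fun x => by
        rw [add_zero]
        exact Relation.ReflTransGen.refl
      add_mem' := fun {s t} hs ht x => by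
        rw [← add_assoc]
        exact (hs x).trans (ht (x + s))
      neg_mem' := fun {s} hs x => by
        have := (hs (x + -s)).symm
        rwa [neg_add_cancel_right] at this }
  have h1 : ∀ i, Pi.single i 1 ∈ S := fun i x =>
    Relation.ReflTransGen.single ⟨⟨x, i⟩, Or.inl ⟨rfl, rfl⟩⟩
  have h2 : s ∈ S := by
    have : s = ∑ i, s i • (Pi.single i 1 : Fin d → ℤ) := by
      ext j
      simp [Finset.sum_apply, Pi.single_apply]
    rw [this]
    exact sum_mem fun i _ => zsmul_mem (h1 i) _
  exact h2 x

theorem gridGraph_components_finite : (gridGraph d).components.Finite := by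
  refine (Set.finite_singleton (Set.univ : Set (Fin d → ℤ))).subset ?_
  rintro _ ⟨x, _, rfl⟩
  refine Set.mem_singleton_iff.mpr (Set.eq_univ_of_forall fun y => ?_)
  have := gridGraph_reachable d x (y - x)
  rwa [add_sub_cancel] at this

theorem laplacianDet_grid (θ : UnitAddTorus (Fin d)) :
    laplacianDet (fun _ : Fin d => ((0 : Fin 1), (0 : Fin d → ℤ)))
      (fun i => (0, Pi.single i 1)) θ = cayleyLaplacian 1 θ := by
  have h : ((coboundary (fun _ : Fin d => ((0 : Fin 1), (0 : Fin d → ℤ)))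
      (fun i => (0, Pi.single i 1)) θ).conjTranspose *
      coboundary (fun _ : Fin d => ((0 : Fin 1), (0 : Fin d → ℤ)))
        (fun i => (0, Pi.single i 1)) θ).det = (cayleyLaplacian 1 θ : ℂ) := by
    rw [Matrix.det_fin_one, Matrix.mul_apply, cayleyLaplacian, Complex.ofReal_sum]
    refine Finset.sum_congr rfl fun i _ => ?_
    have hrow : (1 : Matrix (Fin d) (Fin d) ℤ) i = Pi.single i 1 := by
      ext j
      rw [Matrix.one_eq_pi_single]
    rw [hrow, Matrix.conjTranspose_apply, Complex.star_def, Complex.conj_mul', coboundary,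
      Matrix.of_apply, if_pos rfl, if_pos rfl, UnitAddTorus.mFourier_zero, ContinuousMap.one_apply]
    push_cast
    rfl
  rw [laplacianDet, h, Complex.norm_real, Real.norm_of_nonneg (cayleyLaplacian_nonneg _ _)]

/-- The integral is the growth rate of the grid, a limit of nonnegative numbers because the
logarithm of a natural number is nonnegative. -/
theorem integral_log_cayleyLaplacian_one_nonneg {d : ℕ} (hd : 1 ≤ d) :
    0 ≤ ∫ θ : UnitAddTorus (Fin d), Real.log (cayleyLaplacian 1 θ) := by
  have := minLengthAtTop_neBot hd
  have h := (gridGraph_isPresentation d).tendsto_normalizedLogComplexity hd one_pos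
    (gridGraph_components_finite d)
  simp only [laplacianDet_grid] at h
  refine ge_of_tendsto' h fun Λ => ?_
  exact div_nonneg (Real.log_natCast_nonneg _) (Nat.cast_nonneg _)

end Grid

/-- `G` has cofinite free `ℤ ^ d`-symmetry and finitely many connected components. The limits that
define the growth rates `γ(G)` and `γ(𝔾_d)` exist and `γ(𝔾_d) ≤ γ(G)`; for any choice of orbit
representatives, the Laplacian polynomial `Δ(G)` and `Δ(𝔾_d)` are nonzero, the integrals that define
their Mahler measures converge, and `m(Δ(𝔾_d)) ≤ m(Δ(G))`. -/
theorem theorem3p10 {d : ℕ} (hd : 1 ≤ d) {V E : Type*} [Nonempty V]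
    [AddAction (Fin d → ℤ) V] [AddAction (Fin d → ℤ) E]
    (G : Graph V E) (hG : G.IsCofiniteFree d) (hfin : G.components.Finite) :
    (Tendsto (Graph.normalizedLogComplexity hG) (Graph.minLengthAtTop d)
        (𝓝 (Graph.complexityGrowthRate hG)) ∧
      Tendsto (Graph.normalizedLogComplexity (gridGraph_isCofiniteFree d)) (Graph.minLengthAtTop d)
        (𝓝 (Graph.complexityGrowthRate (gridGraph_isCofiniteFree d))) ∧
      Graph.complexityGrowthRate (gridGraph_isCofiniteFree d) ≤ Graph.complexityGrowthRate hG) ∧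
    ∀ (n : ℕ) (v : Fin n → V), Graph.IsTransversal d v →
      G.laplacianPolynomial d v ≠ 0 ∧ gridLaplacianPolynomial d ≠ 0 ∧
      IntegrableOn (logAbsTorusEval (G.laplacianPolynomial d v)) (Set.Icc (0 : Fin d → ℝ) 1) ∧
      IntegrableOn (logAbsTorusEval (gridLaplacianPolynomial d)) (Set.Icc (0 : Fin d → ℝ) 1) ∧
      logMahlerMeasureTorus (gridLaplacianPolynomial d) ≤
        logMahlerMeasureTorus (G.laplacianPolynomial d v) := by
  have hgrid := gridGraph_isPresentation d
  have hgridfin := gridGraph_components_finite d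
  have hcompare : ∀ {n m : ℕ} {v : Fin n → V} {edge : Fin m → E}
      {a b : Fin m → Fin n × (Fin d → ℤ)}, G.IsPresentation v edge a b →
      ∫ θ, Real.log (laplacianDet (fun _ : Fin d => ((0 : Fin 1), (0 : Fin d → ℤ)))
        (fun i => (0, Pi.single i 1)) θ) ≤ ∫ θ, Real.log (laplacianDet a b θ) := by
    intro n m v edge a b h
    obtain ⟨K, hK, hle⟩ :=
      exists_mul_integral_log_le hd h.transversal.pos (h.hasFiniteRanges hfin)
    simp only [laplacianDet_grid]
    refine le_trans ?_ hle
    -- The factor K ≥ 1 can be dropped because the grid integral is nonnegative.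
    exact le_mul_of_one_le_left (integral_log_cayleyLaplacian_one_nonneg hd) (by exact_mod_cast hK)
  refine ⟨?_, fun n v hv => ?_⟩
  · obtain ⟨n, v, hv⟩ := hG.exists_isTransversal
    obtain ⟨m, edge, a, b, h⟩ := hG.exists_isPresentation hv
    rw [h.complexityGrowthRate_eq hd hv.pos hfin, hgrid.complexityGrowthRate_eq hd one_pos hgridfin]
    exact ⟨h.tendsto_normalizedLogComplexity hd hv.pos hfin,
      hgrid.tendsto_normalizedLogComplexity hd one_pos hgridfin, hcompare h⟩
  · obtain ⟨m, edge, a, b, h⟩ := hG.exists_isPresentation hv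
    refine ⟨h.laplacianPolynomial_ne_zero hd hv.pos hfin,
      hgrid.laplacianPolynomial_ne_zero hd one_pos hgridfin,
      h.integrableOn_logAbsTorusEval hd hv.pos hfin,
      hgrid.integrableOn_logAbsTorusEval hd one_pos hgridfin, ?_⟩
    rw [h.logMahlerMeasureTorus_eq, gridLaplacianPolynomial, hgrid.logMahlerMeasureTorus_eq]
    exact hcompare h
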